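/- A polygon means a simple polygon in the plane. Two vertices of a polygon are visible if the closed segment joining them is contained in the closed polygon. A polygon is deflated if no two distinct edges of its visibility graph, drawn as open segments, intersect. A deformation of a polygon $P$ moves each vertex $v$ along a continuous path $t\mapsto v^t$, $t\in[0,1]$, with $v^0=v$, such that for every $t$ the polygon $P^t$, obtained by joining the points $v^t$ as the corresponding vertices are joined in $P$, is simple. It is monotonic if there are no vertices $u,v$ and no times $s<t$ such that $u^t,v^t$ are visible in $P^t$ but $u^s,v^s$ are not visible in $P^s$. A triangulation $T$ of a polygon is a partition of it into triangles whose vertices are vertices of the polygon; a deflated polygon has exactly one. The directed dual of $T$ is the partially directed plane tree with a triangle node for each triangle of $T$ and a terminal node for each polygon edge; two nodes are adjacent if the corresponding triangles or polygon edges share an edge; the neighbours of a triangle node have the counter-clockwise order of the corresponding edges of the triangle; and the edge between the nodes of adjacent triangles $a,b$ is directed $a\to b$ if $(a,b)$ is right-reflex, i.e. if the quadrilateral $a\cup b$ has a reflex vertex on the right-hand side of a segment that leads from $a$ to $b$ inside the open quadrilateral. **Theorem.** Let $P$ and $P'$ be deflated polygons that have the same directed dual; that is, let $\varphi$ be an isomorphism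 from the directed dual of (the triangulation of) $P$ to that of $P'$, preserving adjacency, counter-clockwise orders and edge directions. Then $P$ can be monotonically deformed into $P'$: there is a monotonic deformation $t\mapsto P^t$ of $P$ with $P^1=P'$, in which each polygon edge of $P$ ends at the polygon edge of $P'$ that corresponds to it under $\varphi$. -/

import Mathlib

open scoped BigOperators

namespace Polygon

variable {n : ℕ}

/-- Twice the signed area of the triangle `a b c` in the plane `ℂ`. It is positive exactly when
`(a, b, c)` is a left turn (counter-clockwise) and negative exactly when it is a right turn. -/
noncomputable def orient (a b c : ℂ) : ℝ :=
  (b - a).re * (c - a).im - (b - a).im * (c - a).re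

/-- A polygon with at least three vertices is simple if its closed boundary curve has no
self-intersection: the half-open edges, parametrized over `[0, 1)`, trace every boundary point
exactly once. -/
def IsSimple (P : Polygon ℂ n) : Prop :=
  3 ≤ n ∧ ∀ i j : Fin n, ∀ s ∈ Set.Ico (0 : ℝ) 1, ∀ t ∈ Set.Ico (0 : ℝ) 1,
    P.edgePath ℝ i s = P.edgePath ℝ j t → i = j ∧ s = t

/-- The winding number of the boundary curve about a point `x` off the boundary: the total signed
angle swept by the ray from `x` to a point that runs along the boundary, in full turns. (Each edge
is seen from `x` under a signed angle in `(-π, π)`, which is the argument below.) -/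
noncomputable def windingNumber (P : Polygon ℂ n) (x : ℂ) : ℝ :=
  (∑ i : Fin n, Complex.arg ((P (finRotate n i) - x) / (P i - x))) / (2 * Real.pi)

/-- The open polygon: the points enclosed by the boundary curve. -/
def openRegion (P : Polygon ℂ n) : Set ℂ :=
  {x | x ∉ P.boundary ℝ ∧ P.windingNumber x ≠ 0}

/-- The closed polygon: the open polygon together with its boundary. -/
def closedRegion (P : Polygon ℂ n) : Set ℂ :=
  P.boundary ℝ ∪ P.openRegion

/-- Two vertices see each other if the closed segment joining them lies in the closed polygon. -/
def Visible (P : Polygon ℂ n) (i j : Fin n) : Prop :=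
  segment ℝ (P i) (P j) ⊆ P.closedRegion

/-- The visibility graph, on the indices of the vertices. The edge `s(i, j)` is drawn as the open
segment between the vertices `P i` and `P j`. -/
def visibilityGraph (P : Polygon ℂ n) : SimpleGraph (Fin n) where
  Adj i j := i ≠ j ∧ P.Visible i j
  symm := ⟨fun i j h => ⟨h.1.symm, by
    have h2 := h.2
    unfold Visible at h2 ⊢
    rwa [segment_symm]⟩⟩
  loopless := ⟨fun _ h => h.1 rfl⟩

/-- A polygon is deflated if no two distinct edges of its visibility graph, drawn as open
segments, intersect. -/
def IsDeflated (P : Polygon ℂ n) : Prop :=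
  ∀ i j k l : Fin n, P.visibilityGraph.Adj i j → P.visibilityGraph.Adj k l → s(i, j) ≠ s(k, l) →
    Disjoint (openSegment ℝ (P i) (P j)) (openSegment ℝ (P k) (P l))

/-- A deformation of `P`: the vertices move continuously during the time interval `[0, 1]`,
starting from those of `P`, and the polygon is simple at all times. -/
def IsDeformation (P : Polygon ℂ n) (γ : unitInterval → Polygon ℂ n) : Prop :=
  γ 0 = P ∧ (∀ i : Fin n, Continuous fun t => γ t i) ∧ ∀ t, (γ t).IsSimple

/-- A monotonic deformation: no two vertices ever become visible. -/
def IsMonotonicDeformation (P : Polygon ℂ n) (γ : unitInterval → Polygon ℂ n) : Prop :=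
  P.IsDeformation γ ∧ ∀ s t : unitInterval, s < t → ∀ i j : Fin n,
    (γ t).Visible i j → (γ s).Visible i j

/-- The closed triangle (convex hull) spanned by the vertices with index in `t`. -/
def hull (P : Polygon ℂ n) (t : Finset (Fin n)) : Set ℂ :=
  convexHull ℝ (P '' (t : Set (Fin n)))

/-- A triangulation: a partition of the closed polygon into nondegenerate triangles whose vertices
are vertices of the polygon. A triangle is given by the set of the indices of its vertices. -/
structure IsTriangulation (P : Polygon ℂ n) (T : Finset (Finset (Fin n))) : Prop where
  card_eq : ∀ t ∈ T, t.card = 3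
  nondegenerate : ∀ t ∈ T, AffineIndependent ℝ (fun i : t => P i)
  disjoint : ∀ t ∈ T, ∀ t' ∈ T, t ≠ t' → Disjoint (interior (P.hull t)) (interior (P.hull t'))
  cover : ⋃ t ∈ T, P.hull t = P.closedRegion

end Polygon

/-- A partially directed plane graph: a graph, the counter-clockwise order of the neighbours around
each node (`ccw x a b c` says that the neighbours `a`, `b`, `c` of `x` occur in this
counter-clockwise cyclic order around `x`), and directions on some of the edges (`arc a b` says
that the edge `{a, b}` is directed `a → b`). -/
structure PartiallyDirectedPlaneGraph (N : Type) where
  graph : SimpleGraph N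
  ccw : N → N → N → N → Prop
  arc : N → N → Prop

/-- An identification of two partially directed plane graphs: a bijection of the nodes that
preserves adjacency, counter-clockwise orders, and edge directions. -/
structure PartiallyDirectedPlaneGraph.Iso {N N' : Type}
    (D : PartiallyDirectedPlaneGraph N) (D' : PartiallyDirectedPlaneGraph N') extends N ≃ N' where
  map_adj : ∀ a b, D'.graph.Adj (toFun a) (toFun b) ↔ D.graph.Adj a b
  map_ccw : ∀ x a b c, D'.ccw (toFun x) (toFun a) (toFun b) (toFun c) ↔ D.ccw x a b c
  map_arc : ∀ a b, D'.arc (toFun a) (toFun b) ↔ D.arc a b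

namespace Polygon

variable {n : ℕ}

/-- The nodes of the dual tree: a triangle node for each triangle of the triangulation and
a terminal node for each polygon edge (the polygon edge `i` joins the vertex `i` to the next). -/
abbrev DualNode (T : Finset (Finset (Fin n))) : Type := {t // t ∈ T} ⊕ Fin n

/-- The edges of the triangulation that belong to the correspondent of a node: the three edges of
a triangle, or the single polygon edge of a terminal node. -/
def nodeEdges {T : Finset (Finset (Fin n))} : DualNode T → Set (Sym2 (Fin n))
  | Sum.inl t => {e | ¬ e.IsDiag ∧ ∀ v ∈ e, v ∈ t.1}
  | Sum.inr i => {s(i, finRotate n i)}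

/-- The dual tree as a graph: two nodes are adjacent if their correspondents share an edge. -/
def dualGraph (T : Finset (Finset (Fin n))) : SimpleGraph (DualNode T) where
  Adj x y := x ≠ y ∧ (nodeEdges x ∩ nodeEdges y).Nonempty
  symm := ⟨fun x y h => ⟨h.1.symm, by rw [Set.inter_comm]; exact h.2⟩⟩
  loopless := ⟨fun _ h => h.1 rfl⟩

/-- The counter-clockwise order around nodes of the dual tree: the neighbours of the node of a
triangle have the counter-clockwise order of the edges that they share with the triangle. A
terminal node has only one neighbour. -/
def dualCcw (P : Polygon ℂ n) (T : Finset (Finset (Fin n))) (x a b c : DualNode T) : Prop :=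
  (dualGraph T).Adj x a ∧ (dualGraph T).Adj x b ∧ (dualGraph T).Adj x c ∧
    ∃ t : {t // t ∈ T}, x = Sum.inl t ∧ ∃ u v w : Fin n, t.1 = {u, v, w} ∧
      0 < orient (P u) (P v) (P w) ∧
      s(u, v) ∈ nodeEdges a ∧ s(v, w) ∈ nodeEdges b ∧ s(w, u) ∈ nodeEdges c

/-- The ordered pair `(a, b)` of adjacent triangles is right-reflex: with `v w` the shared edge,
`u` the third vertex of `a` and `z` the third vertex of `b`, where `v` is on the right-hand side of
the way from `a` to `b` through the shared edge (`(u, v, w)` is a left turn), the quadrilateral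
union, with counter-clockwise boundary `u v z w`, is reflex at `v` (`(u, v, z)` is a right turn). -/
def RightReflex (P : Polygon ℂ n) (a b : Finset (Fin n)) : Prop :=
  ∃ u v w z : Fin n, a = {u, v, w} ∧ b = {v, w, z} ∧
    0 < orient (P u) (P v) (P w) ∧ orient (P u) (P v) (P z) < 0

/-- The directed dual of a triangulation `T` of `P`: the dual tree, with the edge that joins the
nodes of `a` and `b` directed `a → b` for every right-reflex pair `(a, b)` of adjacent triangles. -/
def directedDual (P : Polygon ℂ n) (T : Finset (Finset (Fin n))) :
    PartiallyDirectedPlaneGraph (DualNode T) where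
  graph := dualGraph T
  ccw := P.dualCcw T
  arc x y := (dualGraph T).Adj x y ∧
    ∃ a b : {t // t ∈ T}, x = Sum.inl a ∧ y = Sum.inl b ∧ P.RightReflex a.1 b.1

/-- A bijection `e` between the vertices of two polygons corresponds to the identification `φ` of
their directed duals: the terminal node of every polygon edge of the first is sent by `φ` to the
terminal node of the polygon edge of the second that joins the images of its endpoints. -/
def Corresponds {m : ℕ} {T : Finset (Finset (Fin n))} {T' : Finset (Finset (Fin m))}
    {P : Polygon ℂ n} {P' : Polygon ℂ m}
    (φ : (P.directedDual T).Iso (P'.directedDual T')) (e : Fin n ≃ Fin m) : Prop :=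
  ∀ i : Fin n, ∃ j : Fin m, φ.toEquiv (Sum.inr i) = Sum.inr j ∧
    s(e i, e (finRotate n i)) = s(j, finRotate m j)

end Polygon

/-! A triangulation is treated as an abstract complex of labelled triangles, together with the
information at which end of each inner edge the union of the two adjacent triangles is reflex. A
placement of the vertices is a realization (`Realizes`) if all triangles are counter-clockwise, meet
only in common faces, and have the prescribed reflex vertices. The proof rests on three facts.

Deflated polygons are realizations. A visible open segment crosses no side of a triangle, so it
meets only triangles of which it is a side; hence the triangles form a complex, which unfolds into a
binary tree over a polygon edge (`Deflated.exists_tree`). Adjacent triangles with convex union would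
have crossing visible diagonals (`Deflated.reflex`). An isomorphism of the directed duals identifies
the trees and the reflex vertices (`Chart.match`). The necessary plane topology (inside and outside
at an edge, separation by a chord) is obtained by counting signed angles
(`PerSimple.edgeSweep_sign`, `wind_add`).

All realizations have the same visibility graph. Two vertices see each other only if they share a
triangle (`exists_common_triangle`): when one looks out of a triangle through a side, the reflex
vertex hides one of the two further sides, and at the other one the same situation recurs. A
realization bounds a simple polygon that is the union of its triangles, so a path of realizations is
a deformation along which visibility never changes.

Any two realizations are joined by a path of realizations (`joinedIn_realizes`), by induction on the
number of triangles. Take an ear with tip `u` over `v w` whose union with the next triangle `v o w`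
is reflex at `v`. Shrink it towards `v`, turn it to a direction near the extension of `o v` beyond
`v`, let it follow the motion of the rest given by induction, and undo the turn and the shrinking.
The crux is that this direction is free in every realization (`fan_side`). In the given polygon the
ear shows that the fan at `v` beyond `v o` spans less than a half turn, so its adjacent pairs are
not reflex at `v`. They are thus reflex at the outer ends of their common edges, which keeps the fan
on one side of the line `o v` in all realizations. Ears that are reflex at `w` are treated in the
mirror image. -/

namespace Polygon

/-! ### Orientation and triangles in the plane -/

theorem orient_rot (a b c : ℂ) : orient a b c = orient b c a := by
  simp only [orient, Complex.sub_re, Complex.sub_im]; ring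

theorem orient_swap (a b c : ℂ) : orient a c b = -orient a b c := by
  simp only [orient, Complex.sub_re, Complex.sub_im]; ring

theorem orient_swap' (a b c : ℂ) : orient b a c = -orient a b c := by
  simp only [orient, Complex.sub_re, Complex.sub_im]; ring

theorem orient_self_left (a b : ℂ) : orient a b a = 0 := by
  simp only [orient, Complex.sub_re, Complex.sub_im]; ring

theorem orient_self_right (a b : ℂ) : orient a b b = 0 := by
  simp only [orient, Complex.sub_re, Complex.sub_im]; ring

theorem orient_combo (a b x y : ℂ) {s t : ℝ} (h : s + t = 1) :
    orient a b (s • x + t • y) = s * orient a b x + t * orient a b y := by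
  obtain rfl : s = 1 - t := by linarith
  simp only [orient, Complex.sub_re, Complex.sub_im, Complex.add_re, Complex.add_im,
    Complex.real_smul, Complex.re_ofReal_mul, Complex.im_ofReal_mul]; ring

theorem orient_sum (a b c x : ℂ) :
    orient x b c + orient a x c + orient a b x = orient a b c := by
  simp only [orient, Complex.sub_re, Complex.sub_im]; ring

theorem orient_continuous : Continuous fun z : ℂ × ℂ × ℂ => orient z.1 z.2.1 z.2.2 := by
  unfold orient; fun_prop

theorem continuous_orient {X : Type*} [TopologicalSpace X] {f g h : X → ℂ} (hf : Continuous f)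
    (hg : Continuous g) (hh : Continuous h) : Continuous fun x => orient (f x) (g x) (h x) :=
  orient_continuous.comp (hf.prodMk (hg.prodMk hh))

theorem convex_orient_nonneg (a b : ℂ) : Convex ℝ {x | 0 ≤ orient a b x} := by
  intro x hx y hy s t hs ht hst
  simp only [Set.mem_ofPred_eq] at *
  rw [orient_combo a b x y hst]; positivity

theorem convex_orient_nonpos (a b : ℂ) : Convex ℝ {x | orient a b x ≤ 0} := by
  intro x hx y hy s t hs ht hst
  simp only [Set.mem_ofPred_eq] at *
  rw [orient_combo a b x y hst]; nlinarith

/-- Cramer's rule: barycentric coordinates are ratios of signed areas. -/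
theorem eq_combo (a b c x : ℂ) (h : orient a b c ≠ 0) :
    x = (orient x b c / orient a b c) • a + (orient a x c / orient a b c) • b +
      (orient a b x / orient a b c) • c := by
  apply Complex.ext <;>
  simp only [Complex.add_re, Complex.add_im, Complex.real_smul, Complex.re_ofReal_mul,
    Complex.im_ofReal_mul] <;> field_simp <;>
  simp only [orient, Complex.sub_re, Complex.sub_im] <;> ring

theorem mem_triangle {a b c x : ℂ} (h : 0 < orient a b c) :
    x ∈ convexHull ℝ {a, b, c} ↔ 0 ≤ orient a b x ∧ 0 ≤ orient b c x ∧ 0 ≤ orient c a x := by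
  constructor
  · intro hx
    have h1 : convexHull ℝ {a, b, c} ⊆
        {x | 0 ≤ orient a b x} ∩ {x | 0 ≤ orient b c x} ∩ {x | 0 ≤ orient c a x} := by
      apply convexHull_min
      · rintro y (rfl | rfl | rfl)
        · simp only [Set.mem_inter_iff, Set.mem_ofPred_eq, orient_self_left, orient_self_right,
            ← orient_rot y b c, h.le]; simp
        · simp only [Set.mem_inter_iff, Set.mem_ofPred_eq, orient_self_left, orient_self_right,
            orient_rot c a y, h.le]; simp
        · simp only [Set.mem_inter_iff, Set.mem_ofPred_eq, orient_self_left, orient_self_right,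
            h.le]; simp
      · exact ((convex_orient_nonneg a b).inter (convex_orient_nonneg b c)).inter
          (convex_orient_nonneg c a)
    obtain ⟨⟨h1, h2⟩, h3⟩ := h1 hx
    exact ⟨h1, h2, h3⟩
  · rintro ⟨h1, h2, h3⟩
    have e1 : orient x b c = orient b c x := orient_rot _ _ _
    have e2 : orient a x c = orient c a x := by rw [orient_rot c a x]
    have key := (convex_convexHull ℝ {a, b, c}).sum_mem (t := (Finset.univ : Finset (Fin 3)))
      (w := ![orient x b c / orient a b c, orient a x c / orient a b c,
        orient a b x / orient a b c]) (z := ![a, b, c]) ?_ ?_ ?_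
    · rw [eq_combo a b c x h.ne']
      simpa [Fin.sum_univ_three] using key
    · intro i _; fin_cases i <;> simp [e1, e2] <;> positivity
    · have := orient_sum a b c x
      simp only [Fin.sum_univ_three, Matrix.cons_val_zero, Matrix.cons_val_one, Matrix.cons_val]
      field_simp; exact this
    · intro i _; fin_cases i <;> exact subset_convexHull ℝ _ (by simp)

theorem mem_segment_of_orient {a b c x : ℂ} (h : 0 < orient a b c)
    (hx : x ∈ convexHull ℝ {a, b, c}) (h0 : orient a b x = 0) : x ∈ segment ℝ a b := by
  obtain ⟨h1, h2, h3⟩ := (mem_triangle h).1 hx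
  have e1 : orient x b c = orient b c x := orient_rot _ _ _
  have e2 : orient a x c = orient c a x := by rw [orient_rot c a x]
  have e := eq_combo a b c x h.ne'
  rw [h0, zero_div, zero_smul, add_zero] at e
  refine ⟨orient x b c / orient a b c, orient a x c / orient a b c, by rw [e1]; positivity,
    by rw [e2]; positivity, ?_, e.symm⟩
  have := orient_sum a b c x
  field_simp; linarith

theorem mem_interior_triangle {a b c x : ℂ} (h : 0 < orient a b c) :
    x ∈ interior (convexHull ℝ {a, b, c}) ↔
      0 < orient a b x ∧ 0 < orient b c x ∧ 0 < orient c a x := by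
  have aux : ∀ a b c : ℂ, 0 < orient a b c → x ∈ interior (convexHull ℝ {a, b, c}) →
      0 < orient a b x := by
    intro a b c h hx
    have h1 := ((mem_triangle h).1 (interior_subset hx)).1
    refine lt_of_le_of_ne h1 fun h0 => ?_
    -- A point with `orient a b x = 0` leaves the triangle when it is pushed in the direction `a -
    -- c`, away from `c`.
    have hc : Continuous fun ε : ℝ => x + ε • (a - c) := by fun_prop
    have hev : ∀ᶠ ε : ℝ in nhds 0, x + ε • (a - c) ∈ interior (convexHull ℝ {a, b, c}) :=
      hc.continuousAt.eventually_mem (isOpen_interior.mem_nhds (by simpa using hx))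
    obtain ⟨ε, hε, hε0⟩ := (hev.filter_mono nhdsWithin_le_nhds |>.and
      (self_mem_nhdsWithin : Set.Ioi (0:ℝ) ∈ nhdsWithin 0 (Set.Ioi 0))).exists
    have h2 := ((mem_triangle h).1 (interior_subset hε)).1
    have h3 : orient a b (x + ε • (a - c)) = orient a b x - ε * orient a b c := by
      simp only [orient, Complex.sub_re, Complex.sub_im, Complex.add_re, Complex.add_im,
        Complex.real_smul, Complex.re_ofReal_mul, Complex.im_ofReal_mul]; ring
    rw [h3, ← h0] at h2
    have : 0 < ε * orient a b c := mul_pos hε0 h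
    linarith
  constructor
  · intro hx
    refine ⟨aux a b c h hx, aux b c a (by rwa [← orient_rot]) ?_,
      aux c a b (by rwa [orient_rot]) ?_⟩
    · rwa [show ({b, c, a} : Set ℂ) = {a, b, c} by ext; simp; tauto]
    · rwa [show ({c, a, b} : Set ℂ) = {a, b, c} by ext; simp; tauto]
  · intro hx
    have ho : IsOpen {y | 0 < orient a b y ∧ 0 < orient b c y ∧ 0 < orient c a y} := by
      have := fun a b : ℂ => isOpen_lt (continuous_const (y := (0 : ℝ)))
        (continuous_orient (continuous_const (y := a)) (continuous_const (y := b)) continuous_id)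
      exact (this a b).inter ((this b c).inter (this c a))
    refine mem_interior.2 ⟨_, fun y hy => (mem_triangle h).2 ?_, ho, hx⟩
    exact ⟨hy.1.le, hy.2.1.le, hy.2.2.le⟩

/-- If the area vanishes and `a ≠ b`, then `(c - a) / (b - a)` is real, which puts `c` on the line
`a b`. -/
theorem orient_ne_zero_of_affineIndependent {a b c : ℂ} (h : AffineIndependent ℝ ![a, b, c]) :
    orient a b c ≠ 0 := by
  intro h0
  rw [affineIndependent_iff_not_collinear_set] at h
  apply h
  rw [collinear_iff_of_mem (p₀ := a) (by simp)]
  by_cases hb : b = a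
  · refine ⟨c - a, ?_⟩
    rintro p (rfl | rfl | rfl)
    · exact ⟨0, by simp⟩
    · exact ⟨0, by simp [hb]⟩
    · exact ⟨1, by simp⟩
  · refine ⟨b - a, ?_⟩
    rintro p (rfl | rfl | rfl)
    · exact ⟨0, by simp⟩
    · exact ⟨1, by simp⟩
    · have hba : b - a ≠ 0 := sub_ne_zero.2 hb
      refine ⟨((p - a) / (b - a)).re, ?_⟩
      have him : ((p - a) / (b - a)).im = 0 := by
        simp only [orient] at h0
        rw [Complex.div_im, ← sub_div, div_eq_zero_iff]; left; linarith
      have : ((((p - a) / (b - a)).re : ℝ) : ℂ) = (p - a) / (b - a) := by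
        apply Complex.ext <;> simp [him]
      simp only [vadd_eq_add, Complex.real_smul, this]
      field_simp; ring

theorem affineIndependent_of_orient_ne_zero {a b c : ℂ} (h : orient a b c ≠ 0) :
    AffineIndependent ℝ ![a, b, c] := by
  rw [affineIndependent_iff_not_collinear_set]
  intro hc
  obtain ⟨v, hv⟩ := (collinear_iff_of_mem (p₀ := a) (by simp)).1 hc
  obtain ⟨r, hr⟩ := hv b (by simp)
  obtain ⟨s, hs⟩ := hv c (by simp)
  apply h
  rw [hr, hs]
  simp only [orient, vadd_eq_add, Complex.sub_re, Complex.sub_im, Complex.add_re, Complex.add_im,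
        Complex.real_smul, Complex.re_ofReal_mul, Complex.im_ofReal_mul]; ring

/-! ### Faces of labelled triangles -/

/-- The convex hull of the points with labels in `t`. -/
def lhull {V : Type*} (R : V → ℂ) (t : Finset V) : Set ℂ := convexHull ℝ (R '' t)

variable {V : Type*}

theorem lhull_triple [DecidableEq V] (R : V → ℂ) (a b c : V) :
    lhull R {a, b, c} = convexHull ℝ {R a, R b, R c} := by
  unfold lhull; congr 1; ext; simp [eq_comm]

theorem lhull_pair [DecidableEq V] (R : V → ℂ) (a b : V) : lhull R {a, b} = segment ℝ (R a) (R b) := by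
  rw [← convexHull_pair]
  unfold lhull; congr 1; ext; simp [eq_comm]

theorem lhull_singleton (R : V → ℂ) (a : V) : lhull R {a} = {R a} := by
  simp [lhull]

theorem lhull_mono (R : V → ℂ) {s t : Finset V} (h : s ⊆ t) : lhull R s ⊆ lhull R t :=
  convexHull_mono (Set.image_mono (by exact_mod_cast h))

theorem mem_lhull (R : V → ℂ) {t : Finset V} {a : V} (h : a ∈ t) : R a ∈ lhull R t :=
  subset_convexHull ℝ _ ⟨a, h, rfl⟩

theorem isClosed_lhull (R : V → ℂ) (t : Finset V) : IsClosed (lhull R t) :=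
  ((t.finite_toSet.image R).isCompact_convexHull (𝕜 := ℝ)).isClosed

/-- Hulls of subsets of an affinely independent set intersect in the hull of the common subset. The
case of disjoint faces is included, with an empty hull. -/
theorem lhull_inter [DecidableEq V] {R : V → ℂ} {a b c : V} (h : orient (R a) (R b) (R c) ≠ 0) {s t : Finset V}
    (hs : s ⊆ {a, b, c}) (ht : t ⊆ {a, b, c}) : lhull R s ∩ lhull R t ⊆ lhull R (s ∩ t) := by
  have hab : R a ≠ R b := by rintro e; apply h; rw [e]; simp [orient]
  have hac : R a ≠ R c := by rintro e; apply h; rw [e]; simp [orient]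
  have hbc : R b ≠ R c := by rintro e; apply h; rw [e]; simp only [orient]; ring
  have hinj : Set.InjOn R ({a, b, c} : Finset V) := by
    intro x hx y hy hxy
    simp only [Finset.coe_insert, Finset.coe_singleton, Set.mem_insert_iff,
      Set.mem_singleton_iff] at hx hy
    rcases hx with rfl | rfl | rfl <;> rcases hy with rfl | rfl | rfl <;>
      simp_all [eq_comm]
  have hi := (affineIndependent_of_orient_ne_zero h).range
  have hi2 : AffineIndependent ℝ ((↑) : ((({a, b, c} : Finset V).image R : Finset ℂ) : Set ℂ) → ℂ) := by
    have e : ((({a, b, c} : Finset V).image R : Finset ℂ) : Set ℂ) = Set.range ![R a, R b, R c] := by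
      ext; simp; tauto
    rw [e]; exact hi
  have := hi2.convexHull_inter (t₁ := s.image R) (t₂ := t.image R)
    (Finset.image_subset_image hs) (Finset.image_subset_image ht)
  unfold lhull
  have e2 : (R '' ((s ∩ t : Finset V) : Set V)) = R '' s ∩ R '' t := by
    rw [Finset.coe_inter]
    exact hinj.image_inter (by exact_mod_cast hs) (by exact_mod_cast ht)
  rw [e2]
  simp only [Finset.coe_image] at this
  exact this.ge

end Polygon

/-! ### Triangulations as binary trees -/

/-- A triangulated polygon over a base edge: `leaf` is a polygon edge, and `node l x r` consists of
a triangle with apex `x` over the base and of what lies beyond its two other edges. -/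
inductive PTree : Type
  | leaf : PTree
  | node (l : PTree) (x : ℕ) (r : PTree) : PTree

namespace PTree

/-- `(a, b, c)` is a rotation of `(p, x, q)`. -/
def Rot (p x q a b c : ℕ) : Prop :=
  (a = p ∧ b = x ∧ c = q) ∨ (a = x ∧ b = q ∧ c = p) ∨ (a = q ∧ b = p ∧ c = x)

/-- The counter-clockwise vertex triples of the triangles of a tree over the base edge `p q`. -/
def tri : PTree → ℕ → ℕ → ℕ → ℕ → ℕ → Prop
  | leaf, _, _, _, _, _ => False
  | node l x r, p, q, a, b, c => Rot p x q a b c ∨ l.tri p x a b c ∨ r.tri x q a b c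

/-- The apex labels. -/
def inner : PTree → Finset ℕ
  | leaf => ∅
  | node l x r => insert x (l.inner ∪ r.inner)

/-- The number of triangles. -/
def size : PTree → ℕ
  | leaf => 0
  | node l _ r => l.size + r.size + 1

/-- The apex labels are pairwise distinct. -/
def Distinct : PTree → Prop
  | leaf => True
  | node l x r => x ∉ l.inner ∧ x ∉ r.inner ∧ Disjoint l.inner r.inner ∧ l.Distinct ∧ r.Distinct

/-- The apex labels are distinct from each other and from the two distinct labels of the base. -/
structure WF (p q : ℕ) (τ : PTree) : Prop where
  ne : p ≠ q
  left : p ∉ τ.inner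
  right : q ∉ τ.inner
  distinct : τ.Distinct

theorem Rot.rot {p x q a b c : ℕ} (h : Rot p x q a b c) : Rot p x q b c a := by
  unfold Rot at *; tauto

theorem Rot.refl (p x q : ℕ) : Rot p x q p x q := Or.inl ⟨rfl, rfl, rfl⟩

theorem Rot.finset_eq {p x q a b c : ℕ} (h : Rot p x q a b c) :
    ({a, b, c} : Finset ℕ) = {p, x, q} := by
  rcases h with ⟨rfl, rfl, rfl⟩ | ⟨rfl, rfl, rfl⟩ | ⟨rfl, rfl, rfl⟩ <;> ext <;> simp <;> tauto

theorem tri_rot {τ : PTree} {p q a b c : ℕ} (h : τ.tri p q a b c) : τ.tri p q b c a := by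
  induction τ generalizing p q with
  | leaf => exact h
  | node l x r ihl ihr =>
    rcases h with h | h | h
    · exact Or.inl h.rot
    · exact Or.inr (Or.inl (ihl h))
    · exact Or.inr (Or.inr (ihr h))

theorem WF.node_left {p q x : ℕ} {l r : PTree} (h : WF p q (node l x r)) : WF p x l := by
  obtain ⟨h1, h2, h3, h4, h5, h6, h7, h8⟩ := h
  simp only [inner, Finset.mem_insert, Finset.mem_union, not_or] at h2 h3
  exact ⟨h2.1, h2.2.1, h4, h7⟩

theorem WF.node_right {p q x : ℕ} {l r : PTree} (h : WF p q (node l x r)) : WF x q r := by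
  obtain ⟨h1, h2, h3, h4, h5, h6, h7, h8⟩ := h
  simp only [inner, Finset.mem_insert, Finset.mem_union, not_or] at h2 h3
  exact ⟨Ne.symm h3.1, h5, h3.2.2, h8⟩

theorem tri_mem {τ : PTree} {p q a b c : ℕ} (h : τ.tri p q a b c) :
    a = p ∨ a = q ∨ a ∈ τ.inner := by
  induction τ generalizing p q with
  | leaf => exact h.elim
  | node l x r ihl ihr =>
    simp only [inner, Finset.mem_insert, Finset.mem_union]
    rcases h with h | h | h
    · rcases h with h | h | h <;> tauto
    · have := ihl h; tauto
    · have := ihr h; tauto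

theorem tri_mem2 {τ : PTree} {p q a b c : ℕ} (h : τ.tri p q a b c) :
    b = p ∨ b = q ∨ b ∈ τ.inner := tri_mem (tri_rot h)

theorem tri_mem3 {τ : PTree} {p q a b c : ℕ} (h : τ.tri p q a b c) :
    c = p ∨ c = q ∨ c ∈ τ.inner := tri_mem (tri_rot (tri_rot h))

theorem tri_subset {τ : PTree} {p q a b c : ℕ} (h : τ.tri p q a b c) :
    ({a, b, c} : Finset ℕ) ⊆ insert p (insert q τ.inner) := by
  intro y hy
  simp only [Finset.mem_insert, Finset.mem_singleton] at hy ⊢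
  rcases hy with rfl | rfl | rfl
  · exact tri_mem h
  · exact tri_mem2 h
  · exact tri_mem3 h

theorem tri_ne {τ : PTree} {p q a b c : ℕ} (hw : WF p q τ) (h : τ.tri p q a b c) : a ≠ b := by
  induction τ generalizing p q with
  | leaf => exact h.elim
  | node l x r ihl ihr =>
    rcases h with h | h | h
    · have := hw.ne; have := hw.node_left.ne; have := hw.node_right.ne
      rcases h with ⟨rfl, rfl, rfl⟩ | ⟨rfl, rfl, rfl⟩ | ⟨rfl, rfl, rfl⟩ <;> tauto
    · exact ihl hw.node_left h
    · exact ihr hw.node_right h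

theorem WF.node_facts {p q x : ℕ} {l r : PTree} (h : WF p q (node l x r)) :
    p ≠ q ∧ p ≠ x ∧ x ≠ q ∧ p ∉ l.inner ∧ p ∉ r.inner ∧ q ∉ l.inner ∧ q ∉ r.inner ∧
      x ∉ l.inner ∧ x ∉ r.inner ∧ Disjoint l.inner r.inner := by
  obtain ⟨h1, h2, h3, h4, h5, h6, h7, h8⟩ := h
  simp only [inner, Finset.mem_insert, Finset.mem_union, not_or] at h2 h3
  exact ⟨h1, h2.1, Ne.symm h3.1, h2.2.1, h2.2.2, h3.2.1, h3.2.2, h4, h5, h6⟩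

/-- A triangle that contains both labels of the base is the triangle over the base. -/
theorem tri_base {l r : PTree} {x p q a b c : ℕ} (hw : WF p q (node l x r))
    (h : (node l x r).tri p q a b c) (hp : p ∈ ({a, b, c} : Finset ℕ))
    (hq : q ∈ ({a, b, c} : Finset ℕ)) : Rot p x q a b c := by
  obtain ⟨h1, h2, h3, h4, h5, h6, h7, h8, h9, h10⟩ := hw.node_facts
  rcases h with h | h | h
  · exact h
  · have := tri_subset h hq
    simp only [Finset.mem_insert] at this
    exfalso; rcases this with h | h | h <;> tauto
  · have := tri_subset h hp
    simp only [Finset.mem_insert] at this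
    exfalso; rcases this with h | h | h <;> tauto

theorem not_tri_base {τ : PTree} {p q c : ℕ} (hw : WF p q τ) : ¬ τ.tri p q p q c := by
  intro h
  cases τ with
  | leaf => exact h
  | node l x r =>
    obtain ⟨h1, h2, h3, -⟩ := hw.node_facts
    have := tri_base hw h (by simp) (by simp)
    rcases this with h | h | h <;> tauto

/-- A directed edge belongs to at most one triangle. -/
theorem tri_unique {τ : PTree} {p q a b c c' : ℕ} (hw : WF p q τ) (h : τ.tri p q a b c)
    (h' : τ.tri p q a b c') : c = c' := by
  induction τ generalizing p q with
  | leaf => exact h.elim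
  | node l x r ihl ihr =>
    obtain ⟨h1, h2, h3, h4, h5, h6, h7, h8, h9, h10⟩ := hw.node_facts
    have key1 : ∀ c c', Rot p x q a b c → l.tri p x a b c' → False := by
      clear h h'; intro d d' k k'
      have ha := tri_mem k'
      have hb := tri_mem2 k'
      rcases k with ⟨rfl, rfl, rfl⟩ | ⟨rfl, rfl, rfl⟩ | ⟨rfl, rfl, rfl⟩
      · exact not_tri_base hw.node_left k'
      · rcases hb with h | h | h <;> tauto
      · rcases ha with h | h | h <;> tauto
    have key2 : ∀ c c', Rot p x q a b c → r.tri x q a b c' → False := by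
      clear h h'; intro d d' k k'
      have ha := tri_mem k'
      have hb := tri_mem2 k'
      rcases k with ⟨rfl, rfl, rfl⟩ | ⟨rfl, rfl, rfl⟩ | ⟨rfl, rfl, rfl⟩
      · rcases ha with h | h | h <;> tauto
      · exact not_tri_base hw.node_right k'
      · rcases hb with h | h | h <;> tauto
    have key3 : ∀ c c', l.tri p x a b c → r.tri x q a b c' → False := by
      intro c c' h h'
      have aux : ∀ y, (y = p ∨ y = x ∨ y ∈ l.inner) → (y = x ∨ y = q ∨ y ∈ r.inner) → y = x := by
        intro y hy hy'
        have : y ∈ l.inner → y ∉ r.inner := fun h => Finset.disjoint_left.1 h10 h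
        have e1 : y = p → y ∉ r.inner := fun e => e ▸ h5
        have e2 : y = q → y ∉ l.inner := fun e => e ▸ h6
        have e3 : y = p → y ≠ q := fun e => e ▸ h1
        clear * - hy hy' this e1 e2 e3; tauto
      exact tri_ne hw.node_left h
        ((aux _ (tri_mem h) (tri_mem h')).trans (aux _ (tri_mem2 h) (tri_mem2 h')).symm)
    rcases h with h | h | h <;> rcases h' with h' | h' | h'
    · unfold Rot at h h'; omega
    · exact (key1 _ _ h h').elim
    · exact (key2 _ _ h h').elim
    · exact (key1 _ _ h' h).elim
    · exact ihl hw.node_left h h'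
    · exact (key3 _ _ h h').elim
    · exact (key2 _ _ h' h).elim
    · exact (key3 _ _ h' h).elim
    · exact ihr hw.node_right h h'

/-- A tree has finitely many triangles, so finitely many eventual properties are combined. -/
theorem eventually_tri {X : Type*} {f : Filter X} {Q : ℕ → ℕ → ℕ → X → Prop} (τ : PTree) (p q : ℕ)
    (h : ∀ a b c, τ.tri p q a b c → ∀ᶠ z in f, Q a b c z) :
    ∀ᶠ z in f, ∀ a b c, τ.tri p q a b c → Q a b c z := by
  induction τ generalizing p q with
  | leaf => exact Filter.Eventually.of_forall fun z a b c h => h.elim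
  | node l x r ihl ihr =>
    filter_upwards [ihl p x fun a b c hh => h a b c (Or.inr (Or.inl hh)),
      ihr x q fun a b c hh => h a b c (Or.inr (Or.inr hh)),
      h p x q (Or.inl (Or.inl ⟨rfl, rfl, rfl⟩)),
      h x q p (Or.inl (Or.inr (Or.inl ⟨rfl, rfl, rfl⟩))),
      h q p x (Or.inl (Or.inr (Or.inr ⟨rfl, rfl, rfl⟩)))] with z h1 h2 h3 h4 h5 a b c hh
    rcases hh with hh | hh | hh
    · rcases hh with ⟨rfl, rfl, rfl⟩ | ⟨rfl, rfl, rfl⟩ | ⟨rfl, rfl, rfl⟩ <;> assumption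
    · exact h1 a b c hh
    · exact h2 a b c hh

/-- The mirror image. -/
def mirror : PTree → PTree
  | leaf => leaf
  | node l x r => node r.mirror x l.mirror

theorem tri_mirror {τ : PTree} {p q a b c : ℕ} : τ.mirror.tri q p a b c ↔ τ.tri p q c b a := by
  induction τ generalizing p q with
  | leaf => exact Iff.rfl
  | node l x r ihl ihr =>
    simp only [mirror, tri, ihl, ihr, Rot]; tauto

theorem inner_mirror (τ : PTree) : τ.mirror.inner = τ.inner := by
  induction τ with
  | leaf => rfl
  | node l x r ihl ihr => simp only [mirror, inner, ihl, ihr, Finset.union_comm]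

theorem distinct_mirror {τ : PTree} (h : τ.Distinct) : τ.mirror.Distinct := by
  induction τ with
  | leaf => trivial
  | node l x r ihl ihr =>
    obtain ⟨h1, h2, h3, h4, h5⟩ := h
    simp only [mirror, Distinct, inner_mirror]
    exact ⟨h2, h1, h3.symm, ihr h5, ihl h4⟩

theorem size_mirror (τ : PTree) : τ.mirror.size = τ.size := by
  induction τ with
  | leaf => rfl
  | node l x r ihl ihr => simp only [mirror, size, ihl, ihr]; ring

/-- The triangles `T` consist of those of two trees over the two sides of the edge `p q`. -/
structure Glue (T : ℕ → ℕ → ℕ → Prop) (p q : ℕ) (κ τ : PTree) : Prop where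
  wf₁ : WF q p κ
  wf₂ : WF p q τ
  disj : Disjoint κ.inner τ.inner
  eq : ∀ a b c, T a b c ↔ κ.tri q p a b c ∨ τ.tri p q a b c

theorem WF.glue {p q : ℕ} {τ : PTree} (h : WF p q τ) : Glue (τ.tri p q) p q leaf τ :=
  ⟨⟨h.ne.symm, by simp [inner], by simp [inner], trivial⟩, h, by simp [inner],
    fun a b c => by simp [tri]⟩

theorem Glue.swap {T : ℕ → ℕ → ℕ → Prop} {p q : ℕ} {κ τ : PTree} (h : Glue T p q κ τ) :
    Glue T q p τ κ :=
  ⟨h.wf₂, h.wf₁, h.disj.symm, fun a b c => (h.eq a b c).trans or_comm⟩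

/-- The base moves across the triangle `p x q`: seen from `p x`, the rest consists of that triangle
with `r` over its side `x q` and `κ` over the old base. -/
theorem Glue.left {T : ℕ → ℕ → ℕ → Prop} {p q x : ℕ} {κ l r : PTree}
    (h : Glue T p q κ (node l x r)) : Glue T p x (node r q κ) l := by
  obtain ⟨h1, h2, h3, h4, h5, h6, h7, h8, h9, h10⟩ := h.wf₂.node_facts
  have hd := h.disj
  simp only [inner, Finset.disjoint_insert_right, Finset.disjoint_union_right] at hd
  refine ⟨⟨h2.symm, ?_, ?_, ?_⟩, h.wf₂.node_left, ?_, fun a b c => ?_⟩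
  · simp only [inner, Finset.mem_insert, Finset.mem_union]; tauto
  · have := h.wf₁.right
    simp only [inner, Finset.mem_insert, Finset.mem_union]; tauto
  · exact ⟨h7, h.wf₁.left, hd.2.2.symm, h.wf₂.node_right.distinct, h.wf₁.distinct⟩
  · simp only [inner, Finset.disjoint_insert_left, Finset.disjoint_union_left]
    exact ⟨h6, h10.symm, hd.2.1⟩
  · rw [h.eq]; simp only [tri, Rot]; tauto

theorem Glue.mirror {T : ℕ → ℕ → ℕ → Prop} {p q : ℕ} {κ τ : PTree} (h : Glue T p q κ τ) :
    Glue (fun a b c => T c b a) q p κ.mirror τ.mirror := by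
  obtain ⟨⟨h1, h2, h3, h4⟩, ⟨h5, h6, h7, h8⟩, h9, h10⟩ := h
  refine ⟨⟨h1.symm, ?_, ?_, distinct_mirror h4⟩, ⟨h5.symm, ?_, ?_, distinct_mirror h8⟩, ?_, ?_⟩
  all_goals (try rw [inner_mirror]); (try rw [inner_mirror]); try assumption
  intro a b c
  rw [tri_mirror, tri_mirror]; exact h10 c b a

theorem Glue.right {T : ℕ → ℕ → ℕ → Prop} {p q x : ℕ} {κ l r : PTree}
    (h : Glue T p q κ (node l x r)) : Glue T x q (node κ p l) r := by
  obtain ⟨h1, h2, h3, h4, h5, h6, h7, h8, h9, h10⟩ := h.wf₂.node_facts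
  have hd := h.disj
  simp only [inner, Finset.disjoint_insert_right, Finset.disjoint_union_right] at hd
  refine ⟨⟨h3.symm, ?_, ?_, ?_⟩, h.wf₂.node_right, ?_, fun a b c => ?_⟩
  · have := h.wf₁.left
    simp only [inner, Finset.mem_insert, Finset.mem_union]; have := h1.symm; tauto
  · simp only [inner, Finset.mem_insert, Finset.mem_union]; have := h2.symm; tauto
  · exact ⟨h.wf₁.right, h4, hd.2.1, h.wf₁.distinct, h.wf₂.node_left.distinct⟩
  · simp only [inner, Finset.disjoint_insert_left, Finset.disjoint_union_left]
    exact ⟨h5, hd.2.2, h10⟩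
  · rw [h.eq]; simp only [tri, Rot]; tauto

/-- Every triangle can be made the one next to the base edge. -/
theorem Glue.exists_of_tri {T : ℕ → ℕ → ℕ → Prop} {p q a b c : ℕ} {κ τ : PTree}
    (h : Glue T p q κ τ) (ht : T a b c) : ∃ κ₁ κ₂ σ, Glue T b c (node κ₁ a κ₂) σ := by
  have main : ∀ (τ κ : PTree) (p q : ℕ), Glue T p q κ τ → τ.tri p q a b c →
      ∃ κ₁ κ₂ σ, Glue T b c (node κ₁ a κ₂) σ := by
    intro τ
    induction τ with
    | leaf => intro κ p q h ht; exact ht.elim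
    | node l x r ihl ihr =>
      intro κ p q h ht
      rcases ht with ht | ht | ht
      · rcases ht with ⟨rfl, rfl, rfl⟩ | ⟨rfl, rfl, rfl⟩ | ⟨rfl, rfl, rfl⟩
        · exact ⟨_, _, _, h.right⟩
        · exact ⟨_, _, _, h.swap⟩
        · exact ⟨_, _, _, h.left⟩
      · exact ihl _ _ _ h.left ht
      · exact ihr _ _ _ h.right ht
  rcases (h.eq a b c).1 ht with ht | ht
  · exact main _ _ _ _ h.swap ht
  · exact main _ _ _ _ h ht

/-- Move the base deeper into `τ` until both other sides of its triangle are polygon edges. The part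
on the other side of the base never becomes empty, so the ear found has a neighbour. -/
theorem Glue.exists_ear {T : ℕ → ℕ → ℕ → Prop} {p q : ℕ} {κ τ : PTree}
    (h : Glue T p q κ τ) (hκ : κ ≠ leaf) (hτ : τ ≠ leaf) : ∃ v w u l o r,
      Glue T v w (node leaf u leaf) (node l o r) ∧
        (node l o r).size + 1 = κ.size + τ.size := by
  induction τ generalizing κ p q with
  | leaf => exact (hτ rfl).elim
  | node l x r ihl ihr =>
    by_cases hl : l = leaf
    · by_cases hr : r = leaf
      · subst hl hr
        cases κ with
        | leaf => exact (hκ rfl).elim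
        | node a y b => exact ⟨_, _, _, _, _, _, h.swap, by simp [size]⟩
      · obtain ⟨v, w, u, l', o, r', h1, h2⟩ := ihr h.right (by simp) hr
        exact ⟨v, w, u, l', o, r', h1, by rw [h2]; simp only [size]; ring⟩
    · obtain ⟨v, w, u, l', o, r', h1, h2⟩ := ihl h.left (by simp) hl
      exact ⟨v, w, u, l', o, r', h1, by rw [h2]; simp only [size]; ring⟩

theorem WF.exists_ear {p q x : ℕ} {l r : PTree} (h : WF p q (node l x r))
    (hlr : l ≠ leaf ∨ r ≠ leaf) : ∃ v w u l' o r',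
      Glue ((node l x r).tri p q) v w (node leaf u leaf) (node l' o r') ∧
        (node l' o r').size + 1 = (node l x r).size := by
  rcases hlr with hl | hr
  · obtain ⟨v, w, u, l', o, r', h1, h2⟩ := h.glue.left.exists_ear (by simp) hl
    exact ⟨v, w, u, l', o, r', h1, by rw [h2]; simp only [size]; ring⟩
  · obtain ⟨v, w, u, l', o, r', h1, h2⟩ := h.glue.right.exists_ear (by simp) hr
    exact ⟨v, w, u, l', o, r', h1, by rw [h2]; simp only [size]; ring⟩

end PTree

/-! ### Realizations, and attaching an ear -/

namespace Polygon
open PTree Filter Topology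

/-- The points covered by the triangles `T`. -/
def region (T : ℕ → ℕ → ℕ → Prop) (R : ℕ → ℂ) : Set ℂ :=
  {z | ∃ a b c, T a b c ∧ z ∈ lhull R {a, b, c}}

/-- The triangles `T` are counter-clockwise, form a geometric simplicial complex, and the union of
two adjacent triangles is never convex, its reflex vertices being described by `F`. -/
structure Realizes (T : ℕ → ℕ → ℕ → Prop) (F : ℕ → ℕ → ℕ → Prop) (R : ℕ → ℂ) : Prop where
  pos : ∀ a b c, T a b c → 0 < orient (R a) (R b) (R c)
  cplx : ∀ a b c a' b' c', T a b c → T a' b' c' → ({a, b, c} : Finset ℕ) ≠ {a', b', c'} →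
    lhull R {a, b, c} ∩ lhull R {a', b', c'} ⊆ lhull R ({a, b, c} ∩ {a', b', c'})
  flag : ∀ p x q o, T p x q → T q o p → (F o p x ↔ orient (R o) (R p) (R x) < 0)
  reflex : ∀ p x q o, T p x q → T q o p →
    orient (R o) (R p) (R x) < 0 ∨ orient (R x) (R q) (R o) < 0

theorem mem_hull3 {a b c x : ℂ} (h : x ∈ convexHull ℝ {a, b, c}) :
    ∃ α β γ : ℝ, 0 ≤ α ∧ 0 ≤ β ∧ 0 ≤ γ ∧ α + β + γ = 1 ∧ x = α • a + β • b + γ • c := by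
  rw [convexHull_insert (by simp), convexHull_pair, mem_convexJoin] at h
  obtain ⟨a', ha, y, ⟨s, t, hs, ht, hst, rfl⟩, s', t', hs', ht', hst', rfl⟩ := h
  rw [Set.mem_singleton_iff] at ha
  subst ha
  refine ⟨s', t' * s, t' * t, hs', by positivity, by positivity, by nlinarith, ?_⟩
  simp only [smul_add, mul_smul, add_assoc]

theorem orient_combo3 (p q a b c : ℂ) {α β γ : ℝ} (h : α + β + γ = 1) :
    orient p q (α • a + β • b + γ • c) =
      α * orient p q a + β * orient p q b + γ * orient p q c := by
  obtain rfl : α = 1 - β - γ := by linarith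
  simp only [orient, Complex.sub_re, Complex.sub_im, Complex.add_re, Complex.add_im,
    Complex.real_smul, Complex.re_ofReal_mul, Complex.im_ofReal_mul]; ring

/-- A point of a triangle on the closed side of a line through one vertex that strictly excludes
the other two vertices is that vertex. -/
theorem eq_vertex_of_orient {p q a b c x : ℂ} (hx : x ∈ convexHull ℝ {a, b, c})
    (ha : orient p q a = 0) (hb : 0 < orient p q b) (hc : 0 < orient p q c)
    (h : orient p q x ≤ 0) : x = a := by
  obtain ⟨α, β, γ, h1, h2, h3, h4, rfl⟩ := mem_hull3 hx
  rw [orient_combo3 p q a b c h4, ha] at h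
  have hβ : β = 0 := by
    by_contra hne
    have : 0 < β := lt_of_le_of_ne h2 (Ne.symm hne)
    nlinarith [mul_pos this hb, mul_nonneg h3 hc.le]
  have hγ : γ = 0 := by
    by_contra hne
    have : 0 < γ := lt_of_le_of_ne h3 (Ne.symm hne)
    nlinarith [mul_pos this hc, mul_nonneg h2 hb.le]
  subst hβ hγ
  obtain rfl : α = 1 := by linarith
  simp

theorem hull3_orient_nonpos {p q a b c x : ℂ} (hx : x ∈ convexHull ℝ {a, b, c})
    (ha : orient p q a ≤ 0) (hb : orient p q b ≤ 0) (hc : orient p q c ≤ 0) :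
    orient p q x ≤ 0 := by
  refine convexHull_min ?_ (convex_orient_nonpos p q) hx
  rintro y (rfl | rfl | rfl) <;> assumption

/-- By this linearity, conditions at `p` on the direction of an ear carry over to ears of every
size. -/
theorem orient_add_smul (p q d : ℂ) (ε : ℝ) :
    orient p q (p + ε • d) = ε * orient p q (p + d) := by
  simp only [orient, Complex.sub_re, Complex.sub_im, Complex.add_re, Complex.add_im,
    Complex.real_smul, Complex.re_ofReal_mul, Complex.im_ofReal_mul]; ring

theorem lhull_congr {V : Type*} {R R' : V → ℂ} {t : Finset V} (h : ∀ a ∈ t, R a = R' a) :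
    lhull R t = lhull R' t := by
  unfold lhull
  rw [Set.image_congr (by exact_mod_cast h)]

/-- `y` is joined to `v` by an edge of one of the triangles `T`. -/
def Nbr (T : ℕ → ℕ → ℕ → Prop) (v y : ℕ) : Prop := ∃ c, T v y c ∨ T v c y

section Ear

variable {T : ℕ → ℕ → ℕ → Prop} {v w u o : ℕ} {l r : PTree}

/-- Here and below, the ear is the counter-clockwise triangle `w u v` with tip `u`, and `v o w` is
the triangle on the other side of its base. Their union is reflex at `v` if `F u v o` and reflex at
`w` if `F o w u`. -/
theorem ear_iff (G : Glue T v w (node leaf u leaf) (node l o r)) (a b c : ℕ) :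
    T a b c ↔ Rot w u v a b c ∨ (node l o r).tri v w a b c := by
  rw [G.eq]; simp [tri]

theorem ear_fresh (G : Glue T v w (node leaf u leaf) (node l o r)) {a b c : ℕ}
    (h : (node l o r).tri v w a b c) : a ≠ u ∧ b ≠ u ∧ c ≠ u := by
  have key : ∀ a, (a = v ∨ a = w ∨ a ∈ (node l o r).inner) → a ≠ u := by
    rintro a ha rfl
    have h1 := G.wf₁.left
    have h2 := G.wf₁.right
    have h3 := G.disj
    simp only [PTree.inner, Finset.mem_insert, Finset.mem_union, not_or] at h1 h2
    rcases ha with rfl | rfl | ha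
    · exact h2.1 rfl
    · exact h1.1 rfl
    · exact Finset.disjoint_left.1 h3 (by simp [PTree.inner]) ha
  exact ⟨key a (tri_mem h), key b (tri_mem2 h), key c (tri_mem3 h)⟩

/-- A small ear over the edge `v w` meets the other triangles in common faces. -/
theorem ear_inter {F : ℕ → ℕ → ℕ → Prop} {R : ℕ → ℂ} {z : ℂ}
    (hwf : WF v w (node l o r)) (hR : Realizes ((node l o r).tri v w) F R)
    (h1 : 0 < orient (R v) (R w) z)
    (h2 : ∀ y, Nbr ((node l o r).tri v w) v y → y ≠ w → orient (R v) (R y) z < 0)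
    (h3 : ∀ y c, (node l o r).tri v w w y c → y ≠ v → c ≠ v →
      (orient (R w) (R y) (R v) < 0 ∧ orient (R w) (R y) z < 0) ∨
        (orient (R w) (R v) (R c) < 0 ∧ orient (R w) z (R c) < 0))
    (h4 : ∀ a b c, (node l o r).tri v w a b c → v ∉ ({a, b, c} : Finset ℕ) →
      w ∉ ({a, b, c} : Finset ℕ) →
      Disjoint (convexHull ℝ {R a, R b, R c}) (convexHull ℝ {R v, R w, z})) (a b c : ℕ)
    (h : (node l o r).tri v w a b c) :
    lhull R {a, b, c} ∩ convexHull ℝ {R v, R w, z} ⊆ lhull R ({a, b, c} ∩ {v, w}) := by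
  have hbase : 0 < orient (R v) (R o) (R w) := hR.pos _ _ _ (Or.inl (Rot.refl _ _ _))
  rintro x ⟨hx1, hx3⟩
  -- The line through `v` and the tip separates the ear from a triangle at `v` that does not contain
  -- `w`.
  have hvx : ∀ y c, (node l o r).tri v w v y c → y ≠ w → c ≠ w →
      x ∈ lhull R {v, y, c} → x = R v := by
    intro y c h hy hc hx1
    rw [lhull_triple] at hx1
    have hy' := h2 y ⟨c, Or.inl h⟩ hy
    have hc' := h2 c ⟨y, Or.inr h⟩ hc
    rw [orient_swap, neg_lt_zero] at hy' hc'
    refine eq_vertex_of_orient hx1 (orient_self_left _ _) hy' hc' ?_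
    refine hull3_orient_nonpos hx3 (orient_self_left _ _).le ?_ (orient_self_right _ _).le
    rw [orient_swap]; linarith
  -- At `w`, the separating line extends one of the two sides at `w` of the other triangle; `h3`
  -- tells which one.
  have hwx : ∀ y c, (node l o r).tri v w w y c → y ≠ v → c ≠ v →
      x ∈ lhull R {w, y, c} → x = R w := by
    intro y c h hy hc hx1
    rw [lhull_triple] at hx1
    have hx4 : x ∈ convexHull ℝ {R w, R v, z} := by
      rwa [show ({R w, R v, z} : Set ℂ) = {R v, R w, z} by ext; simp; tauto]
    have hx5 := (mem_triangle (hR.pos _ _ _ h)).1 hx1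
    rcases h3 y c h hy hc with ⟨k1, k2⟩ | ⟨k1, k2⟩
    · have e : ∀ t, orient (R y) (R w) t = - orient (R w) (R y) t := fun t =>
        orient_swap' _ _ _
      refine eq_vertex_of_orient (p := R y) (q := R w) hx4 (orient_self_right _ _) ?_ ?_ ?_ <;>
        rw [e] <;> linarith
    · have e : ∀ t, orient (R w) (R c) t = - orient (R w) t (R c) := fun t => by
        rw [orient_swap]
      refine eq_vertex_of_orient (p := R w) (q := R c) hx4 (orient_self_left _ _) ?_ ?_ ?_ <;>
        rw [e]
      · linarith
      · linarith
      · have := hx5.2.2; rw [orient_rot] at this; linarith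
  have hrot1 : ({b, c, a} : Finset ℕ) = {a, b, c} := by ext; simp; tauto
  have hrot2 : ({c, a, b} : Finset ℕ) = {a, b, c} := by ext; simp; tauto
  by_cases hv : v ∈ ({a, b, c} : Finset ℕ)
  · have hvm : R v ∈ lhull R ({a, b, c} ∩ {v, w}) := by
      exact mem_lhull _ (Finset.mem_inter.2 ⟨hv, by simp⟩)
    by_cases hw : w ∈ ({a, b, c} : Finset ℕ)
    · have hs := (tri_base hwf h hv hw).finset_eq
      rw [hs, show ({v, o, w} : Finset ℕ) = {w, v, o} by ext; simp; tauto, lhull_triple] at hx1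
      have hp : 0 < orient (R w) (R v) (R o) := by rwa [orient_rot]
      have h5 := ((mem_triangle hp).1 hx1).1
      have hp2 : 0 < orient (R v) (R w) z := h1
      have h6 := ((mem_triangle hp2).1 hx3).1
      have e : orient (R w) (R v) x = - orient (R v) (R w) x :=
        orient_swap' _ _ _
      have hx7 := mem_segment_of_orient hp hx1 (by linarith)
      rw [← lhull_pair] at hx7
      refine lhull_mono _ ?_ hx7
      intro y hy
      simp only [Finset.mem_insert, Finset.mem_singleton] at hy
      rcases hy with rfl | rfl
      · exact Finset.mem_inter.2 ⟨hw, by simp⟩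
      · exact Finset.mem_inter.2 ⟨hv, by simp⟩
    · simp only [Finset.mem_insert, Finset.mem_singleton, not_or] at hv hw
      rcases hv with rfl | rfl | rfl
      · rw [hvx b c h (Ne.symm hw.2.1) (Ne.symm hw.2.2) hx1]; exact hvm
      · rw [hvx c a (tri_rot h) (Ne.symm hw.2.2) (Ne.symm hw.1) (by rwa [hrot1])]; exact hvm
      · rw [hvx a b (tri_rot (tri_rot h)) (Ne.symm hw.1) (Ne.symm hw.2.1) (by rwa [hrot2])]
        exact hvm
  · by_cases hw : w ∈ ({a, b, c} : Finset ℕ)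
    · have hvm : R w ∈ lhull R ({a, b, c} ∩ {v, w}) := by
        exact mem_lhull _ (Finset.mem_inter.2 ⟨hw, by simp⟩)
      simp only [Finset.mem_insert, Finset.mem_singleton, not_or] at hv hw
      rcases hw with rfl | rfl | rfl
      · rw [hwx b c h (Ne.symm hv.2.1) (Ne.symm hv.2.2) hx1]; exact hvm
      · rw [hwx c a (tri_rot h) (Ne.symm hv.2.2) (Ne.symm hv.1) (by rwa [hrot1])]; exact hvm
      · rw [hwx a b (tri_rot (tri_rot h)) (Ne.symm hv.1) (Ne.symm hv.2.1) (by rwa [hrot2])]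
        exact hvm
    · rw [lhull_triple] at hx1
      exact (Set.disjoint_left.1 (h4 a b c h hv hw) hx1 hx3).elim

theorem realizes_ear {F : ℕ → ℕ → ℕ → Prop} {R : ℕ → ℂ} {z : ℂ}
    (G : Glue T v w (node leaf u leaf) (node l o r))
    (hR : Realizes ((node l o r).tri v w) F R)
    (h1 : 0 < orient (R v) (R w) z)
    (h2 : orient (R v) (R o) z < 0)
    (h3 : ∀ a b c, (node l o r).tri v w a b c →
      lhull R {a, b, c} ∩ convexHull ℝ {R v, R w, z} ⊆ lhull R ({a, b, c} ∩ {v, w}))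
    (hF : F u v o) (hF' : ¬ F o w u) : Realizes T F (Function.update R u z) := by
  have hvw : v ≠ w := G.wf₂.ne
  obtain ⟨-, hov, how, -⟩ := G.wf₂.node_facts
  have hvu : v ≠ u := (ear_fresh G (Or.inl (Rot.refl _ _ _))).1
  have hou : o ≠ u := (ear_fresh G (Or.inl (Rot.refl _ _ _))).2.1
  have hwu : w ≠ u := (ear_fresh G (Or.inl (Rot.refl _ _ _))).2.2
  have hb : (node l o r).tri v w v o w := Or.inl (Rot.refl _ _ _)
  set R' := Function.update R u z with hR'
  have eR : ∀ y, y ≠ u → R' y = R y := fun y hy => Function.update_of_ne hy _ _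
  have eu : R' u = z := Function.update_self _ _ _
  have hou' : orient (R v) (R o) z < 0 := h2
  have hbase : 0 < orient (R v) (R o) (R w) := hR.pos _ _ _ hb
  have hol : ∀ a b c, (node l o r).tri v w a b c → lhull R' {a, b, c} = lhull R {a, b, c} := by
    intro a b c h
    obtain ⟨e1, e2, e3⟩ := ear_fresh G h
    refine lhull_congr fun y hy => eR y ?_
    simp only [Finset.mem_insert, Finset.mem_singleton] at hy
    rcases hy with rfl | rfl | rfl <;> assumption
  have hear : lhull R' {w, u, v} = convexHull ℝ {R w, z, R v} := by
    rw [lhull_triple, eR w hwu, eu, eR v hvu]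
  have hear' : ∀ x, x ∈ lhull R' {w, u, v} → x ∈ convexHull ℝ {R v, R w, z} := by
    intro x hx
    rw [hear] at hx
    rwa [show ({R v, R w, z} : Set ℂ) = {R w, z, R v} by ext; simp; tauto]
  have hpair : ∀ a b c, (node l o r).tri v w a b c →
      lhull R' {a, b, c} ∩ lhull R' {w, u, v} ⊆ lhull R' ({a, b, c} ∩ {w, u, v}) := by
    rintro a b c h x ⟨hx1, hx2⟩
    rw [hol a b c h] at hx1
    have := h3 a b c h ⟨hx1, hear' x hx2⟩
    rw [lhull_congr (R' := R')] at this
    · refine lhull_mono _ ?_ this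
      intro y hy; simp at hy ⊢; tauto
    · intro y hy
      have := (Finset.mem_inter.1 hy).2
      simp only [Finset.mem_insert, Finset.mem_singleton] at this
      rcases this with rfl | rfl
      · exact (eR _ hvu).symm
      · exact (eR _ hwu).symm
  -- Either diagonal cuts the quadrilateral into triangles of the same total signed area, so a
  -- reflex angle at `v` excludes one at `w`.
  have hq : 0 < orient (R o) (R w) z := by
    have e1 : orient z (R v) (R o) < 0 := by rwa [orient_rot]
    have e2 : orient z (R v) (R o) + orient (R o) (R w) z =
        orient (R v) (R o) (R w) + orient (R v) (R w) z := by
      simp only [orient, Complex.sub_re, Complex.sub_im]; ring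
    linarith
  have hq' : orient z (R v) (R o) < 0 := by rwa [orient_rot]
  have huniq : ∀ x, (node l o r).tri v w v x w → x = o := by
    intro x hx
    have := tri_base G.wf₂ hx (by simp) (by simp)
    unfold Rot at this; omega
  have hquad : ∀ p x q y, T p x q → T q y p → (F y p x ↔ orient (R' y) (R' p) (R' x) < 0) ∧
      (orient (R' y) (R' p) (R' x) < 0 ∨ orient (R' x) (R' q) (R' y) < 0) := by
    intro p x q y ha hb'
    rcases (ear_iff G _ _ _).1 ha with ha | ha <;> rcases (ear_iff G _ _ _).1 hb' with hb' | hb'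
    · exfalso; unfold Rot at ha hb'; omega
    · rcases ha with ⟨rfl, rfl, rfl⟩ | ⟨rfl, rfl, rfl⟩ | ⟨rfl, rfl, rfl⟩
      · obtain rfl := huniq _ hb'
        rw [eu, eR _ hou, eR _ hvu, eR _ hwu]
        exact ⟨⟨fun h => (hF' h).elim, fun h => by linarith⟩, Or.inr hq'⟩
      · exact ((ear_fresh G hb').2.2 rfl).elim
      · exact ((ear_fresh G hb').1 rfl).elim
    · rcases hb' with ⟨rfl, rfl, rfl⟩ | ⟨rfl, rfl, rfl⟩ | ⟨rfl, rfl, rfl⟩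
      · obtain rfl := huniq _ ha
        rw [eu, eR _ hou, eR _ hvu, eR _ hwu]
        exact ⟨⟨fun h => hq', fun h => hF⟩, Or.inl hq'⟩
      · exact ((ear_fresh G ha).2.2 rfl).elim
      · exact ((ear_fresh G ha).1 rfl).elim
    · obtain ⟨e1, e2, e3⟩ := ear_fresh G ha
      rw [eR _ e1, eR _ e2, eR _ e3, eR _ (ear_fresh G hb').2.1]
      exact ⟨hR.flag _ _ _ _ ha hb', hR.reflex _ _ _ _ ha hb'⟩
  refine ⟨?_, ?_, fun p x q y ha hb' => (hquad p x q y ha hb').1,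
    fun p x q y ha hb' => (hquad p x q y ha hb').2⟩
  · intro a b c h
    rcases (ear_iff G _ _ _).1 h with h | h
    · have key : 0 < orient (R' w) (R' u) (R' v) := by
        rw [eu, eR _ hvu, eR _ hwu, ← orient_rot]; exact h1
      rcases h with ⟨rfl, rfl, rfl⟩ | ⟨rfl, rfl, rfl⟩ | ⟨rfl, rfl, rfl⟩
      · exact key
      · rwa [← orient_rot]
      · rwa [orient_rot]
    · obtain ⟨e1, e2, e3⟩ := ear_fresh G h
      rw [eR _ e1, eR _ e2, eR _ e3]; exact hR.pos _ _ _ h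
  · intro a b c a' b' c' h h' hne
    rcases (ear_iff G _ _ _).1 h with h | h <;> rcases (ear_iff G _ _ _).1 h' with h' | h'
    · exact (hne (h.finset_eq.trans h'.finset_eq.symm)).elim
    · rw [h.finset_eq, Set.inter_comm, Finset.inter_comm]
      exact hpair _ _ _ h'
    · rw [h'.finset_eq]; exact hpair _ _ _ h
    · rw [hol _ _ _ h, hol _ _ _ h']
      refine (hR.cplx _ _ _ _ _ _ h h' hne).trans ?_
      rw [lhull_congr]
      intro y hy
      refine (eR y ?_).symm
      obtain ⟨e1, e2, e3⟩ := ear_fresh G h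
      have := (Finset.mem_inter.1 hy).1
      simp only [Finset.mem_insert, Finset.mem_singleton] at this
      rcases this with rfl | rfl | rfl <;> assumption

end Ear
-- Room for a small ear
theorem orient_eq_zero_of_mem_segment {a b x : ℂ} (h : x ∈ segment ℝ a b) : orient a b x = 0 := by
  obtain ⟨s, t, hs, ht, hst, rfl⟩ := h
  rw [orient_combo a b a b hst, orient_self_left, orient_self_right]; ring

section Ear

variable {T : ℕ → ℕ → ℕ → Prop} {v w u o : ℕ} {l r : PTree} {F : ℕ → ℕ → ℕ → Prop}

/-- The directions `d` at the vertex `v` in which there is room for a small ear over `v w`. -/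
def Admissible (T : ℕ → ℕ → ℕ → Prop) (v w : ℕ) (R : ℕ → ℂ) (d : ℂ) : Prop :=
  0 < orient (R v) (R w) (R v + d) ∧
    ∀ y, Nbr T v y → y ≠ w → orient (R v) (R y) (R v + d) < 0

/-- Otherwise the segment from `w` to `v` would start inside the triangle `w y c`. Its first points
also lie in the triangle `v o w`, but the two triangles share at most the face `w o`. The conclusion
is an open condition, so it survives when `v` is replaced by a nearby ear tip. -/
theorem sector {R : ℕ → ℂ} (hw : WF v w (node l o r)) (hR : Realizes ((node l o r).tri v w) F R)
    {y c : ℕ} (h : (node l o r).tri v w w y c) (hy : y ≠ v) (hc : c ≠ v) :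
    orient (R w) (R y) (R v) < 0 ∨ orient (R w) (R v) (R c) < 0 := by
  by_contra hcon
  push Not at hcon
  obtain ⟨h1, h2⟩ := hcon
  have hb : (node l o r).tri v w v o w := Or.inl (Rot.refl _ _ _)
  have hbase := hR.pos _ _ _ hb
  have hpos := hR.pos _ _ _ h
  obtain ⟨hvw, hov, how, -⟩ := hw.node_facts
  -- `η` is so small that the point at the fraction `η` of the way from `w` to `v` stays on the
  -- inner side of the line `y c`.
  obtain ⟨η, hη0, hη1, hη⟩ : ∃ η : ℝ, 0 < η ∧ η ≤ 1 ∧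
      0 ≤ (1 - η) * orient (R y) (R c) (R w) + η * orient (R y) (R c) (R v) := by
    have hA : 0 < orient (R y) (R c) (R w) := by rwa [orient_rot] at hpos
    generalize orient (R y) (R c) (R w) = A at *
    generalize orient (R y) (R c) (R v) = B at *
    have h0 : 0 < A + |B| := by positivity
    refine ⟨A / (A + |B|), by positivity, ?_, ?_⟩
    · rw [div_le_one h0]; linarith [abs_nonneg B]
    · have : (1 - A / (A + |B|)) * A + A / (A + |B|) * B = A * (|B| + B) / (A + |B|) := by
        field_simp; ring
      rw [this]
      have := neg_abs_le B
      apply div_nonneg _ h0.le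
      apply mul_nonneg hA.le; linarith
  set x := (1 - η) • R w + η • R v with hx
  have hsum : (1 - η) + η = 1 := by ring
  have hx1 : x ∈ lhull R {w, y, c} := by
    rw [lhull_triple, mem_triangle hpos]
    refine ⟨?_, ?_, ?_⟩
    · rw [hx, orient_combo _ _ _ _ hsum, orient_self_left]; simp only [mul_zero, zero_add]
      positivity
    · rw [hx, orient_combo _ _ _ _ hsum]; exact hη
    · rw [hx, orient_combo _ _ _ _ hsum, orient_self_right, orient_rot]
      simp only [mul_zero, zero_add]; positivity
  have hx2 : x ∈ lhull R {v, o, w} := by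
    have : x ∈ lhull R {w, v} := by
      rw [lhull_pair]; exact ⟨1 - η, η, by linarith, hη0.le, hsum, rfl⟩
    refine lhull_mono _ ?_ this
    intro a ha; simp at ha ⊢; tauto
  have hne : ({w, y, c} : Finset ℕ) ≠ {v, o, w} := by
    intro e
    have : v ∈ ({w, y, c} : Finset ℕ) := by rw [e]; simp
    simp only [Finset.mem_insert, Finset.mem_singleton] at this
    rcases this with h | h | h
    · exact hvw h
    · exact hy h.symm
    · exact hc h.symm
  have hx3 := hR.cplx _ _ _ _ _ _ h hb hne ⟨hx1, hx2⟩
  have hx4 : x ∈ lhull R {w, o} := by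
    refine lhull_mono _ ?_ hx3
    intro a ha
    simp only [Finset.mem_inter, Finset.mem_insert, Finset.mem_singleton] at ha ⊢
    rcases ha with ⟨e1, e2 | e2 | e2⟩
    · subst e2; exfalso; rcases e1 with e1 | e1 | e1
      · exact hvw e1
      · exact hy e1.symm
      · exact hc e1.symm
    · exact Or.inr e2
    · exact Or.inl e2
  rw [lhull_pair] at hx4
  have h5 := orient_eq_zero_of_mem_segment hx4
  rw [hx, orient_combo _ _ _ _ hsum, orient_self_left, ← orient_rot, orient_swap'] at h5
  have : 0 < orient (R o) (R w) (R v) := by rwa [← orient_rot]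
  have h6 : orient (R o) (R v) (R w) = - orient (R o) (R w) (R v) := orient_swap _ _ _
  rw [orient_rot] at h5
  nlinarith

/-- A common point would lie in the face `{o}` of `v o w`, but `o` is off the line `v w`. -/
theorem disjoint_base {R : ℕ → ℂ} (hR : Realizes ((node l o r).tri v w) F R)
    {a b c : ℕ} (h : (node l o r).tri v w a b c) (hv : v ∉ ({a, b, c} : Finset ℕ))
    (hw : w ∉ ({a, b, c} : Finset ℕ)) :
    Disjoint (convexHull ℝ {R a, R b, R c}) (segment ℝ (R v) (R w)) := by
  rw [Set.disjoint_left]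
  intro x hx1 hx2
  have hb : (node l o r).tri v w v o w := Or.inl (Rot.refl _ _ _)
  have hbase := hR.pos _ _ _ hb
  have hx0 := orient_eq_zero_of_mem_segment hx2
  rw [← lhull_triple] at hx1
  rw [← lhull_pair] at hx2
  have hx3 : x ∈ lhull R {v, o, w} := by
    refine lhull_mono _ ?_ hx2
    intro a ha; simp at ha ⊢; tauto
  have hne : ({a, b, c} : Finset ℕ) ≠ {v, o, w} := by
    intro e; apply hv; rw [e]; simp
  have hx4 := hR.cplx _ _ _ _ _ _ h hb hne ⟨hx1, hx3⟩
  have hx5 : x ∈ lhull R {o} := by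
    refine lhull_mono _ ?_ hx4
    intro y hy
    simp only [Finset.mem_inter] at hy
    obtain ⟨e1, e2⟩ := hy
    simp only [Finset.mem_insert, Finset.mem_singleton] at e2 ⊢
    rcases e2 with rfl | e2 | rfl
    · exact (hv e1).elim
    · exact e2
    · exact (hw e1).elim
  rw [lhull_singleton, Set.mem_singleton_iff] at hx5
  rw [hx5, orient_swap] at hx0
  linarith

/-- A linear functional strictly separates the two compact hulls at `x₀`, and the strict
inequalities at the six vertices persist nearby. -/
theorem eventually_disjoint {X : Type*} [TopologicalSpace X] {x₀ : X} {a b c d e f : X → ℂ}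
    (ha : ContinuousAt a x₀) (hb : ContinuousAt b x₀) (hc : ContinuousAt c x₀)
    (hd : ContinuousAt d x₀) (he : ContinuousAt e x₀) (hf : ContinuousAt f x₀)
    (h : Disjoint (convexHull ℝ {a x₀, b x₀, c x₀}) (convexHull ℝ {d x₀, e x₀, f x₀})) :
    ∀ᶠ x in 𝓝 x₀, Disjoint (convexHull ℝ {a x, b x, c x}) (convexHull ℝ {d x, e x, f x}) := by
  have hfin : ∀ p q s : ℂ, IsCompact (convexHull ℝ ({p, q, s} : Set ℂ)) := fun p q s =>
    (Set.toFinite _).isCompact_convexHull (𝕜 := ℝ)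
  obtain ⟨g, m, m', h1, h2, h3⟩ := geometric_hahn_banach_compact_closed (convex_convexHull ℝ _)
    (hfin (a x₀) (b x₀) (c x₀)) (convex_convexHull ℝ _) (hfin (d x₀) (e x₀) (f x₀)).isClosed h
  have lt : ∀ k : X → ℂ, ContinuousAt k x₀ → k x₀ ∈ convexHull ℝ {a x₀, b x₀, c x₀} →
      ∀ᶠ x in 𝓝 x₀, g (k x) < m := fun k hk hk' =>
    (g.continuous.continuousAt.comp hk).eventually_lt continuousAt_const (h1 _ hk')
  have gt : ∀ k : X → ℂ, ContinuousAt k x₀ → k x₀ ∈ convexHull ℝ {d x₀, e x₀, f x₀} →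
      ∀ᶠ x in 𝓝 x₀, m < g (k x) := fun k hk hk' =>
    continuousAt_const.eventually_lt (g.continuous.continuousAt.comp hk) (h2.trans (h3 _ hk'))
  filter_upwards [lt a ha (subset_convexHull ℝ _ (by simp)),
    lt b hb (subset_convexHull ℝ _ (by simp)), lt c hc (subset_convexHull ℝ _ (by simp)),
    gt d hd (subset_convexHull ℝ _ (by simp)), gt e he (subset_convexHull ℝ _ (by simp)),
    gt f hf (subset_convexHull ℝ _ (by simp))] with x k1 k2 k3 k4 k5 k6
  have s1 : convexHull ℝ {a x, b x, c x} ⊆ {y | g y < m} := by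
    apply convexHull_min _ (convex_halfSpace_lt g.isLinear m)
    rintro y (rfl | rfl | rfl) <;> assumption
  have s2 : convexHull ℝ {d x, e x, f x} ⊆ {y | m < g y} := by
    apply convexHull_min _ (convex_halfSpace_gt g.isLinear m)
    rintro y (rfl | rfl | rfl) <;> assumption
  rw [Set.disjoint_left]
  intro y hy1 hy2
  have k1 : g y < m := s1 hy1
  have k2 : m < g y := s2 hy2
  exact lt_asymm k1 k2

/-- At `ε = 0` the ear degenerates to the segment `v w`, where the conditions needed away from `v`
are open; those at `v` do not depend on the size. Compactness of `K` makes the bound uniform, so one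
size serves during a whole motion. -/
theorem exists_ear_size {K : Type*} [TopologicalSpace K] [CompactSpace K]
    (G : Glue T v w (node leaf u leaf) (node l o r)) {ρ : K → ℕ → ℂ} (hρ : Continuous ρ)
    {δ : K → ℂ} (hδ : Continuous δ) (hR : ∀ s, Realizes ((node l o r).tri v w) F (ρ s))
    (ha : ∀ s, Admissible ((node l o r).tri v w) v w (ρ s) (δ s))
    (hF : F u v o) (hF' : ¬ F o w u) :
    ∃ ε₀ : ℝ, 0 < ε₀ ∧ ∀ ε : ℝ, 0 < ε → ε ≤ ε₀ → ∀ s,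
      Realizes T F (Function.update (ρ s) u (ρ s v + ε • δ s)) := by
  have ev : ∀ᶠ ε : ℝ in 𝓝 0, ∀ s ∈ (Set.univ : Set K), 0 < ε →
      Realizes T F (Function.update (ρ s) u (ρ s v + ε • δ s)) := by
    refine isCompact_univ.eventually_forall_of_forall_eventually fun s₀ _ => ?_
    have hc : ∀ y, Continuous fun z : ℝ × K => ρ z.2 y := fun y =>
      (continuous_apply y).comp (hρ.comp continuous_snd)
    have hz : Continuous fun z : ℝ × K => ρ z.2 v + z.1 • δ z.2 :=
      (hc v).add (continuous_fst.smul (hδ.comp continuous_snd))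
    have hop : ∀ f g h : ℝ × K → ℂ, Continuous f → Continuous g → Continuous h →
        orient (f (0, s₀)) (g (0, s₀)) (h (0, s₀)) < 0 →
        ∀ᶠ z in 𝓝 ((0, s₀) : ℝ × K), orient (f z) (g z) (h z) < 0 := fun f g h hf hg hh h0 =>
      (continuous_orient hf hg hh).continuousAt.eventually_lt continuousAt_const h0
    have e3 : ∀ᶠ z : ℝ × K in 𝓝 (0, s₀), ∀ a b c, (node l o r).tri v w a b c →
        (a = w → b ≠ v → c ≠ v → (orient (ρ z.2 w) (ρ z.2 b) (ρ z.2 v) < 0 ∧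
          orient (ρ z.2 w) (ρ z.2 b) (ρ z.2 v + z.1 • δ z.2) < 0) ∨
        (orient (ρ z.2 w) (ρ z.2 v) (ρ z.2 c) < 0 ∧
          orient (ρ z.2 w) (ρ z.2 v + z.1 • δ z.2) (ρ z.2 c) < 0)) := by
      refine eventually_tri (Q := fun a b c (z : ℝ × K) => a = w → b ≠ v → c ≠ v →
        (orient (ρ z.2 w) (ρ z.2 b) (ρ z.2 v) < 0 ∧
          orient (ρ z.2 w) (ρ z.2 b) (ρ z.2 v + z.1 • δ z.2) < 0) ∨
        (orient (ρ z.2 w) (ρ z.2 v) (ρ z.2 c) < 0 ∧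
          orient (ρ z.2 w) (ρ z.2 v + z.1 • δ z.2) (ρ z.2 c) < 0)) _ v w fun a b c h => ?_
      by_cases haw : a = w
      · by_cases hbv : b = v
        · exact Eventually.of_forall fun z _ h => (h hbv).elim
        by_cases hcv : c = v
        · exact Eventually.of_forall fun z _ _ h => (h hcv).elim
        subst haw
        rcases sector G.wf₂ (hR s₀) h hbv hcv with k | k
        · filter_upwards [hop _ _ _ (hc a) (hc b) (hc v) k,
            hop _ _ _ (hc a) (hc b) hz (by simpa using k)] with z k1 k2 _ _ _
          exact Or.inl ⟨k1, k2⟩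
        · filter_upwards [hop _ _ _ (hc a) (hc v) (hc c) k,
            hop _ _ _ (hc a) hz (hc c) (by simpa using k)] with z k1 k2 _ _ _
          exact Or.inr ⟨k1, k2⟩
      · exact Eventually.of_forall fun z h => (haw h).elim
    have e4 : ∀ᶠ z : ℝ × K in 𝓝 (0, s₀), ∀ a b c, (node l o r).tri v w a b c →
        (v ∉ ({a, b, c} : Finset ℕ) → w ∉ ({a, b, c} : Finset ℕ) →
        Disjoint (convexHull ℝ {ρ z.2 a, ρ z.2 b, ρ z.2 c})
          (convexHull ℝ {ρ z.2 v, ρ z.2 w, ρ z.2 v + z.1 • δ z.2})) := by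
      refine eventually_tri (Q := fun a b c (z : ℝ × K) =>
        v ∉ ({a, b, c} : Finset ℕ) → w ∉ ({a, b, c} : Finset ℕ) →
        Disjoint (convexHull ℝ {ρ z.2 a, ρ z.2 b, ρ z.2 c})
          (convexHull ℝ {ρ z.2 v, ρ z.2 w, ρ z.2 v + z.1 • δ z.2})) _ v w fun a b c h => ?_
      by_cases hv : v ∈ ({a, b, c} : Finset ℕ)
      · exact Eventually.of_forall fun z h => (h hv).elim
      by_cases hw : w ∈ ({a, b, c} : Finset ℕ)
      · exact Eventually.of_forall fun z _ h => (h hw).elim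
      have := disjoint_base (hR s₀) h hv hw
      refine (eventually_disjoint (hc a).continuousAt (hc b).continuousAt (hc c).continuousAt
        (hc v).continuousAt (hc w).continuousAt hz.continuousAt ?_).mono fun z h _ _ => h
      rw [← convexHull_pair] at this
      simp only [zero_smul, add_zero]
      rwa [show ({ρ s₀ v, ρ s₀ w, ρ s₀ v} : Set ℂ) = {ρ s₀ v, ρ s₀ w} by ext; simp; tauto]
    filter_upwards [e3, e4] with z e3 e4 hz0
    have k1 : 0 < orient (ρ z.2 v) (ρ z.2 w) (ρ z.2 v + z.1 • δ z.2) := by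
      rw [orient_add_smul]; exact mul_pos hz0 (ha z.2).1
    have k2 : ∀ y, Nbr ((node l o r).tri v w) v y → y ≠ w →
        orient (ρ z.2 v) (ρ z.2 y) (ρ z.2 v + z.1 • δ z.2) < 0 := by
      intro y hy hyw
      rw [orient_add_smul]; exact mul_neg_of_pos_of_neg hz0 ((ha z.2).2 y hy hyw)
    exact realizes_ear G (hR z.2) k1 (k2 o ⟨w, Or.inl (Or.inl (Rot.refl _ _ _))⟩
      G.wf₂.node_facts.2.2.1) (ear_inter G.wf₂ (hR z.2) k1 k2
      (fun y c h hy hc => e3 _ _ _ h rfl hy hc) e4) hF hF'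
  obtain ⟨ε₀, hε₀, h⟩ := Metric.eventually_nhds_iff.1 ev
  refine ⟨ε₀ / 2, by positivity, fun ε h1 h2 s => h ?_ s trivial h1⟩
  rw [Real.dist_eq, sub_zero, abs_of_pos h1]; linarith

end Ear
-- The fan of triangles at a vertex
theorem exists_small_combo {A B : ℝ} (hA : 0 < A) : ∃ η : ℝ, 0 < η ∧ η ≤ 1 ∧
    0 ≤ (1 - η) * A + η * B := by
  have h0 : 0 < A + |B| := by positivity
  refine ⟨A / (A + |B|), by positivity, ?_, ?_⟩
  · rw [div_le_one h0]; linarith [abs_nonneg B]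
  · have : (1 - A / (A + |B|)) * A + A / (A + |B|) * B = A * (|B| + B) / (A + |B|) := by
      field_simp; ring
    rw [this]
    have := neg_abs_le B
    apply div_nonneg _ h0.le
    apply mul_nonneg hA.le; linarith

/-- The label `v` occurs only along the left spine of the tree, whose triangles therefore form the
fan at `v`. -/
theorem nbr_node {v z x y : ℕ} {l r : PTree} (hw : WF v z (node l x r))
    (h : Nbr ((node l x r).tri v z) v y) : y = x ∨ y = z ∨ Nbr (l.tri v x) v y := by
  obtain ⟨h1, h2, h3, h4, h5, h6, h7, h8, h9, h10⟩ := hw.node_facts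
  obtain ⟨c, h | h⟩ := h
  · rcases h with h | h | h
    · unfold Rot at h; omega
    · exact Or.inr (Or.inr ⟨c, Or.inl h⟩)
    · rcases tri_mem h with h | h | h
      · exact (h2 h).elim
      · exact (h1 h).elim
      · exact (h5 h).elim
  · rcases h with h | h | h
    · unfold Rot at h; omega
    · exact Or.inr (Or.inr ⟨c, Or.inr h⟩)
    · rcases tri_mem h with h | h | h
      · exact (h2 h).elim
      · exact (h1 h).elim
      · exact (h5 h).elim

theorem nbr_base {v z x : ℕ} {l r : PTree} : Nbr ((node l x r).tri v z) v x :=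
  ⟨z, Or.inl (Or.inl (Rot.refl _ _ _))⟩

/-- If a segment from `v` to `U` starts beyond the edge `v z` and meets the triangles beyond that
edge only in `v`, then it lies beyond all of their edges at `v`. -/
theorem fan_beyond {R : ℕ → ℂ} {U : ℂ} {v : ℕ} (σ : PTree) : ∀ z, WF v z σ →
    (∀ a b c, σ.tri v z a b c → 0 < orient (R a) (R b) (R c)) →
    (∀ a b c, σ.tri v z a b c → lhull R {a, b, c} ∩ segment ℝ (R v) U ⊆ {R v}) →
    orient (R v) (R z) U < 0 → ∀ y, Nbr (σ.tri v z) v y → orient (R v) (R y) U < 0 := by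
  induction σ with
  | leaf => rintro z - - - - y ⟨c, h | h⟩ <;> exact h.elim
  | node l x r ihl _ =>
    intro z hw hpos hint hz y hy
    -- Otherwise the segment would start inside the triangle `v x z`.
    have hx : orient (R v) (R x) U < 0 := by
      by_contra hcon
      push Not at hcon
      have hb : (node l x r).tri v z v x z := Or.inl (Rot.refl _ _ _)
      have hp := hpos _ _ _ hb
      obtain ⟨η, h0, h1, h2⟩ := exists_small_combo (A := orient (R x) (R z) (R v))
        (B := orient (R x) (R z) U) (by rwa [← orient_rot])
      have hsum : (1 - η) + η = 1 := by ring
      have hmem : (1 - η) • R v + η • U ∈ lhull R {v, x, z} := by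
        rw [lhull_triple, mem_triangle hp]
        refine ⟨?_, ?_, ?_⟩
        · rw [orient_combo _ _ _ _ hsum, orient_self_left]; simp only [mul_zero, zero_add]
          positivity
        · rw [orient_combo _ _ _ _ hsum]; exact h2
        · rw [orient_combo _ _ _ _ hsum, orient_self_right, orient_swap']
          simp only [mul_zero, zero_add]; nlinarith
      have := hint _ _ _ hb ⟨hmem, ⟨1 - η, η, by linarith, h0.le, hsum, rfl⟩⟩
      rw [Set.mem_singleton_iff] at this
      have e : η • U = η • R v := by
        rw [← sub_eq_zero]
        rw [sub_smul, one_smul] at this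
        linear_combination this
      have e2 : U = R v := smul_right_injective ℂ h0.ne' e
      rw [e2, orient_self_left] at hz
      exact lt_irrefl _ hz
    rcases nbr_node hw hy with rfl | rfl | hy
    · exact hx
    · exact hz
    · exact ihl x hw.node_left (fun a b c h => hpos a b c (Or.inr (Or.inl h)))
        (fun a b c h => hint a b c (Or.inr (Or.inl h))) hx y hy

/-- The fan at `v` beyond the edge `v z` stays on one side of the line through `v` and `R o`. -/
theorem fan_convex {T : ℕ → ℕ → ℕ → Prop} {F : ℕ → ℕ → ℕ → Prop} {R₀ R : ℕ → ℂ} {U : ℂ} {v o : ℕ}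
    (h₀ : Realizes T F R₀) (h : Realizes T F R) (hrot : ∀ a b c, T a b c → T b c a)
    (σ : PTree) : ∀ z z', WF v z σ →
    (∀ a b c, σ.tri v z a b c → T a b c) → T v z z' →
    orient (R₀ v) (R₀ z') U < 0 → orient (R₀ v) (R₀ z) U < 0 →
    (∀ y, Nbr (σ.tri v z) v y → orient (R₀ v) (R₀ y) U < 0) →
    orient (R v) (R o) (R z) < 0 → orient (R v) (R o) (R z) < orient (R v) (R o) (R z') →
    ∀ y, Nbr (σ.tri v z) v y → orient (R v) (R o) (R y) < 0 := by
  induction σ with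
  | leaf => rintro z z' - - - - - - - - y ⟨c, h | h⟩ <;> exact h.elim
  | node l x r ihl _ =>
    intro z z' hw hT hprev hz' hz hg h1 h2 y hy
    have hb : T v x z := hT _ _ _ (Or.inl (Rot.refl _ _ _))
    have hprev2 : T z z' v := hrot _ _ _ hprev
    have hx0 : orient (R₀ v) (R₀ x) U < 0 := hg x nbr_base
    -- In `R₀` the points `z'`, `z` and `x` lie in one open half-plane bounded by the line through
    -- `v` and `U`, so the two triangles at `v z` are not reflex at `v`.
    have hF : ¬ F z' v x := by
      rw [h₀.flag _ _ _ _ hb hprev2, orient_rot]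
      have p1 := h₀.pos _ _ _ hb
      have p2 := h₀.pos _ _ _ hprev
      have e : orient (R₀ v) (R₀ x) (R₀ z') * orient (R₀ v) (R₀ z) U =
          orient (R₀ v) (R₀ x) (R₀ z) * orient (R₀ v) (R₀ z') U +
          orient (R₀ v) (R₀ z) (R₀ z') * orient (R₀ v) (R₀ x) U := by
        simp only [orient, Complex.sub_re, Complex.sub_im]; ring
      intro hneg
      nlinarith [mul_pos_of_neg_of_neg hneg hz, mul_pos p1 (neg_pos.2 hz'),
        mul_pos p2 (neg_pos.2 hx0)]
    -- The flags are common to `R₀` and `R`, so in `R` the pair must be reflex at the other end of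
    -- the edge `v z`.
    have hrefl : orient (R x) (R z) (R z') < 0 := by
      rcases h.reflex _ _ _ _ hb hprev2 with k | k
      · exact (hF ((h.flag _ _ _ _ hb hprev2).2 k)).elim
      · exact k
    -- Both terms on the right of the identity `e` are negative: each further vertex of the fan is
    -- farther from the line `v o` than the one before.
    have hlt : orient (R v) (R o) (R x) < orient (R v) (R o) (R z) := by
      have p1 := h.pos _ _ _ hb
      have p2 := h.pos _ _ _ hprev
      have e : (orient (R v) (R o) (R x) - orient (R v) (R o) (R z)) *
          orient (R v) (R z) (R z') = (orient (R v) (R o) (R z) - orient (R v) (R o) (R z')) *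
          orient (R v) (R x) (R z) + orient (R v) (R o) (R z) * (-orient (R x) (R z) (R z')) := by
        simp only [orient, Complex.sub_re, Complex.sub_im]; ring
      by_contra hcon
      push Not at hcon
      nlinarith [mul_nonneg (sub_nonneg.2 hcon) p2.le, mul_pos (sub_pos.2 h2) p1,
        mul_pos (neg_pos.2 h1) (neg_pos.2 hrefl)]
    rcases nbr_node hw hy with rfl | rfl | hy
    · linarith
    · exact h1
    · exact ihl x z hw.node_left (fun a b c h => hT a b c (Or.inr (Or.inl h))) hb hz hx0
        (fun y hy => hg y (by
          obtain ⟨c, hc | hc⟩ := hy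
          · exact ⟨c, Or.inl (Or.inr (Or.inl hc))⟩
          · exact ⟨c, Or.inr (Or.inr (Or.inl hc))⟩)) (by linarith) hlt y hy

section Ear

variable {T : ℕ → ℕ → ℕ → Prop} {v w u o : ℕ} {l r : PTree} {F : ℕ → ℕ → ℕ → Prop}

theorem realizes_rest (G : Glue T v w (node leaf u leaf) (node l o r)) {R : ℕ → ℂ}
    (h : Realizes T F R) : Realizes ((node l o r).tri v w) F R := by
  have hs : ∀ a b c, (node l o r).tri v w a b c → T a b c := fun a b c h =>
    (ear_iff G a b c).2 (Or.inr h)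
  exact ⟨fun a b c k => h.pos a b c (hs _ _ _ k),
    fun a b c a' b' c' k k' => h.cplx _ _ _ _ _ _ (hs _ _ _ k) (hs _ _ _ k'),
    fun p x q o k k' => h.flag _ _ _ _ (hs _ _ _ k) (hs _ _ _ k'),
    fun p x q o k k' => h.reflex _ _ _ _ (hs _ _ _ k) (hs _ _ _ k')⟩

theorem ear_pos (G : Glue T v w (node leaf u leaf) (node l o r)) {R : ℕ → ℂ}
    (h : Realizes T F R) : 0 < orient (R v) (R w) (R u) := by
  rw [orient_rot]
  exact h.pos _ _ _ ((ear_iff G _ _ _).2 (Or.inl (Rot.refl _ _ _)))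

theorem ear_quad (G : Glue T v w (node leaf u leaf) (node l o r)) : T v o w ∧ T w u v :=
  ⟨(ear_iff G _ _ _).2 (Or.inr (Or.inl (Rot.refl _ _ _))),
    (ear_iff G _ _ _).2 (Or.inl (Rot.refl _ _ _))⟩

/-- The two signed areas at `v` and `w` have the positive sum of the areas of the two triangles, so
they are not both negative. -/
theorem ear_flag (G : Glue T v w (node leaf u leaf) (node l o r)) {R : ℕ → ℂ}
    (h : Realizes T F R) : F u v o ∧ ¬ F o w u ∨ F o w u ∧ ¬ F u v o := by
  obtain ⟨h1, h2⟩ := ear_quad G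
  have f1 := h.flag _ _ _ _ h1 h2
  have f2 := h.flag _ _ _ _ h2 h1
  have hr := h.reflex _ _ _ _ h1 h2
  have p1 := h.pos _ _ _ h1
  have p2 := h.pos _ _ _ h2
  have e2 : orient (R u) (R v) (R o) + orient (R o) (R w) (R u) =
      orient (R v) (R o) (R w) + orient (R w) (R u) (R v) := by
    simp only [orient, Complex.sub_re, Complex.sub_im]; ring
  rw [f1, f2]
  rcases hr with hr | hr
  · exact Or.inl ⟨hr, by linarith⟩
  · exact Or.inr ⟨hr, by linarith⟩

theorem ear_inter_rest (G : Glue T v w (node leaf u leaf) (node l o r)) {R : ℕ → ℂ}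
    (h : Realizes T F R) {a b c : ℕ} (k : (node l o r).tri v w a b c) :
    lhull R {a, b, c} ∩ convexHull ℝ {R v, R w, R u} ⊆ lhull R ({a, b, c} ∩ {v, w}) := by
  obtain ⟨e1, e2, e3⟩ := ear_fresh G k
  have hne : ({a, b, c} : Finset ℕ) ≠ {w, u, v} := by
    intro e
    have : u ∈ ({a, b, c} : Finset ℕ) := by rw [e]; simp
    simp only [Finset.mem_insert, Finset.mem_singleton] at this
    have := e1.symm; have := e2.symm; have := e3.symm; tauto
  have := h.cplx _ _ _ _ _ _ ((ear_iff G _ _ _).2 (Or.inr k)) (ear_quad G).2 hne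
  rw [← lhull_triple]
  rw [show ({v, w, u} : Finset ℕ) = {w, u, v} by ext; simp; tauto]
  refine this.trans (lhull_mono _ ?_)
  intro y hy
  simp only [Finset.mem_inter, Finset.mem_insert, Finset.mem_singleton] at hy ⊢
  refine ⟨hy.1, ?_⟩
  rcases hy with ⟨e4, e5 | e5 | e5⟩
  · exact Or.inr e5
  · exfalso; subst e5; have := e1.symm; have := e2.symm; have := e3.symm; tauto
  · exact Or.inl e5

/-- The direction from `v` to the tip of an ear is admissible. -/
theorem admissible_ear (G : Glue T v w (node leaf u leaf) (node l o r)) {R : ℕ → ℂ}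
    (h : Realizes T F R) (hF : F u v o) :
    Admissible ((node l o r).tri v w) v w R (R u - R v) := by
  obtain ⟨h1, h2⟩ := ear_quad G
  obtain ⟨hvw, hvo, how, k4, k5, k6, k7, k8, k9, k10⟩ := G.wf₂.node_facts
  have ho : orient (R v) (R o) (R u) < 0 := by
    rw [← orient_rot]; exact (h.flag _ _ _ _ h1 h2).1 hF
  refine ⟨by simpa using ear_pos G h, fun y hy hyw => ?_⟩
  rw [add_sub_cancel]
  rcases nbr_node G.wf₂ hy with rfl | rfl | hy
  · exact ho
  · exact (hyw rfl).elim
  -- The ear meets the triangles of `l` at most in `v`, because `w` is not a label of `l`.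
  · refine fan_beyond l o G.wf₂.node_left
      (fun a b c k => (realizes_rest G h).pos _ _ _ (Or.inr (Or.inl k))) ?_ ho y hy
    intro a b c k x hx
    have hx2 : x ∈ convexHull ℝ {R v, R w, R u} := by
      refine convexHull_mono ?_ (convexHull_pair (𝕜 := ℝ) (R v) (R u) ▸ hx.2)
      intro t ht; simp at ht ⊢; tauto
    have := ear_inter_rest G h (Or.inr (Or.inl k)) ⟨hx.1, hx2⟩
    rw [← lhull_singleton R v]
    refine lhull_mono _ ?_ this
    intro t ht
    simp only [Finset.mem_inter, Finset.mem_insert, Finset.mem_singleton] at ht ⊢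
    rcases ht with ⟨e1, rfl | rfl⟩
    · rfl
    · exfalso
      have e0 : t ∈ ({a, b, c} : Finset ℕ) := by simpa using e1
      have := tri_subset k e0
      simp only [Finset.mem_insert] at this
      rcases this with e | e | e
      · exact hvw e.symm
      · exact how e.symm
      · exact k6 e

/-- The fan at `v` beyond the triangle next to an ear that is reflex at `v` is convex. -/
theorem fan_side (G : Glue T v w (node leaf u leaf) (node l o r)) {R₀ R : ℕ → ℂ}
    (h₀ : Realizes T F R₀) (hF : F u v o) (h : Realizes ((node l o r).tri v w) F R)
    {y : ℕ} (hy : Nbr ((node l o r).tri v w) v y) (hyo : y ≠ o) (hyw : y ≠ w) :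
    orient (R v) (R o) (R y) < 0 := by
  have ha := (admissible_ear G h₀ hF).2
  simp only [add_sub_cancel] at ha
  obtain ⟨hvw, hvo, how, k4, k5, k6, k7, k8, k9, k10⟩ := G.wf₂.node_facts
  rcases nbr_node G.wf₂ hy with rfl | rfl | hy
  · exact (hyo rfl).elim
  · exact (hyw rfl).elim
  cases l with
  | leaf => obtain ⟨c, h | h⟩ := hy <;> exact h.elim
  | node l' x r' =>
    have hwl := G.wf₂.node_left
    obtain ⟨-, j2, j3, -⟩ := hwl.node_facts
    have hw2 : w ≠ x := by rintro rfl; exact k6 (by simp [PTree.inner])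
    have up : ∀ t, Nbr (l'.tri v x) v t → Nbr ((node (node l' x r') o r).tri v w) v t := by
      rintro t ⟨c, hc | hc⟩
      · exact ⟨c, Or.inl (Or.inr (Or.inl (Or.inr (Or.inl hc))))⟩
      · exact ⟨c, Or.inr (Or.inr (Or.inl (Or.inr (Or.inl hc))))⟩
    have hvxo : (node (node l' x r') o r).tri v w v x o :=
      Or.inr (Or.inl (Or.inl (Rot.refl _ _ _)))
    have hx : orient (R v) (R o) (R x) < 0 := by
      rw [orient_swap]
      have := h.pos _ _ _ hvxo
      linarith
    rcases nbr_node hwl hy with rfl | rfl | hy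
    · exact hx
    · exact (hyo rfl).elim
    -- The tip of the ear in `R₀` serves as `U`: by `ha` it lies beyond the whole fan there. The
    -- first comparison, of `x` with `o`, holds because `o` is on the line.
    · refine fan_convex (realizes_rest G h₀) h (fun a b c => tri_rot) l' x o hwl.node_left
        (fun a b c k => Or.inr (Or.inl (Or.inr (Or.inl k)))) hvxo
        (ha o nbr_base how) (ha x ⟨o, Or.inl hvxo⟩ (Ne.symm hw2)) (fun t ht => ?_) hx
        (by rwa [orient_self_right]) y hy
      refine ha t (up t ht) ?_
      rintro rfl
      obtain ⟨c, hc | hc⟩ := ht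
      · rcases tri_mem2 hc with e | e | e
        · exact hvw e.symm
        · exact hw2 e
        · exact k6 (by simp [PTree.inner, e])
      · rcases tri_mem3 hc with e | e | e
        · exact hvw e.symm
        · exact hw2 e
        · exact k6 (by simp [PTree.inner, e])

end Ear
-- Moving an ear together with the rest
section Ear

variable {T : ℕ → ℕ → ℕ → Prop} {v w u o : ℕ} {l r : PTree} {F : ℕ → ℕ → ℕ → Prop}

theorem orient_base_combo (p q d d' : ℂ) (s t : ℝ) :
    orient p q (p + (s • d + t • d')) = s * orient p q (p + d) + t * orient p q (p + d') := by
  simp only [orient, Complex.sub_re, Complex.sub_im, Complex.add_re, Complex.add_im,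
    Complex.real_smul, Complex.re_ofReal_mul, Complex.im_ofReal_mul]; ring

theorem convex_admissible (T : ℕ → ℕ → ℕ → Prop) (v w : ℕ) (R : ℕ → ℂ) :
    Convex ℝ {d | Admissible T v w R d} := by
  intro d hd d' hd' s t hs ht hst
  have key : ∀ {a b : ℝ}, 0 < a → 0 < b → 0 < s * a + t * b := by
    intro a b ha hb
    rcases hs.lt_or_eq with h | h
    · have := mul_pos h ha; have := mul_nonneg ht hb.le; linarith
    · subst h; obtain rfl : t = 1 := by linarith
      linarith
  refine ⟨?_, fun y hy hyw => ?_⟩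
  · rw [orient_base_combo]; exact key hd.1 hd'.1
  · rw [orient_base_combo]
    have := key (neg_pos.2 (hd.2 y hy hyw)) (neg_pos.2 (hd'.2 y hy hyw))
    linarith

/-- Slightly turned from the extension of the edge `o v`, a direction is admissible. -/
theorem exists_slaved {K : Type*} [TopologicalSpace K] [CompactSpace K]
    (G : Glue T v w (node leaf u leaf) (node l o r)) {ρ : K → ℕ → ℂ} (hρ : Continuous ρ)
    (hR : ∀ s, Realizes ((node l o r).tri v w) F (ρ s)) {R₀ : ℕ → ℂ} (h₀ : Realizes T F R₀)
    (hF : F u v o) : ∃ η : ℝ, 0 < η ∧ ∀ s, Admissible ((node l o r).tri v w) v w (ρ s)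
      ((ρ s v - ρ s o) + η • (ρ s v - ρ s w)) := by
  obtain ⟨hvw, hvo, how, -⟩ := G.wf₂.node_facts
  -- By `fan_side` the direction `v - o` satisfies all conditions strictly except the one at `o`,
  -- where it gives zero. The tilt by `η (v - w)` makes that one negative, and a small tilt keeps
  -- the others.
  have ev : ∀ᶠ η : ℝ in 𝓝 0, ∀ s ∈ (Set.univ : Set K), 0 < η →
      Admissible ((node l o r).tri v w) v w (ρ s)
        ((ρ s v - ρ s o) + η • (ρ s v - ρ s w)) := by
    refine isCompact_univ.eventually_forall_of_forall_eventually fun s₀ _ => ?_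
    have hc : ∀ y, Continuous fun z : ℝ × K => ρ z.2 y := fun y =>
      (continuous_apply y).comp (hρ.comp continuous_snd)
    have hz : Continuous fun z : ℝ × K =>
        ρ z.2 v + ((ρ z.2 v - ρ z.2 o) + z.1 • (ρ z.2 v - ρ z.2 w)) := by
      have := hc v; have := hc o; have := hc w; fun_prop
    have ey : ∀ y, Nbr ((node l o r).tri v w) v y → y ≠ w → y ≠ o →
        ∀ᶠ z : ℝ × K in 𝓝 (0, s₀), orient (ρ z.2 v) (ρ z.2 y)
          (ρ z.2 v + ((ρ z.2 v - ρ z.2 o) + z.1 • (ρ z.2 v - ρ z.2 w))) < 0 := by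
      intro y hy hyw hyo
      have := fan_side G h₀ hF (hR s₀) hy hyo hyw
      refine (continuous_orient (hc v) (hc y) hz).continuousAt.eventually_lt
        continuousAt_const ?_
      have e : ∀ a b c : ℂ, orient a b (a + (a - c)) = orient a c b := by
        intro a b c; simp only [orient, Complex.sub_re, Complex.sub_im, Complex.add_re,
          Complex.add_im]; ring
      simpa [e] using this
    have e3 := eventually_tri (f := 𝓝 ((0, s₀) : ℝ × K)) (Q := fun a b c (z : ℝ × K) => a = v →
        (b ≠ w → b ≠ o → orient (ρ z.2 v) (ρ z.2 b)
          (ρ z.2 v + ((ρ z.2 v - ρ z.2 o) + z.1 • (ρ z.2 v - ρ z.2 w))) < 0) ∧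
        (c ≠ w → c ≠ o → orient (ρ z.2 v) (ρ z.2 c)
          (ρ z.2 v + ((ρ z.2 v - ρ z.2 o) + z.1 • (ρ z.2 v - ρ z.2 w))) < 0))
        (node l o r) v w ?_
    · filter_upwards [e3] with z e3 hz0
      have hp := (hR z.2).pos _ _ _ (Or.inl (Rot.refl _ _ _))
      refine ⟨?_, fun y hy hyw => ?_⟩
      · have e : ∀ (a b c : ℂ) (t : ℝ), orient a b (a + ((a - c) + t • (a - b))) =
            orient a c b := by
          intro a b c t; simp only [orient, Complex.sub_re, Complex.sub_im, Complex.add_re,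
            Complex.add_im, Complex.real_smul, Complex.re_ofReal_mul, Complex.im_ofReal_mul]; ring
        rw [e]; exact hp
      · by_cases hyo : y = o
        · subst hyo
          have e : ∀ (a b c : ℂ) (t : ℝ), orient a b (a + ((a - b) + t • (a - c))) =
              - (t * orient a b c) := by
            intro a b c t; simp only [orient, Complex.sub_re, Complex.sub_im, Complex.add_re,
              Complex.add_im, Complex.real_smul, Complex.re_ofReal_mul,
              Complex.im_ofReal_mul]; ring
          rw [e, neg_lt_zero]; exact mul_pos hz0 hp
        · obtain ⟨c, hc | hc⟩ := hy
          · exact (e3 _ _ _ hc rfl).1 hyw hyo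
          · exact (e3 _ _ _ hc rfl).2 hyw hyo
    · intro a b c k
      by_cases hav : a = v
      · subst hav
        have : ∀ y, Nbr ((node l o r).tri a w) a y → ∀ᶠ z : ℝ × K in 𝓝 (0, s₀),
            (y ≠ w → y ≠ o → orient (ρ z.2 a) (ρ z.2 y)
          (ρ z.2 a + ((ρ z.2 a - ρ z.2 o) + z.1 • (ρ z.2 a - ρ z.2 w))) < 0) := by
          intro y hy
          by_cases h1 : y = w
          · exact Eventually.of_forall fun z h => (h h1).elim
          by_cases h2 : y = o
          · exact Eventually.of_forall fun z _ h => (h h2).elim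
          exact (ey y hy h1 h2).mono fun z h _ _ => h
        filter_upwards [this b ⟨c, Or.inl k⟩, this c ⟨b, Or.inr k⟩] with z z1 z2 _
        exact ⟨z1, z2⟩
      · exact Eventually.of_forall fun z h => (hav h).elim
  obtain ⟨ε₀, hε₀, h⟩ := Metric.eventually_nhds_iff.1 ev
  refine ⟨ε₀ / 2, by positivity, fun s => h ?_ s trivial (by positivity)⟩
  rw [Real.dist_eq, sub_zero, abs_of_pos (by positivity)]; linarith

/-- An ear can be shrunk towards `v`. -/
theorem realizes_shrink (G : Glue T v w (node leaf u leaf) (node l o r)) {R : ℕ → ℂ}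
    (h : Realizes T F R) (hF : F u v o ∧ ¬ F o w u) {ε : ℝ} (h0 : 0 < ε) (h1 : ε ≤ 1) :
    Realizes T F (Function.update R u (R v + ε • (R u - R v))) := by
  have ha := admissible_ear G h hF.1
  have k1 := ha.2 o nbr_base G.wf₂.node_facts.2.2.1
  refine realizes_ear G (realizes_rest G h) ?_ ?_ ?_ hF.1 hF.2
  · rw [orient_add_smul]; exact mul_pos h0 ha.1
  · rw [orient_add_smul]; exact mul_neg_of_pos_of_neg h0 k1
  · intro a b c k
    refine Set.Subset.trans ?_ (ear_inter_rest G h k)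
    refine Set.inter_subset_inter_right _ ?_
    apply convexHull_min _ (convex_convexHull ℝ _)
    have hv : R v ∈ convexHull ℝ {R v, R w, R u} := subset_convexHull ℝ _ (by simp)
    have hu : R u ∈ convexHull ℝ {R v, R w, R u} := subset_convexHull ℝ _ (by simp)
    rintro y (rfl | rfl | rfl)
    · exact hv
    · exact subset_convexHull ℝ _ (by simp)
    · have := (convex_convexHull ℝ {R v, R w, R u}) hv hu (sub_nonneg.2 h1) h0.le (by ring)
      convert this using 1
      simp only [sub_smul, smul_sub, one_smul]; ring

/-- The rest moves along `ρ` and carries the tip along at `v + ε δ`. -/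
theorem joinedIn_of_admissible (G : Glue T v w (node leaf u leaf) (node l o r))
    {ρ : unitInterval → ℕ → ℂ} (hρ : Continuous ρ) {δ : unitInterval → ℂ} (hδ : Continuous δ)
    (hR : ∀ s, Realizes ((node l o r).tri v w) F (ρ s))
    (ha : ∀ s, Admissible ((node l o r).tri v w) v w (ρ s) (δ s))
    (hF : F u v o ∧ ¬ F o w u) : ∃ ε₀ : ℝ, 0 < ε₀ ∧ ∀ ε : ℝ, 0 < ε → ε ≤ ε₀ →
      JoinedIn {R | Realizes T F R} (Function.update (ρ 0) u (ρ 0 v + ε • δ 0))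
        (Function.update (ρ 1) u (ρ 1 v + ε • δ 1)) := by
  obtain ⟨ε₀, h0, h⟩ := exists_ear_size G hρ hδ hR ha hF.1 hF.2
  refine ⟨ε₀, h0, fun ε h1 h2 => ?_⟩
  refine ⟨⟨⟨fun s => Function.update (ρ s) u (ρ s v + ε • δ s), ?_⟩, rfl, rfl⟩, fun s =>
    h ε h1 h2 s⟩
  have : Continuous fun s => ρ s v := (continuous_apply v).comp hρ
  exact hρ.update u (by fun_prop)

theorem joinedIn_shrink (G : Glue T v w (node leaf u leaf) (node l o r)) {R : ℕ → ℂ}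
    (h : Realizes T F R) (hF : F u v o ∧ ¬ F o w u) {ε : ℝ} (h0 : 0 < ε) (h1 : ε ≤ 1) :
    JoinedIn {R | Realizes T F R} R (Function.update R u (R v + ε • (R u - R v))) := by
  refine JoinedIn.ofLine (f := fun s : ℝ =>
    Function.update R u (R v + (1 - s + s * ε) • (R u - R v))) ?_ ?_ ?_ ?_
  · exact (continuous_const.update u (by fun_prop)).continuousOn
  · simp
  · simp
  · rintro _ ⟨s, ⟨hs0, hs1⟩, rfl⟩
    refine realizes_shrink G h hF ?_ ?_ <;> nlinarith

/-- The rest stands still while the direction is interpolated linearly, which `convex_admissible`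
permits. -/
theorem joinedIn_rotate (G : Glue T v w (node leaf u leaf) (node l o r)) {R : ℕ → ℂ}
    (h : Realizes ((node l o r).tri v w) F R) (hF : F u v o ∧ ¬ F o w u) {d d' : ℂ}
    (hd : Admissible ((node l o r).tri v w) v w R d)
    (hd' : Admissible ((node l o r).tri v w) v w R d') : ∃ ε₀ : ℝ, 0 < ε₀ ∧ ∀ ε : ℝ, 0 < ε →
      ε ≤ ε₀ → JoinedIn {R | Realizes T F R} (Function.update R u (R v + ε • d))
        (Function.update R u (R v + ε • d')) := by
  have := joinedIn_of_admissible G (ρ := fun _ => R) continuous_const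
    (δ := fun s => (1 - (s : ℝ)) • d + (s : ℝ) • d') (by fun_prop) (fun _ => h)
    (fun s => convex_admissible _ _ _ _ hd hd' (sub_nonneg.2 s.2.2) s.2.1 (by ring)) hF
  simpa using this

/-- Five moves: shrink the ear, turn it to the direction of `exists_slaved`, let it follow the path
of the rest, turn it to its final direction, and let it grow. The same small `ε` is used throughout.
-/
theorem joinedIn_ear (G : Glue T v w (node leaf u leaf) (node l o r)) {R₀ R₁ : ℕ → ℂ}
    (h₀ : Realizes T F R₀) (h₁ : Realizes T F R₁) (hF : F u v o ∧ ¬ F o w u)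
    (hj : JoinedIn {R | Realizes ((node l o r).tri v w) F R} R₀ R₁) :
    JoinedIn {R | Realizes T F R} R₀ R₁ := by
  obtain ⟨γ, hγ⟩ := hj
  obtain ⟨η, hη, ha⟩ := exists_slaved G γ.continuous hγ h₀ hF.1
  have hc : ∀ y, Continuous fun s => γ s y := fun y => (continuous_apply y).comp γ.continuous
  obtain ⟨ε₁, p1, j1⟩ := joinedIn_of_admissible G γ.continuous (by
    have := hc v; have := hc o; have := hc w; fun_prop) hγ ha hF
  have ha0 := ha 0
  have ha1 := ha 1
  simp only [γ.source, γ.target] at ha0 ha1 j1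
  obtain ⟨ε₂, p2, j2⟩ := joinedIn_rotate G (realizes_rest G h₀) hF (admissible_ear G h₀ hF.1) ha0
  obtain ⟨ε₃, p3, j3⟩ := joinedIn_rotate G (realizes_rest G h₁) hF ha1 (admissible_ear G h₁ hF.1)
  set ε := min (min ε₁ ε₂) (min ε₃ 1)
  have hε : 0 < ε := by positivity
  have e1 : ε ≤ ε₁ := (min_le_left _ _).trans (min_le_left _ _)
  have e2 : ε ≤ ε₂ := (min_le_left _ _).trans (min_le_right _ _)
  have e3 : ε ≤ ε₃ := (min_le_right _ _).trans (min_le_left _ _)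
  have e4 : ε ≤ 1 := (min_le_right _ _).trans (min_le_right _ _)
  exact (joinedIn_shrink G h₀ hF hε e4).trans ((j2 ε hε e2).trans ((j1 ε hε e1).trans
    ((j3 ε hε e3).trans (joinedIn_shrink G h₁ hF hε e4).symm)))

end Ear

/-! ### Mirror images and the induction on the number of triangles -/

/-- Complex conjugation of all points. -/
noncomputable def conjMap (R : ℕ → ℂ) : ℕ → ℂ := fun y => (starRingEnd ℂ) (R y)

theorem continuous_conjMap : Continuous conjMap :=
  continuous_pi fun y => Complex.continuous_conj.comp (continuous_apply y)

theorem conjMap_conjMap (R : ℕ → ℂ) : conjMap (conjMap R) = R := by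
  funext y; simp [conjMap]

theorem orient_conj (a b c : ℂ) :
    orient ((starRingEnd ℂ) a) ((starRingEnd ℂ) b) ((starRingEnd ℂ) c) = orient c b a := by
  simp only [orient, Complex.sub_re, Complex.sub_im, Complex.conj_re, Complex.conj_im]; ring

theorem lhull_conjMap (R : ℕ → ℂ) (t : Finset ℕ) :
    lhull (conjMap R) t = (starRingEnd ℂ) '' lhull R t := by
  unfold lhull
  have := (Complex.conjAe.toLinearMap).image_convexHull (R '' (t : Set ℕ))
  rw [Set.image_image] at this
  exact this.symm

/-- Conjugation reverses every counter-clockwise triple and exchanges the roles of `v` and `w` at an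
ear, so only ears that are reflex at `v` need to be moved directly. -/
theorem realizes_conjMap {T : ℕ → ℕ → ℕ → Prop} {F : ℕ → ℕ → ℕ → Prop} {R : ℕ → ℂ}
    (h : Realizes T F R) :
    Realizes (fun a b c => T c b a) (fun a b c => F c b a) (conjMap R) := by
  have hs : ∀ a b c : ℕ, ({c, b, a} : Finset ℕ) = {a, b, c} := by intro a b c; ext; simp; tauto
  refine ⟨fun a b c k => ?_, fun a b c a' b' c' k k' hne => ?_, fun p x q o k k' => ?_,
    fun p x q o k k' => ?_⟩
  · simp only [conjMap, orient_conj]; exact h.pos _ _ _ k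
  · have := h.cplx _ _ _ _ _ _ k k' (by rwa [hs a b c, hs a' b' c'])
    rw [hs a b c, hs a' b' c'] at this
    rw [lhull_conjMap, lhull_conjMap, lhull_conjMap,
      ← Set.image_inter (starRingEnd ℂ).injective]
    exact Set.image_mono this
  · simp only [conjMap, orient_conj]
    exact h.flag _ _ _ _ k' k
  · simp only [conjMap, orient_conj]
    exact h.reflex _ _ _ _ k' k

theorem joinedIn_of_conjMap {T : ℕ → ℕ → ℕ → Prop} {F : ℕ → ℕ → ℕ → Prop} {R₀ R₁ : ℕ → ℂ}
    (h : JoinedIn {R | Realizes (fun a b c => T c b a) (fun a b c => F c b a) R}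
      (conjMap R₀) (conjMap R₁)) : JoinedIn {R | Realizes T F R} R₀ R₁ := by
  have := h.map continuous_conjMap
  rw [conjMap_conjMap, conjMap_conjMap] at this
  refine this.mono ?_
  rintro _ ⟨R, hR, rfl⟩
  exact realizes_conjMap hR

/-- Bring the apex to `p - I (q - p)`, so that the triangle is half of a square and is governed by
the vector `q - p`; then move this vector in the punctured plane. Labels outside the triangle are
unconstrained and are interpolated. -/
theorem joinedIn_triangle {p q x : ℕ} (hw : WF p q (node leaf x leaf)) {F : ℕ → ℕ → ℕ → Prop}
    {R₀ R₁ : ℕ → ℂ} (h₀ : Realizes ((node leaf x leaf).tri p q) F R₀)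
    (h₁ : Realizes ((node leaf x leaf).tri p q) F R₁) :
    JoinedIn {R | Realizes ((node leaf x leaf).tri p q) F R} R₀ R₁ := by
  obtain ⟨hpq, hpx, hxq, -⟩ := hw.node_facts
  have key : ∀ R : ℕ → ℂ, 0 < orient (R p) (R x) (R q) →
      Realizes ((node leaf x leaf).tri p q) F R := by
    intro R hR
    refine ⟨fun a b c k => ?_, fun a b c a' b' c' k k' hne => ?_, fun p' x' q' o k k' => ?_,
      fun p' x' q' o k k' => ?_⟩
    · rcases k with (⟨rfl, rfl, rfl⟩ | ⟨rfl, rfl, rfl⟩ | ⟨rfl, rfl, rfl⟩) | k | k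
      · exact hR
      · rwa [← orient_rot]
      · rwa [orient_rot]
      · exact k.elim
      · exact k.elim
    · simp only [tri, or_false] at k k'
      exact (hne (k.finset_eq.trans k'.finset_eq.symm)).elim
    all_goals
      simp only [tri, or_false, Rot] at k k'
      omega
  have pos : ∀ R, Realizes ((node leaf x leaf).tri p q) F R → 0 < orient (R p) (R x) (R q) :=
    fun R hR => hR.pos _ _ _ (Or.inl (Rot.refl _ _ _))
  have hst : ∀ a b : ℂ, orient a (a - Complex.I * (b - a)) b = Complex.normSq (b - a) := by
    intro a b
    simp only [orient, Complex.normSq_apply, Complex.sub_re, Complex.sub_im, Complex.mul_re,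
      Complex.mul_im, Complex.I_re, Complex.I_im]; ring
  have e : ∀ a b c : ℂ, orient a b c = orient c a b := fun a b c => (orient_rot c a b).symm
  have step : ∀ R : ℕ → ℂ, 0 < orient (R p) (R x) (R q) →
      JoinedIn {R | Realizes ((node leaf x leaf).tri p q) F R} R
        (Function.update R x (R p - Complex.I * (R q - R p))) := by
    intro R hR
    have hne : R q - R p ≠ 0 := by
      intro h0; rw [sub_eq_zero] at h0; rw [h0, orient_self_left] at hR; exact lt_irrefl _ hR
    refine JoinedIn.ofLine (f := fun s : ℝ => Function.update R x
      ((1 - s) • R x + s • (R p - Complex.I * (R q - R p)))) ?_ ?_ ?_ ?_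
    · exact (continuous_const.update x (by fun_prop)).continuousOn
    · simp
    · simp
    · rintro _ ⟨s, ⟨hs0, hs1⟩, rfl⟩
      apply key
      beta_reduce
      rw [Function.update_self, Function.update_of_ne hpx, Function.update_of_ne hxq.symm, e,
        orient_combo _ _ _ _ (by ring), ← e, ← e (R p) (R p - _), hst]
      have h2 := Complex.normSq_pos.2 hne
      rcases hs0.lt_or_eq with h | h
      · have := mul_pos h h2; have := mul_nonneg (sub_nonneg.2 hs1) hR.le; linarith
      · subst h; simpa using hR
  refine (step R₀ (pos _ h₀)).trans (JoinedIn.trans ?_ (step R₁ (pos _ h₁)).symm)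
  have hne : ∀ R : ℕ → ℂ, 0 < orient (R p) (R x) (R q) → R q - R p ∈ ({0}ᶜ : Set ℂ) := by
    intro R hR h0
    rw [Set.mem_singleton_iff, sub_eq_zero] at h0
    rw [h0, orient_self_left] at hR; exact lt_irrefl _ hR
  obtain ⟨γ, hγ⟩ := (isPathConnected_compl_singleton_of_one_lt_rank (E := ℂ)
    (by simp) 0).joinedIn _ (hne R₀ (pos _ h₀)) _ (hne R₁ (pos _ h₁))
  let ρ : unitInterval → ℕ → ℂ := fun s y => (1 - (s : ℝ)) • R₀ y + (s : ℝ) • R₁ y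
  have hρ : Continuous ρ := by
    refine continuous_pi fun y => ?_
    fun_prop
  have hρp : Continuous fun s => ρ s p := (continuous_apply p).comp hρ
  refine ⟨⟨⟨fun s => Function.update (Function.update (ρ s) q (ρ s p + γ s)) x
    (ρ s p - Complex.I * γ s), ?_⟩, ?_, ?_⟩, fun s => ?_⟩
  · exact (hρ.update q (hρp.add γ.continuous)).update x
      (hρp.sub (continuous_const.mul γ.continuous))
  · have : ρ 0 = R₀ := by funext y; simp [ρ]
    simp only [this, γ.source, add_sub_cancel, Function.update_eq_self]
  · have : ρ 1 = R₁ := by funext y; simp [ρ]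
    simp only [this, γ.target, add_sub_cancel, Function.update_eq_self]
  · apply key
    simp only [Path.coe_mk', ContinuousMap.coe_mk]
    have e1 : γ s = (ρ s p + γ s) - ρ s p := by ring
    rw [Function.update_self, Function.update_of_ne hpx, Function.update_of_ne hpq,
      Function.update_of_ne hxq.symm, Function.update_self]
    have h3 := hst (ρ s p) (ρ s p + γ s)
    rw [← e1] at h3
    rw [h3]
    exact Complex.normSq_pos.2 (hγ s)

/-- Any two realizations of the same directed dual are joined by a path of realizations. -/
theorem joinedIn_realizes : ∀ (N : ℕ) {p q : ℕ} {τ : PTree} {F : ℕ → ℕ → ℕ → Prop} {R₀ R₁ : ℕ → ℂ},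
    τ.size = N + 1 → WF p q τ → Realizes (τ.tri p q) F R₀ → Realizes (τ.tri p q) F R₁ →
    JoinedIn {R | Realizes (τ.tri p q) F R} R₀ R₁ := by
  intro N
  induction N with
  | zero =>
    intro p q τ F R₀ R₁ hN hw h₀ h₁
    cases τ with
    | leaf => simp [size] at hN
    | node l x r =>
      have hl : l = leaf := by cases l <;> simp [size] at hN ⊢
      have hr : r = leaf := by cases r <;> simp [size] at hN ⊢
      subst hl hr
      exact joinedIn_triangle hw h₀ h₁
  | succ N ih =>
    intro p q τ F R₀ R₁ hN hw h₀ h₁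
    cases τ with
    | leaf => simp [size] at hN
    | node l x r =>
      have hlr : l ≠ leaf ∨ r ≠ leaf := by
        by_contra hcon
        push Not at hcon
        obtain ⟨rfl, rfl⟩ := hcon
        simp [size] at hN
      obtain ⟨v, w, u, l', o, r', G, hsz⟩ := hw.exists_ear hlr
      rcases ear_flag G h₀ with hF | hF
      · exact joinedIn_ear G h₀ h₁ hF
          (ih (by omega) G.wf₂ (realizes_rest G h₀) (realizes_rest G h₁))
      -- This ear is reflex at `w`.
      · apply joinedIn_of_conjMap
        have G' := G.mirror
        simp only [mirror] at G'
        have k₀ := realizes_conjMap h₀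
        have k₁ := realizes_conjMap h₁
        refine joinedIn_ear G' k₀ k₁ hF
          (ih ?_ G'.wf₂ (realizes_rest G' k₀) (realizes_rest G' k₁))
        have e1 := size_mirror (node l' o r')
        simp only [mirror] at e1
        omega

/-! ### Visibility inside a realization -/

section Sight

variable {T : ℕ → ℕ → ℕ → Prop} {F : ℕ → ℕ → ℕ → Prop} {R : ℕ → ℂ}

theorem isClosed_region (τ : PTree) (p q : ℕ) (R : ℕ → ℂ) : IsClosed (region (τ.tri p q) R) := by
  induction τ generalizing p q with
  | leaf =>
    have : region (leaf.tri p q) R = ∅ := by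
      ext z; simp [region, tri]
    rw [this]; exact isClosed_empty
  | node l x r ihl ihr =>
    have : region ((node l x r).tri p q) R =
        lhull R {p, x, q} ∪ region (l.tri p x) R ∪ region (r.tri x q) R := by
      ext z
      constructor
      · rintro ⟨a, b, c, h | h | h, hz⟩
        · rw [h.finset_eq] at hz; exact Or.inl (Or.inl hz)
        · exact Or.inl (Or.inr ⟨a, b, c, h, hz⟩)
        · exact Or.inr ⟨a, b, c, h, hz⟩
      · rintro ((hz | ⟨a, b, c, h, hz⟩) | ⟨a, b, c, h, hz⟩)
        · exact ⟨p, x, q, Or.inl (Rot.refl _ _ _), hz⟩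
        · exact ⟨a, b, c, Or.inr (Or.inl h), hz⟩
        · exact ⟨a, b, c, Or.inr (Or.inr h), hz⟩
    rw [this]
    exact ((isClosed_lhull _ _).union (ihl p x)).union (ihr x q)

theorem vertex_mem (h : Realizes T F R) {a a₁ a₂ b c d : ℕ} (ha : T a a₁ a₂) (ht : T b c d)
    (hm : R a ∈ lhull R {b, c, d}) : a ∈ ({b, c, d} : Finset ℕ) := by
  by_cases he : ({a, a₁, a₂} : Finset ℕ) = {b, c, d}
  · rw [← he]; simp
  · have h1 := h.cplx _ _ _ _ _ _ ha ht he ⟨mem_lhull R (by simp), hm⟩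
    have h2 := lhull_inter (h.pos _ _ _ ha).ne' (s := {a}) (by simp) Finset.inter_subset_left
      ⟨mem_lhull R (by simp), h1⟩
    by_contra hcon
    have : ({a} : Finset ℕ) ∩ ({a, a₁, a₂} ∩ {b, c, d}) = ∅ := by
      rw [Finset.singleton_inter_of_notMem]
      intro hmem; exact hcon (Finset.mem_inter.1 hmem).2
    rw [this] at h2
    simp [lhull] at h2

theorem exists_crossing {X Y : Set ℂ} (hX : IsClosed X) (hY : IsClosed Y) {c b : ℂ}
    (hsub : segment ℝ c b ⊆ X ∪ Y) (hc : c ∈ Y) (hb : b ∈ X) :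
    ∃ z ∈ segment ℝ c b, z ∈ X ∧ z ∈ Y := by
  have := isPreconnected_closed_iff.1 (convex_segment (𝕜 := ℝ) c b).isPreconnected X Y hX hY hsub
    ⟨b, right_mem_segment ℝ c b, hb⟩ ⟨c, left_mem_segment ℝ c b, hc⟩
  obtain ⟨z, h1, h2, h3⟩ := this
  exact ⟨z, h1, h2, h3⟩

/-- From `o`, the side `v x` of the triangle `v x w` is hidden behind `v`. -/
theorem blocked {v w x o k c : ℂ} {X Y : Set ℂ} (hX : IsClosed X) (hY : IsClosed Y)
    (h1 : orient v x o * orient v x w < 0) (h2 : orient v w o * orient v w x < 0)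
    (hc : c ∈ segment ℝ v w) (hck : c ∈ segment ℝ o k) (hne : c ≠ k)
    (hsub : segment ℝ c k ⊆ X ∪ Y) (hB : convexHull ℝ {v, w, x} ⊆ Y) (hk : k ∈ X)
    (hXY : X ∩ Y ⊆ segment ℝ v x) : False := by
  set m := orient v x w with hm
  have hm0 : m ≠ 0 := by rintro h; rw [h, mul_zero] at h1; exact lt_irrefl _ h1
  have hmm : 0 < m * m := mul_self_pos.2 hm0
  have hcB : c ∈ convexHull ℝ {v, w, x} := by
    refine convexHull_mono ?_ (convexHull_pair (𝕜 := ℝ) v w ▸ hc)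
    intro t ht; simp at ht ⊢; tauto
  have hvB : v ∈ convexHull ℝ {v, w, x} := subset_convexHull ℝ _ (by simp)
  obtain ⟨s, t, hs, ht, hst, e⟩ := hck
  have hs0 : 0 < s := by
    rcases hs.lt_or_eq with h | h
    · exact h
    · subst h; obtain rfl : t = 1 := by linarith
      exact (hne (by rw [← e]; simp)).elim
  obtain ⟨s', t', hs', ht', hst', e'⟩ := hc
  -- Multiplication by `m` makes the side of the line `v x` that contains `w` the positive one. The
  -- line of sight starts on the negative side and is not negative at `c`, so it is positive at `k`.
  have gc : orient v x c * m = t' * (m * m) := by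
    rw [← e', orient_combo _ _ _ _ hst', orient_self_left, hm]; ring
  have gc' : orient v x c * m = s * (orient v x o * m) + t * (orient v x k * m) := by
    rw [← e, orient_combo _ _ _ _ hst]; ring
  have gk0 : 0 < t * (orient v x k * m) := by
    have := mul_pos_of_neg_of_neg (neg_lt_zero.2 hs0) h1
    have := mul_nonneg ht' hmm.le
    linarith
  have gk : 0 < orient v x k * m := pos_of_mul_pos_right gk0 ht
  have ht0 : 0 < t := by
    rcases ht.lt_or_eq with h | h
    · exact h
    · subst h; rw [zero_mul] at gk0; exact (lt_irrefl _ gk0).elim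
  obtain ⟨y, hy1, hy2, hy3⟩ : ∃ y ∈ segment ℝ c k, y ∈ Y ∧ 0 < orient v x y * m := by
    rcases ht'.lt_or_eq with h | h
    · exact ⟨c, left_mem_segment ℝ c k, hB hcB, by rw [gc]; positivity⟩
    -- If `c = v`, the point `c` is itself on the line `v x`. As `v - o` is a positive combination
    -- of `x - v` and `w - v`, the line of sight enters the triangle behind `v`, and a point of it
    -- there serves as `y`.
    · subst h
      obtain rfl : s' = 1 := by linarith
      simp only [zero_smul, one_smul, add_zero] at e'
      subst e'
      set β := -(orient v x o * m) / (m * m) with hβ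
      set α := -(orient v w o * orient v w x) / (m * m) with hα
      have hβ0 : 0 < β := div_pos (neg_pos.2 h1) hmm
      have hα0 : 0 < α := div_pos (neg_pos.2 h2) hmm
      have hswap : orient v w x = -m := by rw [hm, orient_swap]
      have eo : v - o = α • (x - v) + β • (w - v) := by
        rw [hα, hβ, hswap]
        apply Complex.ext <;>
        simp only [Complex.add_re, Complex.add_im, Complex.sub_re, Complex.sub_im,
          Complex.real_smul, Complex.re_ofReal_mul, Complex.im_ofReal_mul] <;> field_simp <;>
        simp only [hm, orient, Complex.sub_re, Complex.sub_im] <;> ring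
      have ek : k - v = (s / t) • (v - o) := by
        have : t • (k - v) = s • (v - o) := by
          have h5 : s • v + t • v = v := by rw [← add_smul, hst, one_smul]
          rw [smul_sub, smul_sub, sub_eq_sub_iff_add_eq_add, h5, add_comm]
          exact e
        rw [div_eq_inv_mul, mul_smul, ← this, smul_smul, inv_mul_cancel₀ ht0.ne', one_smul]
      set ε := min 1 (1 / (s / t * (α + β)))
      have hst0 : 0 < s / t * (α + β) := by positivity
      have hε0 : 0 < ε := by positivity
      have hε1 : ε ≤ 1 := min_le_left _ _
      -- This bound keeps the barycentric coordinate at `v` nonnegative.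
      have hε2 : ε * (s / t * (α + β)) ≤ 1 := by
        have : ε ≤ 1 / (s / t * (α + β)) := min_le_right _ _
        rwa [le_div_iff₀ hst0] at this
      have ey : (1 - ε) • v + ε • k = v + ε • (k - v) := by
        simp only [sub_smul, smul_sub, one_smul]; ring
      refine ⟨(1 - ε) • v + ε • k, ⟨1 - ε, ε, by linarith, hε0.le, by ring, rfl⟩, hB ?_, ?_⟩
      · rw [ey, ek, eo]
        have := (convex_convexHull ℝ {v, w, x}).sum_mem (t := (Finset.univ : Finset (Fin 3)))
          (w := ![1 - ε * (s / t * (α + β)), ε * (s / t) * α, ε * (s / t) * β])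
          (z := ![v, x, w]) ?_ ?_ ?_
        · convert this using 1
          simp only [Fin.sum_univ_three, Matrix.cons_val_zero, Matrix.cons_val_one,
            Matrix.cons_val, smul_add, smul_sub, smul_smul, sub_smul, one_smul, mul_add, add_smul]
          ring_nf
        · intro i _; fin_cases i
          · simpa using hε2
          · simp; positivity
          · simp; positivity
        · simp only [Fin.sum_univ_three, Matrix.cons_val_zero, Matrix.cons_val_one,
            Matrix.cons_val]; ring
        · intro i _; fin_cases i
          · exact hvB
          · exact subset_convexHull ℝ _ (by simp)
          · exact subset_convexHull ℝ _ (by simp)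
      · rw [orient_combo _ _ _ _ (by ring), orient_self_left, mul_zero, zero_add, mul_assoc]
        exact mul_pos hε0 gk
  -- From `y` to `k` the segment stays on the positive side, yet it has to pass from `Y` to `X` in a
  -- point of the line `v x`.
  have hsub' : segment ℝ y k ⊆ X ∪ Y :=
    ((convex_segment c k).segment_subset hy1 (right_mem_segment ℝ c k)).trans hsub
  obtain ⟨z, ⟨s₁, t₁, hs₁, ht₁, e₁, rfl⟩, hz2, hz3⟩ := exists_crossing hX hY hsub' hy2 hk
  have := orient_eq_zero_of_mem_segment (hXY ⟨hz2, hz3⟩)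
  rw [orient_combo _ _ _ _ e₁] at this
  have h5 : s₁ * (orient v x y * m) + t₁ * (orient v x k * m) = 0 := by
    linear_combination m * this
  rcases hs₁.lt_or_eq with h | h
  · have := mul_pos h hy3; have := mul_nonneg ht₁ gk.le; linarith
  · subst h; obtain rfl : t₁ = 1 := by linarith
    linarith

end Sight
theorem _root_.PTree.exists_tri_of_inner {τ : PTree} {p q k : ℕ} (h : k ∈ τ.inner) :
    ∃ b c, τ.tri p q k b c := by
  induction τ generalizing p q with
  | leaf => simp [PTree.inner] at h
  | node l x r ihl ihr =>
    simp only [PTree.inner, Finset.mem_insert, Finset.mem_union] at h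
    rcases h with rfl | h | h
    · exact ⟨q, p, Or.inl (Or.inr (Or.inl ⟨rfl, rfl, rfl⟩))⟩
    · obtain ⟨b, c, k⟩ := ihl (p := p) (q := x) h
      exact ⟨b, c, Or.inr (Or.inl k)⟩
    · obtain ⟨b, c, k⟩ := ihr (p := x) (q := q) h
      exact ⟨b, c, Or.inr (Or.inr k)⟩

theorem _root_.PTree.Glue.inter_subset {T : ℕ → ℕ → ℕ → Prop} {p q a b c a' b' c' : ℕ}
    {κ τ : PTree} (h : Glue T p q κ τ) (h₁ : κ.tri q p a b c) (h₂ : τ.tri p q a' b' c') :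
    ({a, b, c} : Finset ℕ) ∩ {a', b', c'} ⊆ {p, q} := by
  intro y hy
  obtain ⟨y1, y2⟩ := Finset.mem_inter.1 hy
  have y1 := tri_subset h₁ y1
  have y2 := tri_subset h₂ y2
  simp only [Finset.mem_insert, Finset.mem_singleton] at y1 y2 ⊢
  by_contra hcon
  push Not at hcon
  exact Finset.disjoint_left.1 h.disj (by tauto) (by tauto : y ∈ τ.inner)

theorem _root_.PTree.Glue.finset_ne {T : ℕ → ℕ → ℕ → Prop} {p q a b c a' b' c' : ℕ}
    {κ τ : PTree} (h : Glue T p q κ τ) (h₁ : κ.tri q p a b c) (h₂ : τ.tri p q a' b' c') :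
    ({a, b, c} : Finset ℕ) ≠ {a', b', c'} := by
  intro e
  have h3 := h.inter_subset h₁ h₂
  rw [← e, Finset.inter_self] at h3
  have h4 := Finset.card_le_card h3
  have : ({p, q} : Finset ℕ).card ≤ 2 := Finset.card_le_two
  rw [Finset.card_eq_three.2 ⟨a, b, c, tri_ne h.wf₁ h₁, (tri_ne h.wf₁ (tri_rot (tri_rot h₁))).symm,
    tri_ne h.wf₁ (tri_rot h₁), rfl⟩] at h4
  omega

section Sight

variable {T : ℕ → ℕ → ℕ → Prop} {F : ℕ → ℕ → ℕ → Prop} {R : ℕ → ℂ}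

theorem region_inter (h : Realizes T F R) {p q : ℕ} {κ τ : PTree} (G : Glue T p q κ τ) :
    region (τ.tri p q) R ∩ region (κ.tri q p) R ⊆ segment ℝ (R p) (R q) := by
  rintro z ⟨⟨a, b, c, k, hz⟩, ⟨a', b', c', k', hz'⟩⟩
  rw [← lhull_pair]
  exact lhull_mono R (G.inter_subset k' k) (h.cplx _ _ _ _ _ _ ((G.eq _ _ _).2 (Or.inl k'))
    ((G.eq _ _ _).2 (Or.inr k)) (G.finset_ne k' k) ⟨hz', hz⟩)

theorem region_union {p q : ℕ} {κ τ : PTree} (G : Glue T p q κ τ) :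
    region T R ⊆ region (τ.tri p q) R ∪ region (κ.tri q p) R := by
  rintro z ⟨a, b, c, k, hz⟩
  rcases (G.eq _ _ _).1 k with k | k
  · exact Or.inr ⟨a, b, c, k, hz⟩
  · exact Or.inl ⟨a, b, c, k, hz⟩

theorem subset_region {a b c : ℕ} (h : T a b c) : lhull R {a, b, c} ⊆ region T R :=
  fun _ hz => ⟨a, b, c, h, hz⟩

theorem inner_mem_region {τ : PTree} {p q k : ℕ} (h : k ∈ τ.inner) :
    R k ∈ region (τ.tri p q) R := by
  obtain ⟨b, c, hk⟩ := exists_tri_of_inner (p := p) (q := q) h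
  exact ⟨k, b, c, hk, mem_lhull R (by simp)⟩

theorem segment_subset_lhull {t : Finset ℕ} {a b : ℕ} (ha : a ∈ t) (hb : b ∈ t) :
    segment ℝ (R a) (R b) ⊆ lhull R t :=
  (convex_convexHull ℝ _).segment_subset (mem_lhull R ha) (mem_lhull R hb)

theorem inner_notMem_base (h : Realizes T F R) {v w x k : ℕ} {κ l r : PTree}
    (G : Glue T v w κ (node l x r)) (hk : k ∈ l.inner ∨ k ∈ r.inner) :
    R k ∉ lhull R {v, x, w} := by
  obtain ⟨h1, h2, h3, h4, h5, h6, h7, h8, h9, h10⟩ := G.wf₂.node_facts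
  have hk' : k ∈ (node l x r).inner := by simp [PTree.inner, hk]
  obtain ⟨b, c, ht⟩ := exists_tri_of_inner (p := v) (q := w) hk'
  intro hm
  have := vertex_mem h ((G.eq _ _ _).2 (Or.inr ht))
    ((G.eq v x w).2 (Or.inr (Or.inl (Rot.refl _ _ _)))) hm
  simp only [Finset.mem_insert, Finset.mem_singleton] at this
  rcases this with rfl | rfl | rfl <;> tauto

/-- The barycentric coordinates of `o` with respect to `v x w`. With the signs present in
`no_sight`, a pair of triangles that is reflex for `v` (or `w`) is also reflex when `o` takes the
place of that vertex. -/
theorem orient_cone (v x w o y z : ℂ) : orient y z o * orient v x w =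
    orient y z v * (orient v x w + orient v w o - orient v x o) - orient v w o * orient y z x +
      orient v x o * orient y z w := by
  simp only [orient, Complex.sub_re, Complex.sub_im]; ring

/-- The segment `o x` stays on one closed side of the line `v x` and `v w` on the other, so a common
point would be both `x` and `v`. -/
theorem apex_blocked {v w x o c : ℂ} (h1 : orient v x o * orient v x w < 0)
    (hc : c ∈ segment ℝ v w) (hck : c ∈ segment ℝ o x) : False := by
  obtain ⟨s, t, hs, ht, hst, e⟩ := hck
  obtain ⟨s', t', hs', ht', hst', e'⟩ := hc
  have h2 : orient v x c * orient v x w = s * (orient v x o * orient v x w) := by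
    rw [← e, orient_combo _ _ _ _ hst, orient_self_right]; ring
  have hD : orient v x w ≠ 0 := by rintro h; rw [h, mul_zero] at h1; exact lt_irrefl _ h1
  have hDD := mul_self_pos.2 hD
  have h3 : orient v x c * orient v x w = t' * (orient v x w * orient v x w) := by
    rw [← e', orient_combo _ _ _ _ hst', orient_self_left]; ring
  have h4 : 0 ≤ t' * (orient v x w * orient v x w) := by positivity
  have hs0 : s = 0 := by
    by_contra hne
    have : 0 < s := lt_of_le_of_ne hs (Ne.symm hne)
    nlinarith
  have ht0 : t' = 0 := by
    rw [h3, hs0, zero_mul] at h2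
    exact (mul_eq_zero.1 h2).resolve_right hDD.ne'
  subst hs0 ht0
  obtain rfl : t = 1 := by linarith
  obtain rfl : s' = 1 := by linarith
  simp only [zero_smul, one_smul, zero_add, add_zero] at e e'
  apply hD
  rw [e', ← e]; simp [orient]

/-- From a point `o` beyond the window `v w` that sees the side of the first triangle only on one
side, no apex behind the window is visible through the window. -/
theorem no_sight (h : Realizes T F R) {o : ℂ} {k : ℕ} (hsub : segment ℝ o (R k) ⊆ region T R)
    {σ : PTree} : ∀ {v w : ℕ} {κ : PTree}, Glue T v w κ σ → 0 < orient (R v) (R w) o →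
    (∀ l x r, σ = node l x r → orient o (R v) (R x) < 0 ∨ orient (R x) (R w) o < 0) →
    k ∈ σ.inner → ∀ c ∈ segment ℝ (R v) (R w), c ∈ segment ℝ o (R k) → False := by
  induction σ with
  | leaf => intro v w κ _ _ _ hk; simp [PTree.inner] at hk
  | node l x r ihl ihr =>
    intro v w κ G H0 hfl hk c hc hck
    have hbase : T v x w := (G.eq v x w).2 (Or.inr (Or.inl (Rot.refl _ _ _)))
    have hD := h.pos _ _ _ hbase
    have hcsub : segment ℝ c (R k) ⊆ region T R :=
      ((convex_segment _ _).segment_subset hck (right_mem_segment ℝ _ _)).trans hsub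
    have hc3 : c ∈ lhull R {v, x, w} := segment_subset_lhull (by simp) (by simp) hc
    have hid := orient_sum (R v) (R x) (R w) o
    have e1 := orient_swap (R v) (R w) o
    have e2 := orient_rot o (R x) (R w)
    have e3 := orient_swap (R v) (R x) (R w)
    have e4 := orient_swap' (R w) (R v) o
    have e5 : orient (R w) (R x) (R v) = - orient (R v) (R x) (R w) := by
      rw [orient_rot, orient_swap']
    have e6 : orient (R w) (R v) (R x) = orient (R v) (R x) (R w) := orient_rot _ _ _
    have e7 := orient_swap' (R w) (R x) o
    have e8 := orient_rot o (R v) (R x)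
    simp only [PTree.inner, Finset.mem_insert, Finset.mem_union] at hk
    have hl : lhull R {v, x, w} ⊆ region ((node r w κ).tri x v) R := by
      refine fun z hz => ⟨x, w, v, Or.inl (Rot.refl _ _ _), ?_⟩
      rwa [Rot.finset_eq (Or.inr (Or.inl ⟨rfl, rfl, rfl⟩) : Rot v x w x w v)]
    have hr : lhull R {v, x, w} ⊆ region ((node κ v l).tri w x) R := by
      refine fun z hz => ⟨w, v, x, Or.inl (Rot.refl _ _ _), ?_⟩
      rwa [Rot.finset_eq (Or.inr (Or.inr ⟨rfl, rfl, rfl⟩) : Rot v x w w v x)]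
    have hckl : k ∈ l.inner ∨ k ∈ r.inner → c ≠ R k := by
      rintro hk rfl
      exact inner_notMem_base h G hk hc3
    have recl : ∀ z, z ∈ segment ℝ c (R k) → z ∈ segment ℝ o (R k) := fun z hz =>
      (convex_segment _ _).segment_subset hck (right_mem_segment ℝ _ _) hz
    rcases hfl l x r rfl with hv | hw
    -- The quadrilateral of `o` and the triangle is reflex at `v`: the apex and everything behind `v
    -- x` are hidden, so the line of sight leaves through `x w`.
    · have h1 : orient (R v) (R x) o * orient (R v) (R x) (R w) < 0 :=
        mul_neg_of_neg_of_pos (by linarith) hD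
      have hx0 : 0 < orient (R x) (R w) o := by linarith
      rcases hk with rfl | hk | hk
      · exact apex_blocked h1 hc hck
      · refine blocked (isClosed_region l v x R) (isClosed_region (node r w κ) x v R) h1
          (mul_neg_of_pos_of_neg H0 (by linarith)) hc hck (hckl (Or.inl hk))
          (hcsub.trans (region_union G.left)) ?_ (inner_mem_region hk) (region_inter h G.left)
        rw [← lhull_triple, Finset.pair_comm]; exact hl
      · obtain ⟨c', k1, k2, k3⟩ := exists_crossing (isClosed_region r x w R)
          (isClosed_region (node κ v l) w x R) (hcsub.trans (region_union G.right)) (hr hc3)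
          (inner_mem_region hk)
        refine ihr G.right hx0 ?_ hk c' (region_inter h G.right ⟨k2, k3⟩) (recl _ k1)
        rintro l' y r' rfl
        have hT : T x y w := (G.eq _ _ _).2 (Or.inr (Or.inr (Or.inr (Or.inl (Rot.refl _ _ _)))))
        have hT' : T w v x := (G.eq _ _ _).2
          (Or.inr (Or.inl (Or.inr (Or.inr ⟨rfl, rfl, rfl⟩))))
        have hp := h.pos _ _ _ hT
        -- The pair of triangles at the new window is reflex at one of its ends; by `orient_cone`
        -- the same end is reflex for `o`, which restores the induction hypothesis.
        rcases h.reflex _ _ _ _ hT hT' with hf | hf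
        · left
          have := orient_cone (R v) (R x) (R w) o (R x) (R y)
          rw [orient_self_left, ← orient_rot (R v), ← orient_rot o] at this
          nlinarith
        · right
          have := orient_cone (R v) (R x) (R w) o (R y) (R w)
          rw [orient_self_right, ← orient_rot (R x)] at this
          nlinarith
    -- The mirror image: reflex at `w`, with exit through `v x`.
    · have h1 : orient (R w) (R x) o * orient (R w) (R x) (R v) < 0 :=
        mul_neg_of_pos_of_neg (by linarith) (by linarith)
      have hx0 : 0 < orient (R v) (R x) o := by linarith
      rcases hk with rfl | hk | hk
      · exact apex_blocked h1 (segment_symm ℝ (R v) (R w) ▸ hc) hck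
      · obtain ⟨c', k1, k2, k3⟩ := exists_crossing (isClosed_region l v x R)
          (isClosed_region (node r w κ) x v R) (hcsub.trans (region_union G.left)) (hl hc3)
          (inner_mem_region hk)
        refine ihl G.left hx0 ?_ hk c' (region_inter h G.left ⟨k2, k3⟩) (recl _ k1)
        rintro l' y r' rfl
        have hT : T v y x := (G.eq _ _ _).2 (Or.inr (Or.inr (Or.inl (Or.inl (Rot.refl _ _ _)))))
        have hT' : T x w v := (G.eq _ _ _).2
          (Or.inr (Or.inl (Or.inr (Or.inl ⟨rfl, rfl, rfl⟩))))
        have hp := h.pos _ _ _ hT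
        rcases h.reflex _ _ _ _ hT hT' with hf | hf
        · left
          have := orient_cone (R w) (R x) (R v) o (R v) (R y)
          rw [orient_self_left, ← orient_rot (R w), ← orient_rot o] at this
          nlinarith
        · right
          have := orient_cone (R w) (R x) (R v) o (R y) (R x)
          rw [orient_self_right, ← orient_rot (R v) (R y)] at this
          nlinarith
      · refine blocked (isClosed_region r x w R) (isClosed_region (node κ v l) w x R) h1
          (mul_neg_of_neg_of_pos (by linarith) (by linarith)) (segment_symm ℝ (R v) (R w) ▸ hc) hck
          (hckl (Or.inr hk)) (hcsub.trans (region_union G.right)) ?_ (inner_mem_region hk) 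
          (segment_symm ℝ (R x) (R w) ▸ region_inter h G.right)
        rw [← lhull_triple, Rot.finset_eq (Or.inr (Or.inr ⟨rfl, rfl, rfl⟩) : Rot v x w w v x)]
        exact hr

/-- The line of sight must pass through the window `v w`. The triangle of `a` and the one behind the
window form a reflex pair, which is the starting hypothesis of `no_sight`. -/
theorem sight_beyond (h : Realizes T F R) {a b v w : ℕ} {κ₁ κ₂ σ : PTree}
    (G : Glue T v w (node κ₁ a κ₂) σ) (hb : b ∈ σ.inner) :
    ¬ segment ℝ (R a) (R b) ⊆ region T R := by
  intro hsub
  have hT : T w a v := (G.eq _ _ _).2 (Or.inl (Or.inl (Rot.refl _ _ _)))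
  obtain ⟨c, k1, k2, k3⟩ := exists_crossing (isClosed_region σ v w R)
    (isClosed_region (node κ₁ a κ₂) w v R) (hsub.trans (region_union G))
    (inner_mem_region (by simp [PTree.inner])) (inner_mem_region hb)
  refine no_sight h hsub G (by have := h.pos _ _ _ hT; rwa [← orient_rot] at this) ?_ hb c
    (region_inter h G ⟨k2, k3⟩) k1
  rintro l x r rfl
  exact h.reflex _ _ _ _ ((G.eq _ _ _).2 (Or.inr (Or.inl (Rot.refl _ _ _)))) hT

/-- Descend along the fan at `a`: either `b` turns up as a vertex of a triangle at `a`, or it lies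
behind the side opposite `a` of such a triangle. -/
theorem window_or_common {a b : ℕ} : ∀ {κ : PTree} {v w : ℕ} {τ : PTree},
    Glue T v w κ τ → (a = v ∨ a = w) → b ∈ τ.inner →
    (∃ c, T a b c ∨ T b a c) ∨ ∃ v w κ₁ κ₂ σ, Glue T v w (node κ₁ a κ₂) σ ∧ b ∈ σ.inner := by
  intro κ v w τ
  induction τ generalizing κ v w with
  | leaf => intro _ _ hb; simp [PTree.inner] at hb
  | node l x r ihl ihr =>
    intro G ha hb
    have hbase : ∀ a b c, Rot v x w a b c → T a b c := fun a b c k =>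
      (G.eq _ _ _).2 (Or.inr (Or.inl k))
    simp only [PTree.inner, Finset.mem_insert, Finset.mem_union] at hb
    rcases hb with rfl | hb | hb
    · left
      rcases ha with rfl | rfl
      · exact ⟨w, Or.inl (hbase _ _ _ (Rot.refl _ _ _))⟩
      · exact ⟨v, Or.inr (hbase _ _ _ (Or.inr (Or.inl ⟨rfl, rfl, rfl⟩)))⟩
    · rcases ha with rfl | rfl
      · exact ihl G.left (Or.inl rfl) hb
      · exact Or.inr ⟨_, _, _, _, _, G.left, hb⟩
    · rcases ha with rfl | rfl
      · exact Or.inr ⟨_, _, _, _, _, G.right, hb⟩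
      · exact ihr G.right (Or.inr rfl) hb

/-- The vertices that see each other inside the union of the triangles belong to a common
triangle. -/
theorem exists_common_triangle (h : Realizes T F R) {p q a b a₁ a₂ b₁ b₂ : ℕ} {κ τ : PTree}
    (G : Glue T p q κ τ) (ha : T a a₁ a₂) (hb : T b b₁ b₂) (hab : a ≠ b)
    (hsub : segment ℝ (R a) (R b) ⊆ region T R) : ∃ c, T a b c ∨ T b a c := by
  obtain ⟨κ₁, κ₂, σ, G'⟩ := G.exists_of_tri ha
  have hw : T a₂ a a₁ := (G'.eq _ _ _).2 (Or.inl (Or.inl (Rot.refl _ _ _)))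
  have main : ∀ {v w κ τ}, Glue T v w κ τ → (a = v ∨ a = w) → b ∈ τ.inner →
      ∃ c, T a b c ∨ T b a c := by
    intro v w κ τ G ha hb
    rcases window_or_common G ha hb with hc | ⟨v, w, κ₁, κ₂, σ, G, hb⟩
    · exact hc
    · exact (sight_beyond h G hb hsub).elim
  have ha' : T a₁ a₂ a := by
    refine (G'.eq _ _ _).2 (Or.inl (Or.inl (Or.inr (Or.inr ⟨rfl, rfl, rfl⟩))))
  have common : b = a₁ ∨ b = a₂ → ∃ c, T a b c ∨ T b a c := by
    rintro (rfl | rfl)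
    · exact ⟨_, Or.inl ha⟩
    · exact ⟨_, Or.inr hw⟩
  rcases (G'.eq _ _ _).1 hb with hb | hb
  · rcases tri_mem hb with hb | hb | hb
    · exact common (Or.inr hb)
    · exact common (Or.inl hb)
    · simp only [PTree.inner, Finset.mem_insert, Finset.mem_union] at hb
      rcases hb with rfl | hb | hb
      · exact (hab rfl).elim
      · exact main G'.swap.left (Or.inr rfl) hb
      · exact main G'.swap.right (Or.inl rfl) hb
  · rcases tri_mem hb with hb | hb | hb
    · exact common (Or.inl hb)
    · exact common (Or.inr hb)
    · exact (sight_beyond h G' hb hsub).elim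

end Sight
-- Signed angles and the winding number of a triangulated region
/-- The signed angle under which the segment from `a` to `b` is seen from `x`. -/
noncomputable def ang (a b x : ℂ) : ℝ := Complex.arg ((b - x) / (a - x))

theorem ang_coe {a b x : ℂ} (ha : x ≠ a) (hb : x ≠ b) :
    (ang a b x : Real.Angle) = Complex.arg (b - x) - Complex.arg (a - x) :=
  Complex.arg_div_coe_angle (sub_ne_zero.2 hb.symm) (sub_ne_zero.2 ha.symm)

theorem ang_le_pi (a b x : ℂ) : ang a b x ≤ Real.pi := Complex.arg_le_pi _

theorem neg_pi_lt_ang (a b x : ℂ) : -Real.pi < ang a b x := Complex.neg_pi_lt_arg _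

theorem div_im_eq (a b x : ℂ) :
    ((b - x) / (a - x)).im = orient a b x / Complex.normSq (a - x) := by
  rw [Complex.div_im, ← sub_div]
  congr 1
  simp only [orient, Complex.sub_re, Complex.sub_im]; ring

theorem ang_neg_iff {a b x : ℂ} (ha : x ≠ a) : ang a b x < 0 ↔ orient a b x < 0 := by
  have h := Complex.normSq_pos.2 (sub_ne_zero.2 ha.symm)
  rw [ang, Complex.arg_neg_iff, div_im_eq, div_lt_iff₀ h, zero_mul]

theorem ang_nonneg {a b x : ℂ} (h : 0 ≤ orient a b x) : 0 ≤ ang a b x := by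
  rw [ang, Complex.arg_nonneg_iff, div_im_eq]
  exact div_nonneg h (Complex.normSq_nonneg _)

theorem ang_pos {a b x : ℂ} (h : 0 < orient a b x) : 0 < ang a b x := by
  have ha : x ≠ a := by rintro rfl; rw [orient_self_left] at h; exact lt_irrefl _ h
  refine lt_of_le_of_ne (ang_nonneg h.le) fun e => ?_
  have := (Complex.arg_eq_zero_iff.1 e.symm).2
  rw [div_im_eq] at this
  exact (div_pos h (Complex.normSq_pos.2 (sub_ne_zero.2 ha.symm))).ne' this

theorem ang_swap (a b x : ℂ) :
    ang b a x = if ang a b x = Real.pi then Real.pi else -ang a b x := by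
  rw [ang, ang, ← Complex.arg_inv, inv_div]

theorem mem_openSegment_of_ang {a b x : ℂ} (h : ang a b x = Real.pi) : x ∈ openSegment ℝ a b := by
  obtain ⟨h1, h2⟩ := Complex.arg_eq_pi_iff.1 h
  set z := (b - x) / (a - x) with hz
  have ha : a - x ≠ 0 := by intro h0; rw [hz, h0, div_zero] at h1; simp at h1
  have hzr : z = (z.re : ℂ) := Complex.ext (by simp) (by simp [h2])
  have e : b - x = z.re * (a - x) := by rw [← hzr, hz, div_mul_cancel₀ _ ha]
  have h3 : 0 < 1 - z.re := by linarith
  refine ⟨-z.re / (1 - z.re), 1 / (1 - z.re), by apply div_pos <;> linarith, by positivity, ?_, ?_⟩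
  · field_simp
    ring
  · have h3' : ((1 - z.re : ℝ) : ℂ) ≠ 0 := by exact_mod_cast h3.ne'
    have : ((1 - z.re : ℝ) : ℂ) * x = -z.re * a + b := by
      push_cast; linear_combination -e
    rw [Complex.real_smul, Complex.real_smul]
    apply mul_left_cancel₀ h3'
    rw [this]; push_cast at h3' ⊢; field_simp

theorem ang_of_mem_openSegment {a b x : ℂ} (hab : a ≠ b) (h : x ∈ openSegment ℝ a b) :
    ang a b x = Real.pi := by
  obtain ⟨s, t, hs, ht, hst, rfl⟩ := h
  have hba : b - a ≠ 0 := sub_ne_zero.2 hab.symm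
  have e : (b - (s • a + t • b)) / (a - (s • a + t • b)) = ((-(s / t) : ℝ) : ℂ) := by
    have e1 : b - (s • a + t • b) = s * (b - a) := by
      rw [Complex.real_smul, Complex.real_smul]
      obtain rfl : s = 1 - t := by linarith
      push_cast; ring
    have e2 : a - (s • a + t • b) = -t * (b - a) := by
      rw [Complex.real_smul, Complex.real_smul]
      obtain rfl : s = 1 - t := by linarith
      push_cast; ring
    have : (t : ℂ) ≠ 0 := by exact_mod_cast ht.ne'
    rw [e1, e2]; push_cast; field_simp
  rw [ang, e, Complex.arg_ofReal_of_neg]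
  have := div_pos hs ht
  linarith

theorem continuousAt_ang {a b x : ℂ} (h : x ∉ segment ℝ a b) : ContinuousAt (ang a b) x := by
  have ha : x ≠ a := by rintro rfl; exact h (left_mem_segment ℝ _ _)
  have hb : x ≠ b := by rintro rfl; exact h (right_mem_segment ℝ _ _)
  refine ContinuousAt.comp (f := fun x => (b - x) / (a - x)) (g := Complex.arg)
    (Complex.continuousAt_arg ?_) ?_
  · rw [Complex.mem_slitPlane_iff_arg]
    refine ⟨fun e => h (openSegment_subset_segment ℝ _ _ (mem_openSegment_of_ang e)), ?_⟩
    exact div_ne_zero (sub_ne_zero.2 hb.symm) (sub_ne_zero.2 ha.symm)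
  · exact (continuousAt_const.sub continuousAt_id).div (continuousAt_const.sub continuousAt_id)
      (sub_ne_zero.2 ha.symm)

/-- The sum is a multiple of `2π`. For a point of the triangle the angles are nonnegative, one is
positive, and the sum is at most `3π`. For a point outside, some angle is negative and some
positive, so the sum is strictly between `-2π` and `2π`. A point of an open side sees it under the
angle `π` and counts as inside. -/
theorem ang_triangle {a b c x : ℂ} (h : 0 < orient a b c) (ha : x ≠ a) (hb : x ≠ b) (hc : x ≠ c) :
    (x ∈ convexHull ℝ {a, b, c} → ang a b x + ang b c x + ang c a x = 2 * Real.pi) ∧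
    (x ∉ convexHull ℝ {a, b, c} → ang a b x + ang b c x + ang c a x = 0) := by
  have hsum := orient_sum a b c x
  have e1 : orient x b c = orient b c x := orient_rot _ _ _
  have e2 : orient a x c = orient c a x := by rw [orient_rot c a x]
  rw [e1, e2] at hsum
  obtain ⟨k, hk⟩ : ∃ k : ℤ, k • (2 * Real.pi) = ang a b x + ang b c x + ang c a x := by
    rw [← Real.Angle.coe_eq_zero_iff]
    rw [Real.Angle.coe_add, Real.Angle.coe_add, ang_coe ha hb, ang_coe hb hc, ang_coe hc ha]; abel
  rw [zsmul_eq_mul] at hk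
  have hpi := Real.pi_pos
  have hl : 0 < ang a b x + ang b c x + ang c a x ∨ ang a b x < 0 ∨ ang b c x < 0 ∨ ang c a x < 0 := by
    by_contra hcon
    push Not at hcon
    obtain ⟨c1, c2, c3, c4⟩ := hcon
    have p1 : ¬ 0 < orient a b x := fun hp => by have := ang_pos hp; linarith
    have p2 : ¬ 0 < orient b c x := fun hp => by have := ang_pos hp; linarith
    have p3 : ¬ 0 < orient c a x := fun hp => by have := ang_pos hp; linarith
    linarith
  have u1 := ang_le_pi a b x
  have u2 := ang_le_pi b c x
  have u3 := ang_le_pi c a x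
  constructor
  · intro hx
    obtain ⟨h1, h2, h3⟩ := (mem_triangle h).1 hx
    have q1 := ang_nonneg h1
    have q2 := ang_nonneg h2
    have q3 := ang_nonneg h3
    have hpos : 0 < ang a b x + ang b c x + ang c a x := by
      rcases hl with h | h | h | h <;> linarith
    have k1 : (0 : ℝ) < k := by
      by_contra hcon
      push Not at hcon
      nlinarith
    have k2 : (k : ℝ) < 2 := by
      by_contra hcon
      push Not at hcon
      nlinarith
    have k1' : 0 < k := by exact_mod_cast k1
    have k2' : k < 2 := by exact_mod_cast k2
    obtain rfl : k = 1 := by omega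
    rw [← hk]; simp
  · intro hx
    rw [mem_triangle h] at hx
    have hneg : orient a b x < 0 ∨ orient b c x < 0 ∨ orient c a x < 0 := by
      by_contra hcon
      push Not at hcon
      exact hx hcon
    have hneg' : ang a b x < 0 ∨ ang b c x < 0 ∨ ang c a x < 0 := by
      rwa [ang_neg_iff ha, ang_neg_iff hb, ang_neg_iff hc]
    have hpos : 0 < ang a b x ∨ 0 < ang b c x ∨ 0 < ang c a x := by
      by_contra hcon
      push Not at hcon
      obtain ⟨c1, c2, c3⟩ := hcon
      have p1 : ¬ 0 < orient a b x := fun hp => by have := ang_pos hp; linarith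
      have p2 : ¬ 0 < orient b c x := fun hp => by have := ang_pos hp; linarith
      have p3 : ¬ 0 < orient c a x := fun hp => by have := ang_pos hp; linarith
      linarith
    have l1 := neg_pi_lt_ang a b x
    have l2 := neg_pi_lt_ang b c x
    have l3 := neg_pi_lt_ang c a x
    have k1 : (-1 : ℝ) < k := by
      by_contra hcon
      push Not at hcon
      have : ang a b x + ang b c x + ang c a x ≤ -(2 * Real.pi) := by rw [← hk]; nlinarith
      rcases hpos with h | h | h <;> linarith
    have k2 : (k : ℝ) < 1 := by
      by_contra hcon
      push Not at hcon
      have : 2 * Real.pi ≤ ang a b x + ang b c x + ang c a x := by rw [← hk]; nlinarith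
      rcases hneg' with h | h | h <;> linarith
    have k1' : -1 < k := by exact_mod_cast k1
    have k2' : k < 1 := by exact_mod_cast k2
    obtain rfl : k = 0 := by omega
    rw [← hk]; simp

/-- The inner labels are, in order, the numbers strictly between those of the base. -/
def _root_.PTree.Consec : PTree → ℕ → ℕ → Prop
  | leaf, p, q => q = p + 1
  | node l x r, p, q => l.Consec p x ∧ r.Consec x q

theorem _root_.PTree.Consec.lt {τ : PTree} {p q : ℕ} (h : τ.Consec p q) : p < q := by
  induction τ generalizing p q with
  | leaf => rw [Consec] at h; omega
  | node l x r ihl ihr => exact (ihl h.1).trans (ihr h.2)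

theorem _root_.PTree.Consec.inner_eq {τ : PTree} {p q : ℕ} (h : τ.Consec p q) :
    τ.inner = Finset.Ioo p q := by
  induction τ generalizing p q with
  | leaf => rw [Consec] at h; subst h; ext; simp [PTree.inner]
  | node l x r ihl ihr =>
    have h1 := h.1.lt
    have h2 := h.2.lt
    rw [PTree.inner, ihl h.1, ihr h.2]; ext; simp; omega

theorem _root_.PTree.Consec.wf {τ : PTree} {p q : ℕ} (h : τ.Consec p q) : WF p q τ := by
  refine ⟨h.lt.ne, by simp [h.inner_eq], by simp [h.inner_eq], ?_⟩
  induction τ generalizing p q with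
  | leaf => trivial
  | node l x r ihl ihr =>
    refine ⟨by simp [h.1.inner_eq], by simp [h.2.inner_eq], ?_, ihl h.1, ihr h.2⟩
    rw [h.1.inner_eq, h.2.inner_eq, Finset.disjoint_left]
    intro y; simp; omega

variable {R : ℕ → ℂ}

/-- Replacing the base `p q` by `p x` and `x q` adds a full turn exactly for the points of the
triangle `p x q`. The exception are the points of the open base, which see it under the angle `π` in
both directions; hence `1 ≤ k` is claimed only off the base. -/
theorem exists_chain_ang {τ : PTree} {p q : ℕ} (h : τ.Consec p q)
    (hpos : ∀ a b c, τ.tri p q a b c → 0 < orient (R a) (R b) (R c)) {z : ℂ}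
    (hz : ∀ i, p ≤ i → i ≤ q → z ≠ R i) :
    ∃ k : ℤ, ∑ i ∈ Finset.Ico p q, ang (R i) (R (i + 1)) z =
        ang (R p) (R q) z + 2 * Real.pi * k ∧ 0 ≤ k ∧
      (z ∈ region (τ.tri p q) R → z ∉ segment ℝ (R p) (R q) → 1 ≤ k) ∧
      (z ∉ region (τ.tri p q) R → k = 0) := by
  induction τ generalizing p q with
  | leaf =>
    rw [Consec] at h; subst h
    refine ⟨0, by simp, le_rfl, ?_, fun _ => rfl⟩
    rintro ⟨a, b, c, h, -⟩; exact h.elim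
  | node l x r ihl ihr =>
    have h1 := h.1.lt
    have h2 := h.2.lt
    obtain ⟨kl, el, pl, il, ol⟩ := ihl h.1 (fun a b c k => hpos a b c (Or.inr (Or.inl k)))
      fun i hi hi' => hz i hi (hi'.trans h2.le)
    obtain ⟨kr, er, pr, ir, or'⟩ := ihr h.2 (fun a b c k => hpos a b c (Or.inr (Or.inr k)))
      fun i hi hi' => hz i (h1.le.trans hi) hi'
    have hb : (node l x r).tri p q p x q := Or.inl (Rot.refl _ _ _)
    obtain ⟨ti, tout⟩ := ang_triangle (hpos _ _ _ hb) (hz p le_rfl (h1.trans h2).le)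
      (hz x h1.le h2.le) (hz q (h1.trans h2).le le_rfl)
    rw [← lhull_triple] at ti tout
    have hsub : ∀ a b, a ∈ ({p, x, q} : Finset ℕ) → b ∈ ({p, x, q} : Finset ℕ) →
        z ∈ segment ℝ (R a) (R b) → z ∈ lhull R {p, x, q} := fun a b ha hb h =>
      segment_subset_lhull ha hb h
    have hsw := ang_swap (R p) (R q) z
    rw [← Finset.sum_Ico_consecutive _ h1.le h2.le, el, er]
    have hreg : z ∈ region ((node l x r).tri p q) R ↔ z ∈ lhull R {p, x, q} ∨
        z ∈ region (l.tri p x) R ∨ z ∈ region (r.tri x q) R := by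
      constructor
      · rintro ⟨a, b, c, h | h | h, hz⟩
        · rw [h.finset_eq] at hz; exact Or.inl hz
        · exact Or.inr (Or.inl ⟨a, b, c, h, hz⟩)
        · exact Or.inr (Or.inr ⟨a, b, c, h, hz⟩)
      · rintro (hz | ⟨a, b, c, h, hz⟩ | ⟨a, b, c, h, hz⟩)
        · exact ⟨p, x, q, Or.inl (Rot.refl _ _ _), hz⟩
        · exact ⟨a, b, c, Or.inr (Or.inl h), hz⟩
        · exact ⟨a, b, c, Or.inr (Or.inr h), hz⟩
    rw [hreg]
    by_cases hin : z ∈ lhull R {p, x, q}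
    · have t1 := ti hin
      by_cases hpi : ang (R p) (R q) z = Real.pi
      · rw [if_pos hpi] at hsw
        refine ⟨kl + kr, by push_cast; linarith, by omega, fun _ hno => ?_, fun hno => ?_⟩
        · exact (hno (openSegment_subset_segment ℝ _ _ (mem_openSegment_of_ang hpi))).elim
        · exact (hno (Or.inl hin)).elim
      · rw [if_neg hpi] at hsw
        refine ⟨kl + kr + 1, by push_cast; linarith, by omega, fun _ _ => by omega, fun hno => ?_⟩
        exact (hno (Or.inl hin)).elim
    · have t1 := tout hin
      have hpi : ang (R p) (R q) z ≠ Real.pi := fun e => hin (hsub p q (by simp) (by simp)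
        (openSegment_subset_segment ℝ _ _ (mem_openSegment_of_ang e)))
      rw [if_neg hpi] at hsw
      refine ⟨kl + kr, by push_cast; linarith, by omega, ?_, fun hno => ?_⟩
      · rintro (h | h | h) -
        · exact (hin h).elim
        · have := il h fun h => hin (hsub p x (by simp) (by simp) h)
          omega
        · have := ir h fun h => hin (hsub x q (by simp) (by simp) h)
          omega
      · push Not at hno
        rw [ol hno.2.1, or' hno.2.2]; rfl

end Polygon

/-! ### Realizations as simple polygons -/

namespace Polygon
open PTree Filter Topology

section
variable {n : ℕ}

theorem edgePath_eq (P : Polygon ℂ n) (i : Fin n) (s : ℝ) :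
    P.edgePath ℝ i s = (1 - s) • P i + s • P (finRotate n i) := by
  rw [edgePath, AffineMap.lineMap_apply_module]

theorem boundary_eq (P : Polygon ℂ n) :
    P.boundary ℝ = ⋃ i, segment ℝ (P i) (P (finRotate n i)) := by
  simp only [boundary, edgeSet, affineSegment_eq_segment]

theorem finRotate_ne (hn : 3 ≤ n) (i : Fin n) : finRotate n i ≠ i := by
  obtain ⟨m, rfl⟩ : ∃ m, n = m + 1 := ⟨n - 1, by omega⟩
  intro h
  by_cases hl : i = Fin.last m
  · rw [hl, finRotate_last] at h
    have := congrArg Fin.val h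
    simp at this; omega
  · have := coe_finRotate_of_ne_last hl
    rw [h] at this; omega

theorem finRotate_finRotate_ne (hn : 3 ≤ n) (i : Fin n) : finRotate n (finRotate n i) ≠ i := by
  obtain ⟨m, rfl⟩ : ∃ m, n = m + 1 := ⟨n - 1, by omega⟩
  intro h
  by_cases hl : i = Fin.last m
  · rw [hl, finRotate_last] at h
    have := coe_finRotate_of_ne_last (n := m) (i := 0) (by intro e; have := congrArg Fin.val e; simp at this; omega)
    rw [h] at this; simp at this; omega
  · have h1 := coe_finRotate_of_ne_last hl
    by_cases hl' : finRotate (m + 1) i = Fin.last m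
    · rw [hl', finRotate_last] at h
      rw [hl', ← h] at h1; simp at h1; omega
    · have := coe_finRotate_of_ne_last hl'
      rw [h] at this; omega

theorem edge_injective (hn : 3 ≤ n) {i j : Fin n}
    (h : s(i, finRotate n i) = s(j, finRotate n j)) : i = j := by
  rw [Sym2.eq_iff] at h
  rcases h with h | ⟨h1, h2⟩
  · exact h.1
  · rw [h1] at h2; exact (finRotate_finRotate_ne hn j h2).elim

theorem left_notMem_openSegment {a b : ℂ} (h : a ≠ b) : a ∉ openSegment ℝ a b := fun hm =>
  h (left_mem_openSegment_iff.1 hm)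

theorem right_notMem_openSegment {a b : ℂ} (h : a ≠ b) : b ∉ openSegment ℝ a b := fun hm =>
  h (right_mem_openSegment_iff.1 hm)

theorem isSimple_iff (P : Polygon ℂ n) : P.IsSimple ↔ 3 ≤ n ∧ Function.Injective P ∧
    (∀ i j, P j ∉ openSegment ℝ (P i) (P (finRotate n i))) ∧
    ∀ i j, i ≠ j → Disjoint (openSegment ℝ (P i) (P (finRotate n i)))
      (openSegment ℝ (P j) (P (finRotate n j))) := by
  have e0 : ∀ i, P.edgePath ℝ i 0 = P i := fun i => by simp [edgePath_eq]
  have eo : ∀ i z, z ∈ openSegment ℝ (P i) (P (finRotate n i)) ↔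
      ∃ s ∈ Set.Ioo (0 : ℝ) 1, P.edgePath ℝ i s = z := by
    intro i z
    rw [openSegment_eq_image_lineMap]; rfl
  constructor
  · rintro ⟨hn, h⟩
    refine ⟨hn, fun i j hij => ?_, fun i j hj => ?_, fun i j hij => ?_⟩
    · exact (h i j 0 (by simp) 0 (by simp) (by rw [e0, e0]; exact hij)).1
    · obtain ⟨s, hs, e⟩ := (eo _ _).1 hj
      have := (h i j s ⟨hs.1.le, hs.2⟩ 0 (by simp) (by rw [e, e0])).2
      exact hs.1.ne' this
    · rw [Set.disjoint_left]
      intro z hz hz'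
      obtain ⟨s, hs, e⟩ := (eo _ _).1 hz
      obtain ⟨t, ht, e'⟩ := (eo _ _).1 hz'
      exact hij (h i j s ⟨hs.1.le, hs.2⟩ t ⟨ht.1.le, ht.2⟩ (e.trans e'.symm)).1
  · rintro ⟨hn, hinj, hv, hd⟩
    refine ⟨hn, fun i j s hs t ht e => ?_⟩
    rcases hs.1.eq_or_lt with rfl | hs0
    · rcases ht.1.eq_or_lt with rfl | ht0
      · rw [e0, e0] at e; exact ⟨hinj e, rfl⟩
      · rw [e0] at e
        exact (hv j i ((eo _ _).2 ⟨t, ⟨ht0, ht.2⟩, e.symm⟩)).elim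
    · rcases ht.1.eq_or_lt with rfl | ht0
      · rw [e0] at e
        exact (hv i j ((eo _ _).2 ⟨s, ⟨hs0, hs.2⟩, e⟩)).elim
      · by_cases hij : i = j
        · subst hij
          refine ⟨rfl, ?_⟩
          have hne : P i ≠ P (finRotate n i) := fun h => finRotate_ne hn i (hinj h).symm
          exact AffineMap.lineMap_injective ℝ hne e
        · exact (Set.disjoint_left.1 (hd i j hij) ((eo _ _).2 ⟨s, ⟨hs0, hs.2⟩, rfl⟩)
            ((eo _ _).2 ⟨t, ⟨ht0, ht.2⟩, e.symm⟩)).elim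

end

section Tree

variable {T F : ℕ → ℕ → ℕ → Prop} {R : ℕ → ℂ}

/-- Within one triangle this is `lhull_inter`; for two triangles it is applied on both sides of
their common face. -/
theorem realizes_face_inter (h : Realizes T F R) {a b c a' b' c' : ℕ} (ht : T a b c)
    (ht' : T a' b' c') {s s' : Finset ℕ} (hs : s ⊆ {a, b, c}) (hs' : s' ⊆ {a', b', c'}) :
    lhull R s ∩ lhull R s' ⊆ lhull R (s ∩ s') := by
  rintro z ⟨hz, hz'⟩
  by_cases he : ({a, b, c} : Finset ℕ) = {a', b', c'}
  · rw [← he] at hs'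
    exact lhull_inter (h.pos _ _ _ ht).ne' hs hs' ⟨hz, hz'⟩
  · have h1 := h.cplx _ _ _ _ _ _ ht ht' he ⟨lhull_mono R hs hz, lhull_mono R hs' hz'⟩
    have h2 := lhull_inter (h.pos _ _ _ ht).ne' hs Finset.inter_subset_left ⟨hz, h1⟩
    rw [← Finset.inter_assoc] at h2
    have h3 := lhull_inter (h.pos _ _ _ ht').ne' Finset.inter_subset_right hs' ⟨h2, hz'⟩
    refine lhull_mono R ?_ h3
    intro y hy
    simp only [Finset.mem_inter] at hy ⊢
    exact ⟨hy.1.1.1, hy.2⟩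

theorem realizes_injOn (h : Realizes T F R) {a b c a' b' c' : ℕ} (ht : T a b c)
    (ht' : T a' b' c') (e : R a = R a') : a = a' := by
  by_contra hne
  have := realizes_face_inter h ht ht' (s := {a}) (s' := {a'}) (by simp) (by simp)
    (⟨mem_lhull R (by simp), by rw [e]; exact mem_lhull R (by simp)⟩ :
      R a ∈ lhull R {a} ∩ lhull R {a'})
  rw [Finset.singleton_inter_of_notMem (by simpa using hne)] at this
  simp [lhull] at this

/-- The polygon with the first `n` points of a sequence as vertices. -/
def ofSeq (R : ℕ → ℂ) (n : ℕ) : Polygon ℂ n := ⟨fun i => R i⟩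

theorem ofSeq_apply (R : ℕ → ℂ) (n : ℕ) (i : Fin n) : ofSeq R n i = R i := rfl

theorem _root_.PTree.Consec.exists_tri {τ : PTree} {p q i : ℕ} (h : τ.Consec p q)
    (hi : p ≤ i) (hi' : i < q) (hτ : τ ≠ leaf) : ∃ c, τ.tri p q i (i + 1) c := by
  induction τ generalizing p q with
  | leaf => exact (hτ rfl).elim
  | node l x r ihl ihr =>
    rcases lt_or_ge i x with hx | hx
    · by_cases hl : l = leaf
      · subst hl
        have : x = p + 1 := h.1
        obtain rfl : i = p := by omega
        subst this
        exact ⟨q, Or.inl (Rot.refl _ _ _)⟩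
      · obtain ⟨c, hc⟩ := ihl h.1 hi hx hl
        exact ⟨c, Or.inr (Or.inl hc)⟩
    · by_cases hr : r = leaf
      · subst hr
        have : q = x + 1 := h.2
        obtain rfl : i = x := by omega
        subst this
        exact ⟨p, Or.inl (Or.inr (Or.inl ⟨rfl, rfl, rfl⟩))⟩
      · obtain ⟨c, hc⟩ := ihr h.2 hx hi' hr
        exact ⟨c, Or.inr (Or.inr hc)⟩

theorem _root_.PTree.Consec.exists_tri_finRotate {τ : PTree} {M : ℕ} (h : τ.Consec 0 M)
    (hτ : τ ≠ leaf) (i : Fin (M + 1)) : ∃ c, τ.tri 0 M i (finRotate (M + 1) i : Fin (M + 1)) c := by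
  by_cases hi : i = Fin.last M
  · cases τ with
    | leaf => exact (hτ rfl).elim
    | node l x r =>
      rw [hi, finRotate_last]
      exact ⟨x, Or.inl (Or.inr (Or.inr ⟨rfl, rfl, rfl⟩))⟩
  · rw [coe_finRotate_of_ne_last hi]
    exact h.exists_tri (Nat.zero_le _) (by have := i.2; have : (i : ℕ) ≠ M := fun e => hi (Fin.ext e); omega) hτ

theorem _root_.PTree.Consec.two_le {τ : PTree} {p q : ℕ} (h : τ.Consec p q) (hτ : τ ≠ leaf) :
    p + 2 ≤ q := by
  cases τ with
  | leaf => exact (hτ rfl).elim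
  | node l x r => have := h.1.lt; have := h.2.lt; omega

theorem isSimple_ofSeq {τ : PTree} {M : ℕ} (hτ : τ.Consec 0 M) (hl : τ ≠ leaf)
    (h : Realizes (τ.tri 0 M) F R) : (ofSeq R (M + 1)).IsSimple := by
  have hM := hτ.two_le hl
  have hn : 3 ≤ M + 1 := by omega
  have hedge := hτ.exists_tri_finRotate hl
  have hinj : Function.Injective (ofSeq R (M + 1)) := by
    intro i j e
    obtain ⟨c, hc⟩ := hedge i
    obtain ⟨d, hd⟩ := hedge j
    exact Fin.ext (realizes_injOn h hc hd e)
  have hne : ∀ i : Fin (M + 1), R i ≠ R (finRotate (M + 1) i : Fin (M + 1)) := fun i e =>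
    finRotate_ne hn i (hinj e).symm
  have key : ∀ (i : Fin (M + 1)) (y : ℕ), y ∈ ({(i : ℕ), ((finRotate (M + 1) i : Fin (M + 1)) : ℕ)} : Finset ℕ) →
      R y ∉ openSegment ℝ (R i) (R (finRotate (M + 1) i : Fin (M + 1))) := by
    intro i y hy
    simp only [Finset.mem_insert, Finset.mem_singleton] at hy
    rcases hy with rfl | rfl
    · exact left_notMem_openSegment (hne i)
    · exact right_notMem_openSegment (hne i)
  have hsub : ∀ i : Fin (M + 1), openSegment ℝ (R i) (R (finRotate (M + 1) i : Fin (M + 1))) ⊆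
      lhull R {(i : ℕ), ((finRotate (M + 1) i : Fin (M + 1)) : ℕ)} := fun i => by
    rw [lhull_pair]; exact openSegment_subset_segment ℝ _ _
  refine (isSimple_iff _).2 ⟨hn, hinj, fun i j hj => ?_, fun i j hij => ?_⟩
  · obtain ⟨c, hc⟩ := hedge i
    obtain ⟨d, hd⟩ := hedge j
    have h1 := realizes_face_inter h hd hc (s := {(j : ℕ)})
      (s' := {(i : ℕ), ((finRotate (M + 1) i : Fin (M + 1)) : ℕ)}) (by simp)
      (by intro y; simp; tauto)
      ⟨mem_lhull R (by simp), hsub i hj⟩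
    by_cases hm : (j : ℕ) ∈ ({(i : ℕ), ((finRotate (M + 1) i : Fin (M + 1)) : ℕ)} : Finset ℕ)
    · exact key i _ hm hj
    · rw [Finset.singleton_inter_of_notMem hm] at h1
      simp [lhull] at h1
  · rw [Set.disjoint_left]
    intro z hz hz'
    obtain ⟨c, hc⟩ := hedge i
    obtain ⟨d, hd⟩ := hedge j
    set A : Finset ℕ := {(i : ℕ), ((finRotate (M + 1) i : Fin (M + 1)) : ℕ)} with hA
    set B : Finset ℕ := {(j : ℕ), ((finRotate (M + 1) j : Fin (M + 1)) : ℕ)} with hB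
    have h1 := realizes_face_inter h hc hd (s := A) (s' := B)
      (by intro y; simp [hA]; tauto) (by intro y; simp [hB]; tauto) ⟨hsub i hz, hsub j hz'⟩
    -- Different polygon edges have at most one label in common, and a vertex never lies on an open
    -- edge.
    have hcard : (A ∩ B).card ≤ 1 := by
      by_contra hcon
      push Not at hcon
      have cA : A.card ≤ 2 := Finset.card_le_two
      have cB : B.card ≤ 2 := Finset.card_le_two
      have eA : A ∩ B = A := Finset.eq_of_subset_of_card_le Finset.inter_subset_left (by omega)
      have eB : A ∩ B = B := Finset.eq_of_subset_of_card_le Finset.inter_subset_right (by omega)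
      have e : A = B := eA.symm.trans eB
      apply hij
      apply edge_injective hn
      have m1 : (i : ℕ) ∈ B := e ▸ (by simp [hA])
      have m2 : ((finRotate (M + 1) i : Fin (M + 1)) : ℕ) ∈ B := e ▸ (by simp [hA])
      have m3 : ((finRotate (M + 1) i : Fin (M + 1)) : ℕ) ≠ i := fun e => finRotate_ne hn i (Fin.ext e)
      simp only [hB, Finset.mem_insert, Finset.mem_singleton] at m1 m2
      rw [Sym2.eq_iff]
      rcases m1 with m1 | m1 <;> rcases m2 with m2 | m2
      · exact (m3 (m2.trans m1.symm)).elim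
      · exact Or.inl ⟨Fin.ext m1, Fin.ext m2⟩
      · exact Or.inr ⟨Fin.ext m1, Fin.ext m2⟩
      · exact (m3 (m2.trans m1.symm)).elim
    rcases (A ∩ B).eq_empty_or_nonempty with he | ⟨y, hy⟩
    · rw [he] at h1; simp [lhull] at h1
    · have hy' : A ∩ B = {y} := by
        refine (Finset.eq_of_subset_of_card_le (by simpa using hy) (by simpa using hcard)).symm
      rw [hy', lhull_singleton] at h1
      rw [Set.mem_singleton_iff.1 h1] at hz
      exact key i y (Finset.mem_inter.1 hy).1 hz

theorem windingNumber_ofSeq (R : ℕ → ℂ) (M : ℕ) (z : ℂ) :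
    (ofSeq R (M + 1)).windingNumber z = (∑ i ∈ Finset.Ico 0 M, ang (R i) (R (i + 1)) z +
      ang (R M) (R 0) z) / (2 * Real.pi) := by
  rw [windingNumber, Fin.sum_univ_castSucc, Nat.Ico_zero_eq_range, Finset.sum_range]
  congr 2
  · refine Finset.sum_congr rfl fun i _ => ?_
    rw [ang, ofSeq_apply, ofSeq_apply, coe_finRotate_of_ne_last (Fin.castSucc_lt_last i).ne]
    rfl
  · rw [finRotate_last, ofSeq_apply, ofSeq_apply, ang]; rfl

/-- The last polygon edge runs back along the base of the tree and cancels the base term of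
`exists_chain_ang`, so off the boundary the winding number is the integer `k` there. -/
theorem closedRegion_ofSeq {τ : PTree} {M : ℕ} (hτ : τ.Consec 0 M) (hl : τ ≠ leaf)
    (hpos : ∀ a b c, τ.tri 0 M a b c → 0 < orient (R a) (R b) (R c)) :
    (ofSeq R (M + 1)).closedRegion = region (τ.tri 0 M) R := by
  have hb : (ofSeq R (M + 1)).boundary ℝ ⊆ region (τ.tri 0 M) R := by
    rw [boundary_eq]
    refine Set.iUnion_subset fun i => ?_
    obtain ⟨c, hc⟩ := hτ.exists_tri_finRotate hl i
    exact (segment_subset_lhull (by simp) (by simp)).trans (subset_region hc)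
  have main : ∀ z, z ∉ (ofSeq R (M + 1)).boundary ℝ →
      ((ofSeq R (M + 1)).windingNumber z ≠ 0 ↔ z ∈ region (τ.tri 0 M) R) := by
    intro z hz
    rw [boundary_eq, Set.mem_iUnion] at hz
    push Not at hz
    have hne : ∀ i, 0 ≤ i → i ≤ M → z ≠ R i := by
      rintro i - hi rfl
      exact hz ⟨i, by omega⟩ (left_mem_segment ℝ _ _)
    have hlast : z ∉ segment ℝ (R 0) (R M) := by
      have := hz (Fin.last M)
      rw [finRotate_last, ofSeq_apply, ofSeq_apply, segment_symm] at this
      exact this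
    obtain ⟨k, e, h1, h2, h3⟩ := exists_chain_ang hτ hpos hne
    have hsw := ang_swap (R 0) (R M) z
    rw [if_neg fun e => hlast (openSegment_subset_segment ℝ _ _ (mem_openSegment_of_ang e))] at hsw
    have : (ofSeq R (M + 1)).windingNumber z = k := by
      rw [windingNumber_ofSeq, e, hsw]
      have := Real.pi_ne_zero
      field_simp; ring
    rw [this]
    constructor
    · intro hk
      by_contra hcon
      exact hk (by rw [h3 hcon]; simp)
    · intro hr
      have := h2 hr hlast
      exact_mod_cast (by omega : k ≠ 0)
  ext z
  constructor
  · rintro (hz | ⟨hz, hw⟩)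
    · exact hb hz
    · exact (main z hz).1 hw
  · intro hz
    by_cases hbd : z ∈ (ofSeq R (M + 1)).boundary ℝ
    · exact Or.inl hbd
    · exact Or.inr ⟨hbd, (main z hbd).2 hz⟩

/-- The right-hand side does not mention `R`: all realizations of a tree have the same visibility
graph, and any path of them is monotonic. -/
theorem visible_ofSeq_iff {τ : PTree} {M : ℕ} (hτ : τ.Consec 0 M) (hl : τ ≠ leaf)
    (h : Realizes (τ.tri 0 M) F R) (i j : Fin (M + 1)) :
    (ofSeq R (M + 1)).Visible i j ↔ i = j ∨ ∃ c, τ.tri 0 M i j c ∨ τ.tri 0 M j i c := by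
  rw [Visible, closedRegion_ofSeq hτ hl h.pos]
  obtain ⟨c, hc⟩ := hτ.exists_tri_finRotate hl i
  obtain ⟨d, hd⟩ := hτ.exists_tri_finRotate hl j
  constructor
  · intro hv
    by_cases hij : i = j
    · exact Or.inl hij
    · exact Or.inr (exists_common_triangle h hτ.wf.glue hc hd (fun e => hij (Fin.ext e)) hv)
  · rintro (rfl | ⟨c, h | h⟩)
    · exact (segment_subset_lhull (by simp) (by simp)).trans (subset_region hc)
    · exact (segment_subset_lhull (by simp) (by simp)).trans (subset_region h)
    · exact (segment_subset_lhull (by simp) (by simp)).trans (subset_region h)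

end Tree
-- Winding numbers of a simple polygon near its edges
/-- A simple closed polygon, given as a periodic sequence of points. -/
structure PerSimple (n : ℕ) (p : ℕ → ℂ) : Prop where
  three : 3 ≤ n
  per : ∀ i, p (i + n) = p i
  inj : ∀ i j, p i = p j → i ≡ j [MOD n]
  vert : ∀ i j, p j ∉ openSegment ℝ (p i) (p (i + 1))
  disj : ∀ i j, ¬ i ≡ j [MOD n] →
    Disjoint (openSegment ℝ (p i) (p (i + 1))) (openSegment ℝ (p j) (p (j + 1)))

/-- The closed curve of a sequence of points. -/
def bd (p : ℕ → ℂ) : Set ℂ := ⋃ i, segment ℝ (p i) (p (i + 1))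

/-- The total signed angle swept along the sequence from index `k` to index `l`. -/
noncomputable def sweep (p : ℕ → ℂ) (k l : ℕ) (z : ℂ) : ℝ :=
  ∑ j ∈ Finset.Ico k l, ang (p j) (p (j + 1)) z

theorem mem_bd {p : ℕ → ℂ} {z : ℂ} : z ∈ bd p ↔ ∃ i, z ∈ segment ℝ (p i) (p (i + 1)) := by
  simp [bd]

theorem vertex_mem_bd (p : ℕ → ℂ) (i : ℕ) : p i ∈ bd p :=
  mem_bd.2 ⟨i, left_mem_segment ℝ _ _⟩

theorem sweep_coe {p : ℕ → ℂ} {k l : ℕ} {z : ℂ} (hkl : k ≤ l)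
    (h : ∀ j, k ≤ j → j ≤ l → z ≠ p j) :
    (sweep p k l z : Real.Angle) = Complex.arg (p l - z) - Complex.arg (p k - z) := by
  induction l, hkl using Nat.le_induction with
  | base => simp [sweep]
  | succ l hkl ih =>
    have := ih fun j h1 h2 => h j h1 (h2.trans (Nat.le_succ _))
    rw [sweep, Finset.sum_Ico_succ_top hkl, Real.Angle.coe_add, ← sweep, this,
      ang_coe (h l hkl (Nat.le_succ _)) (h (l + 1) (hkl.trans (Nat.le_succ _)) le_rfl)]
    abel

/-- Two different values would differ by a multiple of `2π`, and on a connected set an intermediate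
value less than a full turn away from the first would be attained. -/
theorem eq_of_coe_angle {S : Set ℂ} (hS : IsPreconnected S) {f : ℂ → ℝ} (hf : ContinuousOn f S)
    {θ : Real.Angle} (h : ∀ x ∈ S, (f x : Real.Angle) = θ) {x y : ℂ} (hx : x ∈ S) (hy : y ∈ S) :
    f x = f y := by
  have main : ∀ x ∈ S, ∀ y ∈ S, ¬ f x < f y := by
    intro x hx y hy hlt
    have hpi := Real.pi_pos
    obtain ⟨z, hz, e⟩ := hS.intermediate_value hx hy hf
      (show min (f y) (f x + Real.pi) ∈ Set.Icc (f x) (f y) from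
        ⟨le_min hlt.le (by linarith), min_le_left _ _⟩)
    have := (h z hz).trans (h x hx).symm
    rw [Real.Angle.angle_eq_iff_two_pi_dvd_sub] at this
    obtain ⟨k, hk⟩ := this
    have h1 : f x < f z := by rw [e]; exact lt_min hlt (by linarith)
    have h2 : f z ≤ f x + Real.pi := by rw [e]; exact min_le_right _ _
    have k1 : (0 : ℝ) < k := by
      by_contra hcon
      push Not at hcon
      nlinarith
    have k2 : (k : ℝ) < 1 := by
      by_contra hcon
      push Not at hcon
      nlinarith
    have k1' : 0 < k := by exact_mod_cast k1
    have k2' : k < 1 := by exact_mod_cast k2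
    omega
  exact le_antisymm (not_lt.1 (main y hy x hx)) (not_lt.1 (main x hx y hy))

theorem arg_div_smul {r : ℝ} (hr : 0 < r) (y w : ℂ) :
    Complex.arg (y / (r * w)) = Complex.arg (y / w) := by
  rw [show y / ((r : ℂ) * w) = ((r⁻¹ : ℝ) : ℂ) * (y / w) by push_cast; field_simp,
    Complex.arg_real_mul _ (inv_pos.2 hr)]

theorem arg_smul_div {r : ℝ} (hr : 0 < r) (y w : ℂ) :
    Complex.arg ((r * y) / w) = Complex.arg (y / w) := by
  rw [mul_div_assoc, Complex.arg_real_mul _ hr]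

/-- For `b` and `v` the ends of an edge and `a` the far end of an adjacent edge, each case
contradicts simplicity; this keeps the arguments in `edgeSweep` off the cut. -/
theorem ray_cases {v b a x : ℂ} {t r : ℝ} (ht : 0 ≤ t) (hx : x = (1 - t) • v + t • b)
    (hr : 0 < r) (h : a - x = r * (b - v)) :
    a ∈ openSegment ℝ v b ∨ a = b ∨ b ∈ openSegment ℝ v a := by
  have ha : a = v + ((t + r : ℝ) : ℂ) * (b - v) := by
    rw [← sub_add_cancel a x, h, hx, Complex.real_smul, Complex.real_smul]; push_cast; ring
  rcases lt_trichotomy (t + r) 1 with h1 | h1 | h1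
  · refine Or.inl ⟨1 - (t + r), t + r, by linarith, by linarith, by ring, ?_⟩
    rw [ha, Complex.real_smul, Complex.real_smul]; push_cast; ring
  · refine Or.inr (Or.inl ?_)
    rw [ha, h1]; push_cast; ring
  · have h0 : 0 < t + r := by linarith
    refine Or.inr (Or.inr ⟨1 - 1 / (t + r), 1 / (t + r), ?_, by positivity, by ring, ?_⟩)
    · rw [sub_pos, div_lt_one h0]; exact h1
    · rw [ha, Complex.real_smul, Complex.real_smul]
      have : ((t + r : ℝ) : ℂ) ≠ 0 := by exact_mod_cast h0.ne'
      push_cast at this ⊢; field_simp; ring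

namespace PerSimple

variable {n : ℕ} {p : ℕ → ℂ}

theorem inj' (h : PerSimple n p) {i j : ℕ} (hij : i < j) (hji : j < i + n) : p i ≠ p j := by
  intro e
  have := (Nat.modEq_iff_dvd' hij.le).1 (h.inj i j e)
  exact absurd (Nat.le_of_dvd (by omega) this) (by omega)

theorem not_modEq {i j : ℕ} (hij : i < j) (hji : j < i + n) : ¬ i ≡ j [MOD n] := by
  intro e
  exact absurd (Nat.le_of_dvd (by omega) ((Nat.modEq_iff_dvd' hij.le).1 e)) (by omega)

theorem notMem_edge (h : PerSimple n p) {i j : ℕ} (hij : i + 1 < j) (hji : j < i + n) :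
    p j ∉ segment ℝ (p i) (p (i + 1)) := by
  intro hm
  rw [← insert_endpoints_openSegment] at hm
  rcases hm with e | e | e
  · exact h.inj' (by omega) hji e.symm
  · exact h.inj' hij (by omega) e.symm
  · exact h.vert _ _ e

theorem notMem_vertex_edge (h : PerSimple n p) {i j : ℕ} (hij : i < j) (hji : j + 1 < i + n) :
    p i ∉ segment ℝ (p j) (p (j + 1)) := by
  have := h.notMem_edge (i := j) (j := i + n) hji (by omega)
  rwa [h.per] at this

/-- Edges that are not adjacent are disjoint. -/
theorem disjoint_edges (h : PerSimple n p) {i j : ℕ} (hij : i + 1 < j) (hji : j + 1 < i + n) :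
    Disjoint (segment ℝ (p i) (p (i + 1))) (segment ℝ (p j) (p (j + 1))) := by
  rw [Set.disjoint_left]
  intro z hz hz'
  rw [← insert_endpoints_openSegment] at hz
  rcases hz with rfl | rfl | hz
  · exact h.notMem_vertex_edge (by omega) hji hz'
  · exact h.notMem_vertex_edge hij (by omega) hz'
  · rw [← insert_endpoints_openSegment] at hz'
    rcases hz' with rfl | rfl | hz'
    · exact h.vert _ _ hz
    · exact h.vert _ _ hz
    · exact Set.disjoint_left.1 (h.disj i j (not_modEq (by omega) (by omega))) hz hz'

theorem notMem_edge_of_open (h : PerSimple n p) {i j : ℕ} {z : ℂ}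
    (hz : z ∈ openSegment ℝ (p i) (p (i + 1))) (hij : i < j) (hji : j < i + n) :
    z ∉ segment ℝ (p j) (p (j + 1)) := by
  intro hz'
  rw [← insert_endpoints_openSegment] at hz'
  rcases hz' with rfl | rfl | hz'
  · exact h.vert _ _ hz
  · exact h.vert _ _ hz
  · exact Set.disjoint_left.1 (h.disj i j (not_modEq hij hji)) hz hz'

theorem ne_vertex_of_open (h : PerSimple n p) {i : ℕ} {z : ℂ}
    (hz : z ∈ openSegment ℝ (p i) (p (i + 1))) (j : ℕ) : z ≠ p j := by
  rintro rfl; exact h.vert _ _ hz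

/-- The total angle of the edges other than edge `k`, seen from a point of the closed edge `k`. -/
noncomputable def edgeSweep (n : ℕ) (p : ℕ → ℂ) (k : ℕ) (x : ℂ) : ℝ :=
  sweep p (k + 2) (k + n - 1) x +
    Complex.arg ((p k - p (k + 1)) / (p (k + n - 1) - x)) +
    Complex.arg ((p (k + 2) - x) / (p (k + 1) - p k))

/-- In `edgeSweep` the directions from `x` to the two ends of the edge are replaced by the
directions of the edge itself. On the open edge this changes no argument, and it keeps the
expression meaningful at the ends. -/
theorem edgeSweep_eq (h : PerSimple n p) {k : ℕ} {x : ℂ}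
    (hx : x ∈ openSegment ℝ (p k) (p (k + 1))) :
    edgeSweep n p k x = sweep p (k + 1) (k + n) x := by
  have h3 := h.three
  obtain ⟨m, rfl⟩ : ∃ m, n = m + 3 := ⟨n - 3, by omega⟩
  rw [edgeSweep, show k + (m + 3) - 1 = k + 2 + m by omega, show k + (m + 3) = k + 2 + m + 1 by omega,
    sweep, sweep, Finset.sum_Ico_succ_top (by omega), Finset.sum_eq_sum_Ico_succ_bot (a := k + 1) (by omega)]
  have e := h.per k
  rw [show k + (m + 3) = k + 2 + m + 1 by omega] at e
  rw [e, ang, ang]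
  obtain ⟨s, t, hs, ht, hst, rfl⟩ := hx
  have e1 : p k - (s • p k + t • p (k + 1)) = t * (p k - p (k + 1)) := by
    obtain rfl : s = 1 - t := by linarith
    rw [Complex.real_smul, Complex.real_smul]; push_cast; ring
  have e2 : p (k + 1) - (s • p k + t • p (k + 1)) = s * (p (k + 1) - p k) := by
    obtain rfl : t = 1 - s := by linarith
    rw [Complex.real_smul, Complex.real_smul]; push_cast; ring
  rw [e1, e2, arg_smul_div ht, arg_div_smul hs]
  ring

theorem ne_of_edge (h : PerSimple n p) {k j : ℕ} {x : ℂ}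
    (hx : x ∈ segment ℝ (p k) (p (k + 1))) (h1 : k + 2 ≤ j) (h2 : j < k + n) : x ≠ p j := by
  rintro rfl
  exact h.notMem_edge (by omega) h2 hx

/-- Modulo `2π` the angles telescope from the direction of the edge to the opposite direction. -/
theorem edgeSweep_coe (h : PerSimple n p) {k : ℕ} {x : ℂ}
    (hx : x ∈ segment ℝ (p k) (p (k + 1))) : (edgeSweep n p k x : Real.Angle) = Real.pi := by
  have h3 := h.three
  have h1 := h.ne_of_edge hx (j := k + n - 1) (by omega) (by omega)
  have h2 := h.ne_of_edge hx (j := k + 2) (by omega) (by omega)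
  have h4 := sub_ne_zero.2 (h.inj' (i := k) (j := k + 1) (by omega) (by omega))
  rw [edgeSweep, Real.Angle.coe_add, Real.Angle.coe_add, sweep_coe (by omega) fun j a b =>
    h.ne_of_edge hx a (by omega), Complex.arg_div_coe_angle h4 (sub_ne_zero.2 h1.symm),
    Complex.arg_div_coe_angle (sub_ne_zero.2 h2.symm) (by rwa [← neg_sub, neg_ne_zero]),
    ← neg_sub (p k), Complex.arg_neg_coe_angle h4]
  have := Real.Angle.coe_pi_add_coe_pi
  rw [← sub_eq_zero]
  have e : (Real.pi : Real.Angle) = - Real.pi := by rw [eq_neg_iff_add_eq_zero]; exact this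
  nth_rewrite 1 [e]
  abel_nf

/-- The argument of a nonzero quotient can only jump at the negative reals, that is, where an
adjacent edge would fold back onto the edge `k`. -/
theorem continuousAt_edgeSweep (h : PerSimple n p) {k : ℕ} {x : ℂ}
    (hx : x ∈ segment ℝ (p k) (p (k + 1))) : ContinuousAt (edgeSweep n p k) x := by
  have h3 := h.three
  have h1 := h.ne_of_edge hx (j := k + n - 1) (by omega) (by omega)
  have h2 := h.ne_of_edge hx (j := k + 2) (by omega) (by omega)
  have hne := h.inj' (i := k) (j := k + 1) (by omega) (by omega)
  have h4 := sub_ne_zero.2 hne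
  have h4' := sub_ne_zero.2 hne.symm
  have hper := h.per k
  obtain ⟨s, t, hs, ht, hst, e⟩ := id hx
  have slit : ∀ {y w : ℂ}, y ≠ 0 → w ≠ 0 → (∀ r : ℝ, 0 < r → y ≠ -r * w) →
      y / w ∈ Complex.slitPlane := by
    intro y w hy hw hr
    rw [Complex.mem_slitPlane_iff_arg]
    refine ⟨fun e => ?_, div_ne_zero hy hw⟩
    obtain ⟨g1, g2⟩ := Complex.arg_eq_pi_iff.1 e
    refine hr (-(y / w).re) (by linarith) ?_
    have : (y / w) = ((y / w).re : ℂ) := Complex.ext (by simp) (by simp [g2])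
    push_cast
    rw [neg_neg, ← this, div_mul_cancel₀ _ hw]
  refine (ContinuousAt.add ?_ ?_).add ?_
  · unfold sweep
    refine tendsto_finsetSum _ fun j hj => ?_
    rw [Finset.mem_Ico] at hj
    exact continuousAt_ang fun hm => Set.disjoint_left.1
      (h.disjoint_edges (i := k) (j := j) (by omega) (by omega)) hx hm
  · refine ContinuousAt.comp (f := fun x => (p k - p (k + 1)) / (p (k + n - 1) - x))
      (g := Complex.arg) (Complex.continuousAt_arg (slit h4 (sub_ne_zero.2 h1.symm) ?_))
      (continuousAt_const.div (continuousAt_const.sub continuousAt_id) (sub_ne_zero.2 h1.symm))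
    intro r hr e'
    have hr' : (r : ℂ) ≠ 0 := by exact_mod_cast hr.ne'
    rcases ray_cases ht (x := x) (a := p (k + n - 1)) (r := r⁻¹)
      (by rw [← e]; obtain rfl : s = 1 - t := by linarith
          rfl) (inv_pos.2 hr) (by push_cast; field_simp; linear_combination e') with g | g | g
    · exact h.vert _ _ g
    · exact h.inj' (i := k + 1) (j := k + n - 1) (by omega) (by omega) g.symm
    · rw [← hper, openSegment_symm] at g
      have := h.vert (k + n - 1) (k + 1)
      rw [show k + n - 1 + 1 = k + n by omega] at this
      exact this g
  · refine ContinuousAt.comp (f := fun x => (p (k + 2) - x) / (p (k + 1) - p k))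
      (g := Complex.arg) (Complex.continuousAt_arg (slit (sub_ne_zero.2 h2.symm) h4' ?_))
      ((continuousAt_const.sub continuousAt_id).div continuousAt_const h4')
    intro r hr e'
    rcases ray_cases hs (x := x) (a := p (k + 2)) (r := r)
      (by rw [← e]; obtain rfl : t = 1 - s := by linarith
          rw [add_comm]) hr (by rw [e']; ring) with g | g | g
    · rw [openSegment_symm] at g; exact h.vert _ _ g
    · exact h.inj' (i := k) (j := k + 2) (by omega) (by omega) g.symm
    · exact h.vert (k + 1) k g

theorem edgeSweep_const (h : PerSimple n p) {k : ℕ} {x y : ℂ}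
    (hx : x ∈ segment ℝ (p k) (p (k + 1))) (hy : y ∈ segment ℝ (p k) (p (k + 1))) :
    edgeSweep n p k x = edgeSweep n p k y :=
  eq_of_coe_angle (convex_segment (𝕜 := ℝ) (p k) (p (k + 1))).isPreconnected
    (fun _ hz => (h.continuousAt_edgeSweep hz).continuousWithinAt) (fun _ hz => h.edgeSweep_coe hz)
    hx hy

theorem edgeSweep_vertex (h : PerSimple n p) (k : ℕ) : edgeSweep n p k (p k) =
    sweep p (k + 1) (k + n - 1) (p k) +
      Complex.arg ((p k - p (k + 1)) / (p (k + n - 1) - p k)) := by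
  have h3 := h.three
  rw [edgeSweep, sweep, sweep, Finset.sum_eq_sum_Ico_succ_bot (a := k + 1) (by omega), ang]
  ring

/-- At the common vertex both expressions add up the same angles. With constancy along each edge,
the value propagates around the polygon. -/
theorem edgeSweep_succ (h : PerSimple n p) (k : ℕ) :
    edgeSweep n p k (p (k + 1)) = edgeSweep n p (k + 1) (p (k + 1)) := by
  have h3 := h.three
  rw [h.edgeSweep_vertex, edgeSweep, sweep, sweep]
  rw [show k + 1 + n - 1 = (k + n - 1) + 1 by omega, Finset.sum_Ico_succ_top (by omega), ang,
    show k + n - 1 + 1 = k + n by omega, h.per k, add_assoc, add_assoc]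
  congr 2
  rw [← neg_sub (p (k + 2)), ← neg_sub (p (k + 1)) (p k), neg_div_neg_eq]

theorem edgeSweep_eq_zero (h : PerSimple n p) (k : ℕ) :
    edgeSweep n p k (p k) = edgeSweep n p 0 (p 0) := by
  induction k with
  | zero => rfl
  | succ k ih =>
    rw [← h.edgeSweep_succ, h.edgeSweep_const (right_mem_segment ℝ _ _) (left_mem_segment ℝ _ _), ih]

end PerSimple
/-- `2π` times the winding number of a closed polygon. -/
noncomputable def wind (n : ℕ) (p : ℕ → ℂ) (z : ℂ) : ℝ := sweep p 0 n z

namespace PerSimple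

variable {n : ℕ} {p : ℕ → ℂ}

/-- The common value is `π` modulo `2π`, so it suffices to find one vertex where its modulus is
below `2π`. From the lexicographically smallest vertex all others are seen within a half turn, where
the angles telescope as real numbers. The sign `κ` is the orientation of the polygon, with `1` for
counter-clockwise. -/
theorem edgeSweep_sign (h : PerSimple n p) : ∃ κ : ℝ, (κ = 1 ∨ κ = -1) ∧
    ∀ k, ∀ x ∈ segment ℝ (p k) (p (k + 1)), edgeSweep n p k x = κ * Real.pi := by
  have h3 := h.three
  have hpi := Real.pi_pos
  suffices hs : ∃ k, |edgeSweep n p k (p k)| < 2 * Real.pi by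
    obtain ⟨k, hk⟩ := hs
    have hc := h.edgeSweep_coe (left_mem_segment ℝ (p k) (p (k + 1)))
    rw [Real.Angle.angle_eq_iff_two_pi_dvd_sub] at hc
    obtain ⟨m, hm⟩ := hc
    obtain ⟨a1, a2⟩ := abs_lt.1 hk
    have m1 : (-2 : ℝ) < m := by
      by_contra hcon
      push Not at hcon
      nlinarith
    have m2 : (m : ℝ) < 1 := by
      by_contra hcon
      push Not at hcon
      nlinarith
    have m1' : -2 < m := by exact_mod_cast m1
    have m2' : m < 1 := by exact_mod_cast m2
    have all : ∀ k', ∀ x ∈ segment ℝ (p k') (p (k' + 1)), edgeSweep n p k' x =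
        edgeSweep n p k (p k) := fun k' x hx => by
      rw [h.edgeSweep_const hx (left_mem_segment ℝ _ _), h.edgeSweep_eq_zero,
        ← h.edgeSweep_eq_zero k]
    have : m = -1 ∨ m = 0 := by omega
    rcases this with rfl | rfl
    · exact ⟨-1, Or.inr rfl, fun k' x hx => by rw [all k' x hx]; push_cast at hm; linarith⟩
    · exact ⟨1, Or.inl rfl, fun k' x hx => by rw [all k' x hx]; push_cast at hm; linarith⟩
  obtain ⟨k, -, hk⟩ := Finset.exists_min_image (Finset.range n)
    (fun i => toLex ((p i).re, (p i).im)) ⟨0, by simp; omega⟩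
  have hmin : ∀ j, toLex ((p k).re, (p k).im) ≤ toLex ((p j).re, (p j).im) := by
    intro j
    have hp : Function.Periodic p n := h.per
    have := hk (j % n) (Finset.mem_range.2 (Nat.mod_lt _ (by omega)))
    rwa [hp.map_mod_nat] at this
  have harg : ∀ j, k < j → j < k + n → Complex.arg (p j - p k) ∈
      Set.Ioc (-(Real.pi / 2)) (Real.pi / 2) := by
    intro j h1 h2
    have hne := h.inj' h1 h2
    have := hmin j
    rw [Prod.Lex.toLex_le_toLex] at this
    rcases this with hlt | ⟨heq, hle⟩
    · have := Complex.abs_arg_lt_pi_div_two_iff.2 (Or.inl (by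
        rw [Complex.sub_re]; simpa using hlt : 0 < (p j - p k).re))
      exact ⟨(abs_lt.1 this).1, (abs_lt.1 this).2.le⟩
    · have hre : (p j - p k).re = 0 := by simp at heq ⊢; linarith
      have him : 0 < (p j - p k).im := by
        refine lt_of_le_of_ne (by simpa using hle) fun e => hne ?_
        apply Complex.ext
        · exact heq
        · rw [Complex.sub_im] at e; linarith
      have : Complex.arg (p j - p k) = Real.pi / 2 := Complex.arg_eq_pi_div_two_iff.2 ⟨hre, him⟩
      rw [this]; constructor <;> linarith
  refine ⟨k, ?_⟩
  have htel : ∀ m, k + 1 ≤ m → m < k + n → sweep p (k + 1) m (p k) =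
      Complex.arg (p m - p k) - Complex.arg (p (k + 1) - p k) := by
    intro m hm
    induction m, hm using Nat.le_induction with
    | base => intro _; simp [sweep]
    | succ m hm ih =>
      intro hlt
      have e1 := ih (by omega)
      rw [sweep, Finset.sum_Ico_succ_top hm, ← sweep, e1]
      have b1 := harg m (by omega) (by omega)
      have b2 := harg (m + 1) (by omega) hlt
      have hc := ang_coe (h.inj' (i := k) (j := m) (by omega) (by omega))
        (h.inj' (i := k) (j := m + 1) (by omega) hlt)
      rw [← Real.Angle.coe_sub, Real.Angle.angle_eq_iff_two_pi_dvd_sub] at hc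
      obtain ⟨c, hc⟩ := hc
      have c1 := ang_le_pi (p m) (p (m + 1)) (p k)
      have c2 := neg_pi_lt_ang (p m) (p (m + 1)) (p k)
      have m1 : (-1 : ℝ) < c := by
        by_contra hcon
        push Not at hcon
        nlinarith [b1.1, b1.2, b2.1, b2.2]
      have m2 : (c : ℝ) < 1 := by
        by_contra hcon
        push Not at hcon
        nlinarith [b1.1, b1.2, b2.1, b2.2]
      have m1' : -1 < c := by exact_mod_cast m1
      have m2' : c < 1 := by exact_mod_cast m2
      obtain rfl : c = 0 := by omega
      push_cast at hc
      linarith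
  rw [h.edgeSweep_vertex, htel (k + n - 1) (by omega) (by omega)]
  have b1 := harg (k + 1) (by omega) (by omega)
  have b2 := harg (k + n - 1) (by omega) (by omega)
  have c1 := Complex.arg_le_pi ((p k - p (k + 1)) / (p (k + n - 1) - p k))
  have c2 := Complex.neg_pi_lt_arg ((p k - p (k + 1)) / (p (k + n - 1) - p k))
  rw [abs_lt]
  constructor <;> linarith [b1.1, b1.2, b2.1, b2.2]

theorem sweep_period (h : PerSimple n p) (k : ℕ) (z : ℂ) : sweep p k (k + n) z = wind n p z := by
  have h3 := h.three
  induction k with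
  | zero => simp [wind]
  | succ k ih =>
    have hp := h.per (k + 1)
    rw [← ih, sweep, sweep, Finset.sum_eq_sum_Ico_succ_bot (a := k) (by omega),
      show k + 1 + n = k + n + 1 by omega, Finset.sum_Ico_succ_top (by omega), h.per k,
      show k + n + 1 = k + 1 + n by omega, hp]
    ring

theorem wind_eq (h : PerSimple n p) (k : ℕ) (z : ℂ) :
    wind n p z = ang (p k) (p (k + 1)) z + sweep p (k + 1) (k + n) z := by
  have h3 := h.three
  rw [← h.sweep_period k, sweep, Finset.sum_eq_sum_Ico_succ_bot (a := k) (by omega), sweep]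

theorem bd_eq (h : PerSimple n p) (k : ℕ) :
    bd p = ⋃ j ∈ Finset.Ico k (k + n), segment ℝ (p j) (p (j + 1)) := by
  have h3 := h.three
  ext z
  simp only [mem_bd, Set.mem_iUnion, exists_prop]
  constructor
  · rintro ⟨i, hi⟩
    have hp : Function.Periodic p n := h.per
    have e0 : (i + (n - 1) * k) % n + k ≡ i [MOD n] := by
      have : (i + (n - 1) * k) % n + k ≡ (i + (n - 1) * k) + k [MOD n] :=
        (Nat.mod_modEq _ _).add_right k
      refine this.trans ?_
      have e : i + (n - 1) * k + k = i + n * k := by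
        obtain ⟨m, rfl⟩ : ∃ m, n = m + 1 := ⟨n - 1, by omega⟩
        simp; ring
      rw [e]
      exact (Nat.modEq_iff_dvd' (by omega)).2 ⟨k, by omega⟩ |>.symm
    refine ⟨(i + (n - 1) * k) % n + k, ?_, ?_⟩
    · rw [Finset.mem_Ico]
      have := Nat.mod_lt (i + (n - 1) * k) (show 0 < n by omega)
      omega
    · rw [← hp.map_mod_nat, e0, hp.map_mod_nat, ← hp.map_mod_nat (_ + 1),
        (e0.add_right 1 : _ % n = _), hp.map_mod_nat]
      exact hi
  · rintro ⟨j, -, hj⟩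
    exact ⟨j, hj⟩

theorem wind_coe (h : PerSimple n p) {z : ℂ} (hz : z ∉ bd p) :
    (wind n p z : Real.Angle) = 0 := by
  rw [wind, sweep_coe (Nat.zero_le _) fun j _ _ => by rintro rfl; exact hz (vertex_mem_bd p j)]
  have := h.per 0
  rw [zero_add] at this
  rw [this, sub_self]

theorem continuousAt_wind {z : ℂ} (hz : z ∉ bd p) : ContinuousAt (wind n p) z := by
  unfold wind sweep
  exact tendsto_finsetSum _ fun j _ => continuousAt_ang fun hm => hz (mem_bd.2 ⟨j, hm⟩)

theorem wind_const (h : PerSimple n p) {S : Set ℂ} (hS : IsPreconnected S)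
    (hd : Disjoint S (bd p)) {x y : ℂ} (hx : x ∈ S) (hy : y ∈ S) : wind n p x = wind n p y :=
  eq_of_coe_angle hS (fun _ hz => (continuousAt_wind (Set.disjoint_left.1 hd hz)).continuousWithinAt)
    (fun _ hz => h.wind_coe (Set.disjoint_left.1 hd hz)) hx hy

theorem continuousAt_rest (h : PerSimple n p) {k : ℕ} {x : ℂ}
    (hx : x ∈ openSegment ℝ (p k) (p (k + 1))) :
    ContinuousAt (sweep p (k + 1) (k + n)) x := by
  unfold sweep
  refine tendsto_finsetSum _ fun j hj => ?_
  rw [Finset.mem_Ico] at hj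
  exact continuousAt_ang (h.notMem_edge_of_open hx (by omega) (by omega))

theorem eventually_notMem_bd (h : PerSimple n p) {k : ℕ} {x : ℂ}
    (hx : x ∈ openSegment ℝ (p k) (p (k + 1))) :
    ∀ᶠ z in 𝓝 x, orient (p k) (p (k + 1)) z ≠ 0 → z ∉ bd p := by
  have h3 := h.three
  have : ∀ᶠ z in 𝓝 x, ∀ j ∈ Finset.Ico (k + 1) (k + n), z ∉ segment ℝ (p j) (p (j + 1)) := by
    rw [Filter.eventually_all_finset]
    intro j hj
    rw [Finset.mem_Ico] at hj
    have hc : IsClosed (segment ℝ (p j) (p (j + 1))) := by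
      rw [← convexHull_pair]
      exact ((Set.toFinite _).isCompact_convexHull (𝕜 := ℝ)).isClosed
    exact hc.isOpen_compl.mem_nhds (h.notMem_edge_of_open hx (by omega) (by omega))
  filter_upwards [this] with z hz h0 hm
  rw [h.bd_eq k] at hm
  simp only [Set.mem_iUnion, exists_prop] at hm
  obtain ⟨j, hj, hm⟩ := hm
  rw [Finset.mem_Ico] at hj
  rcases hj.1.eq_or_lt with rfl | hlt
  · exact h0 (orient_eq_zero_of_mem_segment hm)
  · exact hz j (Finset.mem_Ico.2 ⟨hlt, hj.2⟩) hm

/-- The winding numbers on the two sides of an edge. -/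
theorem eventually_wind (h : PerSimple n p) {κ : ℝ} (hκ : κ = 1 ∨ κ = -1)
    (hs : ∀ k, ∀ x ∈ segment ℝ (p k) (p (k + 1)), edgeSweep n p k x = κ * Real.pi) {k : ℕ} {x : ℂ}
    (hx : x ∈ openSegment ℝ (p k) (p (k + 1))) :
    ∀ᶠ z in 𝓝 x, (0 < orient (p k) (p (k + 1)) z →
        z ∉ bd p ∧ wind n p z = (κ + 1) * Real.pi) ∧
      (orient (p k) (p (k + 1)) z < 0 → z ∉ bd p ∧ wind n p z = (κ - 1) * Real.pi) := by
  have hpi := Real.pi_pos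
  have e := hs k x (openSegment_subset_segment ℝ _ _ hx)
  rw [h.edgeSweep_eq hx] at e
  have hc := h.continuousAt_rest hx
  -- Near `x` the other edges contribute a value within `π` of `κ π`, and the edge itself an angle
  -- in `(0, π]` on its left and in `(-π, 0)` on its right. Only one multiple of `2π` remains on
  -- each side.
  have h1 := hc.eventually (lt_mem_nhds (show κ * Real.pi - Real.pi < _ by rw [e]; linarith))
  have h2 := hc.eventually (gt_mem_nhds (show _ < κ * Real.pi + Real.pi by rw [e]; linarith))
  have two : ∀ {m : ℤ} {a : ℝ}, 2 * Real.pi * m = a → ∀ c : ℤ, 2 * Real.pi * (c - 1) < a →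
      a < 2 * Real.pi * (c + 1) → a = 2 * Real.pi * c := by
    intro m a hm c h1 h2
    have m1 : (c - 1 : ℝ) < m := by
      rw [← hm] at h1; exact lt_of_mul_lt_mul_left h1 (by positivity)
    have m2 : (m : ℝ) < c + 1 := by
      rw [← hm] at h2; exact lt_of_mul_lt_mul_left h2 (by positivity)
    have m1' : c - 1 < m := by exact_mod_cast m1
    have m2' : m < c + 1 := by exact_mod_cast m2
    obtain rfl : m = c := by omega
    exact hm.symm
  filter_upwards [h.eventually_notMem_bd hx, h1, h2] with z g1 g2 g3
  have hz := h.wind_eq k z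
  constructor
  · intro ho
    have hb := g1 ho.ne'
    refine ⟨hb, ?_⟩
    have hc := h.wind_coe hb
    rw [Real.Angle.coe_eq_zero_iff] at hc
    obtain ⟨m, hm⟩ := hc
    rw [zsmul_eq_mul, mul_comm] at hm
    have a1 := ang_pos ho
    have a2 := ang_le_pi (p k) (p (k + 1)) z
    rcases hκ with rfl | rfl
    · rw [two hm 1 (by push_cast; linarith) (by push_cast; linarith)]; push_cast; ring
    · rw [two hm 0 (by push_cast; linarith) (by push_cast; linarith)]; push_cast; ring
  · intro ho
    have hb := g1 ho.ne
    refine ⟨hb, ?_⟩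
    have hc := h.wind_coe hb
    rw [Real.Angle.coe_eq_zero_iff] at hc
    obtain ⟨m, hm⟩ := hc
    rw [zsmul_eq_mul, mul_comm] at hm
    have a1 := neg_pi_lt_ang (p k) (p (k + 1)) z
    have a2 := (ang_neg_iff (b := p (k + 1)) (by rintro rfl; exact hb (vertex_mem_bd p k))).2 ho
    rcases hκ with rfl | rfl
    · rw [two hm 0 (by push_cast; linarith) (by push_cast; linarith)]; push_cast; ring
    · rw [two hm (-1) (by push_cast; linarith) (by push_cast; linarith)]; push_cast; ring

end PerSimple
-- Cutting a polygon along a chord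
/-- The closed polygon enclosed by a periodic sequence. -/
def Cl (n : ℕ) (p : ℕ → ℂ) : Set ℂ := {z | z ∈ bd p ∨ wind n p z ≠ 0}

/-- The sequence that repeats the part of `p` with `L` terms from the index `i` on. -/
def loop (p : ℕ → ℂ) (i L : ℕ) : ℕ → ℂ := fun k => p (i + k % L)

section Loop

variable {n : ℕ} {p : ℕ → ℂ} {i L : ℕ}

theorem loop_of_lt {k : ℕ} (h : k < L) : loop p i L k = p (i + k) := by
  rw [loop, Nat.mod_eq_of_lt h]

theorem loop_self : loop p i L L = p i := by simp [loop]

theorem loop_cases (hL : 0 < L) (k : ℕ) :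
    (k % L + 1 < L ∧ loop p i L k = p (i + k % L) ∧ loop p i L (k + 1) = p (i + k % L + 1)) ∨
    (k % L + 1 = L ∧ loop p i L k = p (i + L - 1) ∧ loop p i L (k + 1) = p i) := by
  have := Nat.mod_lt k hL
  have e : (k + 1) % L = (k % L + 1) % L := by simp
  rcases lt_or_eq_of_le (show k % L + 1 ≤ L by omega) with h | h
  · refine Or.inl ⟨h, rfl, ?_⟩
    rw [loop, e, Nat.mod_eq_of_lt h, add_assoc]
  · refine Or.inr ⟨h, ?_, ?_⟩
    · rw [loop]; congr 1; omega
    · rw [loop, e, h, Nat.mod_self, add_zero]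

theorem PerSimple.loop (h : PerSimple n p) (hL : 3 ≤ L) (hLn : L ≤ n)
    (hd : Disjoint (openSegment ℝ (p (i + L - 1)) (p i)) (bd p)) : PerSimple L (loop p i L) := by
  have hv : ∀ j, p j ∉ openSegment ℝ (p (i + L - 1)) (p i) := fun j hj =>
    Set.disjoint_left.1 hd hj (vertex_mem_bd p j)
  have he : ∀ j, Disjoint (openSegment ℝ (p (i + L - 1)) (p i))
      (openSegment ℝ (p j) (p (j + 1))) := fun j =>
    hd.mono_right fun z hz => mem_bd.2 ⟨j, openSegment_subset_segment ℝ _ _ hz⟩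
  refine ⟨hL, fun k => by simp [Polygon.loop], fun a b e => ?_, fun a b => ?_, fun a b hab => ?_⟩
  · have ha := Nat.mod_lt a (show 0 < L by omega)
    have hb := Nat.mod_lt b (show 0 < L by omega)
    rw [Polygon.loop, Polygon.loop] at e
    rcases lt_trichotomy (a % L) (b % L) with hlt | heq | hlt
    · exact (h.inj' (by omega) (by omega) e).elim
    · exact heq
    · exact (h.inj' (by omega) (by omega) e.symm).elim
  · rcases loop_cases (p := p) (i := i) (show 0 < L by omega) a with ⟨-, e1, e2⟩ | ⟨-, e1, e2⟩
    · rw [e1, e2]; exact h.vert _ _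
    · rw [e1, e2]; exact hv _
  · rcases loop_cases (p := p) (i := i) (show 0 < L by omega) a with ⟨a1, e1, e2⟩ | ⟨a1, e1, e2⟩ <;>
    rcases loop_cases (p := p) (i := i) (show 0 < L by omega) b with ⟨b1, f1, f2⟩ | ⟨b1, f1, f2⟩
    · rw [e1, e2, f1, f2]
      refine h.disj _ _ fun hm => hab ?_
      rcases lt_trichotomy (a % L) (b % L) with hlt | heq | hlt
      · exact (PerSimple.not_modEq (by omega) (by omega) hm).elim
      · exact heq
      · exact (PerSimple.not_modEq (by omega) (by omega) hm.symm).elim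
    · rw [e1, e2, f1, f2]; exact (he _).symm
    · rw [e1, e2, f1, f2]; exact he _
    · exact (hab (show a % L = b % L by omega)).elim

theorem wind_loop (hL : 1 ≤ L) (z : ℂ) : wind L (loop p i L) z =
    sweep p i (i + L - 1) z + ang (p (i + L - 1)) (p i) z := by
  obtain ⟨m, rfl⟩ : ∃ m, L = m + 1 := ⟨L - 1, by omega⟩
  rw [wind, sweep, Finset.sum_Ico_succ_top (Nat.zero_le _), loop_self,
    loop_of_lt (Nat.lt_succ_self _), show i + (m + 1) - 1 = i + m by omega, sweep,
    Finset.sum_Ico_eq_sum_range _ i, show i + m - i = m by omega, Nat.Ico_zero_eq_range]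
  congr 1
  refine Finset.sum_congr rfl fun j hj => ?_
  rw [Finset.mem_range] at hj
  rw [loop_of_lt (by omega), loop_of_lt (by omega), add_assoc]

/-- Together the two loops traverse the polygon once and the chord in both directions. The two
angles of the chord cancel off the open chord and are `π` each on it. -/
theorem wind_add (h : PerSimple n p) {j : ℕ} (hij : i ≤ j) (hjn : j ≤ i + n) (z : ℂ) :
    wind n p z + (ang (p i) (p j) z + ang (p j) (p i) z) =
      wind (j - i + 1) (loop p i (j - i + 1)) z +
        wind (i + n - j + 1) (loop p j (i + n - j + 1)) z := by
  rw [wind_loop (by omega), wind_loop (by omega), show i + (j - i + 1) - 1 = j by omega,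
    show j + (i + n - j + 1) - 1 = i + n by omega, h.per i, ← h.sweep_period i z, sweep, sweep, sweep,
    ← Finset.sum_Ico_consecutive _ hij hjn]
  ring

theorem bd_loop_subset (hL : 0 < L) {z : ℂ} (hz : z ∈ bd (loop p i L)) :
    (∃ k, i ≤ k ∧ k + 1 < i + L ∧ z ∈ segment ℝ (p k) (p (k + 1))) ∨
      z ∈ segment ℝ (p (i + L - 1)) (p i) := by
  obtain ⟨k, hk⟩ := mem_bd.1 hz
  rcases loop_cases (p := p) (i := i) hL k with ⟨a, e1, e2⟩ | ⟨-, e1, e2⟩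
  · rw [e1, e2] at hk
    exact Or.inl ⟨i + k % L, by omega, by omega, hk⟩
  · rw [e1, e2] at hk; exact Or.inr hk

/-- On the edge itself, `wind` takes the value of the left-hand side, because the edge is seen there
under the angle `π`. -/
theorem PerSimple.wind_open (h : PerSimple n p) {κ : ℝ}
    (hs : ∀ k, ∀ x ∈ segment ℝ (p k) (p (k + 1)), PerSimple.edgeSweep n p k x = κ * Real.pi)
    {k : ℕ} {x : ℂ} (hx : x ∈ openSegment ℝ (p k) (p (k + 1))) : wind n p x = (κ + 1) * Real.pi := by
  have h3 := h.three
  rw [h.wind_eq k, ang_of_mem_openSegment (h.inj' (Nat.lt_succ_self k) (by omega)) hx,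
    ← h.edgeSweep_eq hx, hs k x (openSegment_subset_segment ℝ _ _ hx)]
  ring

end Loop

/-! ### Polygons as periodic sequences -/

section Bridge

variable {M : ℕ}

/-- The vertices of a polygon, repeated periodically. -/
def toPer (P : Polygon ℂ (M + 1)) : ℕ → ℂ := fun k => P (Fin.ofNat (M + 1) k)

theorem finRotate_ofNat (k : ℕ) :
    finRotate (M + 1) (Fin.ofNat (M + 1) k) = Fin.ofNat (M + 1) (k + 1) := by
  rw [finRotate_apply]
  ext
  simp [Fin.val_add]

theorem ofNat_val (i : Fin (M + 1)) : Fin.ofNat (M + 1) (i : ℕ) = i := by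
  ext; simp

theorem toPer_val (P : Polygon ℂ (M + 1)) (i : Fin (M + 1)) : toPer P i = P i := by
  rw [toPer, ofNat_val]

theorem perSimple_toPer {P : Polygon ℂ (M + 1)} (h : P.IsSimple) : PerSimple (M + 1) (toPer P) := by
  obtain ⟨h1, h2, h3, h4⟩ := (isSimple_iff P).1 h
  refine ⟨h1, fun i => ?_, fun i j e => ?_, fun i j => ?_, fun i j hij => ?_⟩
  · rw [toPer, toPer]; congr 1; ext; simp
  · have := congrArg Fin.val (h2 e)
    exact (by simpa using this : i % (M + 1) = j % (M + 1))
  · rw [toPer, toPer, toPer, ← finRotate_ofNat]; exact h3 _ _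
  · rw [toPer, toPer, toPer, toPer, ← finRotate_ofNat, ← finRotate_ofNat]
    refine h4 _ _ fun e => hij ?_
    have := congrArg Fin.val e
    exact (by simpa using this : i % (M + 1) = j % (M + 1))

theorem bd_toPer (P : Polygon ℂ (M + 1)) : bd (toPer P) = P.boundary ℝ := by
  rw [boundary_eq]
  ext z
  rw [mem_bd, Set.mem_iUnion]
  constructor
  · rintro ⟨i, hi⟩
    exact ⟨_, by rw [finRotate_ofNat]; exact hi⟩
  · rintro ⟨i, hi⟩
    exact ⟨i, by rwa [toPer_val, toPer, ← finRotate_ofNat, ofNat_val]⟩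

theorem wind_toPer (P : Polygon ℂ (M + 1)) (z : ℂ) :
    wind (M + 1) (toPer P) z = 2 * Real.pi * P.windingNumber z := by
  rw [windingNumber, mul_div_cancel₀ _ (by positivity), wind, sweep, Nat.Ico_zero_eq_range,
    Finset.sum_range]
  refine Finset.sum_congr rfl fun i _ => ?_
  rw [ang, toPer_val, toPer, ← finRotate_ofNat, ofNat_val]

theorem closedRegion_eq_Cl (P : Polygon ℂ (M + 1)) : P.closedRegion = Cl (M + 1) (toPer P) := by
  ext z
  rw [closedRegion, openRegion, Cl, bd_toPer, Set.mem_union, Set.mem_ofPred_eq, Set.mem_ofPred_eq,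
    wind_toPer]
  have : 2 * Real.pi * P.windingNumber z ≠ 0 ↔ P.windingNumber z ≠ 0 := by
    simp [Real.pi_ne_zero]
  rw [this]
  tauto

end Bridge
-- The triangulation of a deflated polygon
/-- A counter-clockwise deflated polygon with the counter-clockwise vertex triples `T` of the
triangles of a triangulation. -/
structure Deflated (n : ℕ) (p : ℕ → ℂ) (T : ℕ → ℕ → ℕ → Prop) : Prop extends PerSimple n p where
  left : ∀ k, ∀ x ∈ segment ℝ (p k) (p (k + 1)), PerSimple.edgeSweep n p k x = Real.pi
  lt : ∀ a b c, T a b c → a < n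
  rot : ∀ a b c, T a b c → T b c a
  pos : ∀ a b c, T a b c → 0 < orient (p a) (p b) (p c)
  cover : Cl n p = region T p
  disjoint : ∀ a b c a' b' c', T a b c → T a' b' c' → ({a, b, c} : Finset ℕ) ≠ {a', b', c'} →
    Disjoint (interior (lhull p {a, b, c})) (interior (lhull p {a', b', c'}))
  defl : ∀ i j k l, i < n → j < n → k < n → l < n → i ≠ j → k ≠ l →
    segment ℝ (p i) (p j) ⊆ Cl n p → segment ℝ (p k) (p l) ⊆ Cl n p → s(i, j) ≠ s(k, l) →
    Disjoint (openSegment ℝ (p i) (p j)) (openSegment ℝ (p k) (p l))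

theorem orient_add_perp (a b z : ℂ) (s : ℝ) :
    orient a b (z + s * (Complex.I * (b - a))) = orient a b z + s * Complex.normSq (b - a) := by
  simp only [orient, Complex.normSq_apply, Complex.sub_re, Complex.sub_im, Complex.add_re,
    Complex.add_im, Complex.mul_re, Complex.mul_im, Complex.ofReal_re, Complex.ofReal_im,
    Complex.I_re, Complex.I_im]
  ring

theorem tendsto_add_smul (z w : ℂ) :
    Tendsto (fun s : ℝ => z + s * w) (𝓝[>] 0) (𝓝 z) := by
  have : Continuous fun s : ℝ => z + s * w := by fun_prop
  have h := this.tendsto 0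
  simp only [Complex.ofReal_zero, zero_mul, add_zero] at h
  exact h.mono_left nhdsWithin_le_nhds

namespace Deflated

variable {n : ℕ} {p : ℕ → ℂ} {T : ℕ → ℕ → ℕ → Prop}

theorem lts (h : Deflated n p T) {a b c : ℕ} (ht : T a b c) : a < n ∧ b < n ∧ c < n :=
  ⟨h.lt _ _ _ ht, h.lt _ _ _ (h.rot _ _ _ ht), h.lt _ _ _ (h.rot _ _ _ (h.rot _ _ _ ht))⟩

theorem nes (h : Deflated n p T) {a b c : ℕ} (ht : T a b c) : a ≠ b ∧ b ≠ c ∧ c ≠ a := by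
  have := h.pos _ _ _ ht
  refine ⟨?_, ?_, ?_⟩ <;> rintro rfl
  · simp [orient] at this
  · rw [orient_self_right] at this; exact lt_irrefl _ this
  · rw [orient_self_left] at this; exact lt_irrefl _ this

theorem inj_lt (h : Deflated n p T) {i j : ℕ} (hi : i < n) (hj : j < n) (e : p i = p j) : i = j :=
  Nat.ModEq.eq_of_lt_of_lt (h.inj i j e) hi hj

theorem hull_subset (h : Deflated n p T) {a b c : ℕ} (ht : T a b c) :
    lhull p {a, b, c} ⊆ Cl n p := by
  rw [h.cover]; exact subset_region ht

theorem side_subset (h : Deflated n p T) {a b c x y : ℕ} (ht : T a b c)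
    (hx : x ∈ ({a, b, c} : Finset ℕ)) (hy : y ∈ ({a, b, c} : Finset ℕ)) :
    segment ℝ (p x) (p y) ⊆ Cl n p := (segment_subset_lhull hx hy).trans (h.hull_subset ht)

theorem edge_subset (n : ℕ) (p : ℕ → ℂ) (k : ℕ) : segment ℝ (p k) (p (k + 1)) ⊆ Cl n p :=
  fun _ hz => Or.inl (mem_bd.2 ⟨k, hz⟩)

/-- No vertex lies on an open visible segment. -/
theorem vertex_notMem (h : Deflated n p T) {i j k : ℕ} (hi : i < n) (hj : j < n) (hk : k < n)
    (hij : i ≠ j) (hv : segment ℝ (p i) (p j) ⊆ Cl n p) : p k ∉ openSegment ℝ (p i) (p j) := by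
  intro hm
  have hne : p i ≠ p j := fun e => hij (h.inj_lt hi hj e)
  have hki : i ≠ k := by rintro rfl; exact left_notMem_openSegment hne hm
  have hkj : k ≠ j := by rintro rfl; exact right_notMem_openSegment hne hm
  have hms := openSegment_subset_segment ℝ _ _ hm
  -- Otherwise the visible segments from `i` to `k` and from `i` to `j` would overlap.
  have := h.defl i k i j hi hk hi hj hki hij
    (((convex_segment _ _).segment_subset (left_mem_segment ℝ _ _) hms).trans hv) hv
    (by rw [Ne, Sym2.eq_iff]; rintro (⟨-, e⟩ | ⟨-, e⟩); exacts [hkj e, hki e.symm])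
  have hmid : midpoint ℝ (p i) (p k) ∈ openSegment ℝ (p i) (p k) :=
    ⟨1 / 2, 1 / 2, by norm_num, by norm_num, by norm_num, by
      rw [midpoint_eq_smul_add, ← smul_add]; norm_num⟩
  refine Set.disjoint_left.1 this hmid ?_
  obtain ⟨s, t, hs, ht, hst, e⟩ := hm
  obtain ⟨s', t', hs', ht', hst', e'⟩ := hmid
  refine ⟨s' + t' * s, t' * t, by positivity, by positivity, ?_, ?_⟩
  · rw [add_assoc, ← mul_add, hst, mul_one, hst']
  · rw [← e', ← e, smul_add, smul_smul, smul_smul, add_smul, add_assoc]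

theorem mod_vertex (h : Deflated n p T) (k : ℕ) : p (k % n) = p k :=
  Function.Periodic.map_mod_nat h.per k

/-- Points just to the right of an edge have winding number zero, so no neighbourhood of a point of
an open edge lies in the polygon; a vertex is a limit of such points. -/
theorem interior_disjoint_bd (h : Deflated n p T) {a b c : ℕ} (ht : T a b c) :
    Disjoint (interior (lhull p {a, b, c})) (bd p) := by
  have h3 := h.three
  have main : ∀ k, ∀ z ∈ openSegment ℝ (p k) (p (k + 1)), z ∉ interior (lhull p {a, b, c}) := by
    intro k z hz hi
    have hne : p k ≠ p (k + 1) := h.inj' (Nat.lt_succ_self k) (by omega)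
    have e1 := tendsto_add_smul z (Complex.I * (p k - p (k + 1)))
    have e2 := e1.eventually (h.eventually_wind (Or.inl rfl) (by simpa using h.left) hz)
    have e3 := e1.eventually (isOpen_interior.mem_nhds hi)
    obtain ⟨s, ⟨⟨-, g2⟩, g3⟩, hs⟩ := ((e2.and e3).and self_mem_nhdsWithin).exists
    have hs : 0 < s := hs
    have hor : orient (p k) (p (k + 1)) (z + s * (Complex.I * (p k - p (k + 1)))) < 0 := by
      rw [orient_swap', orient_add_perp, orient_swap',
        orient_eq_zero_of_mem_segment (openSegment_subset_segment ℝ _ _ hz)]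
      have := Complex.normSq_pos.2 (sub_ne_zero.2 hne)
      have := mul_pos hs this
      linarith
    obtain ⟨q1, q2⟩ := g2 hor
    rcases h.hull_subset ht (interior_subset g3) with q | q
    · exact q1 q
    · exact q (by rw [q2]; ring)
  rw [Set.disjoint_left]
  intro z hi hz
  obtain ⟨k, hk⟩ := mem_bd.1 hz
  have hv : ∀ k, p k ∉ interior (lhull p {a, b, c}) := by
    intro k hi
    have e1 := tendsto_add_smul (p k) (p (k + 1) - p k)
    have e3 := e1.eventually (isOpen_interior.mem_nhds hi)
    have e4 : ∀ᶠ s : ℝ in 𝓝[>] 0, s < 1 :=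
      nhdsWithin_le_nhds (gt_mem_nhds (by norm_num : (0 : ℝ) < 1))
    obtain ⟨s, ⟨g3, g4⟩, hs⟩ := ((e3.and e4).and self_mem_nhdsWithin).exists
    have hs : 0 < s := hs
    refine main k _ ⟨1 - s, s, by linarith, hs, by ring, ?_⟩ g3
    rw [Complex.real_smul, Complex.real_smul]; push_cast; ring
  rw [← insert_endpoints_openSegment] at hk
  rcases hk with rfl | rfl | hk
  · exact hv _ hi
  · exact hv _ hi
  · exact main _ _ hk hi

theorem exists_side (h : Deflated n p T) {a b c : ℕ} (ht : T a b c) {z : ℂ}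
    (hz : z ∈ lhull p {a, b, c}) (hi : z ∉ interior (lhull p {a, b, c})) :
    ∃ x ∈ ({a, b, c} : Finset ℕ), ∃ y ∈ ({a, b, c} : Finset ℕ), x ≠ y ∧
      (z = p x ∨ z ∈ openSegment ℝ (p x) (p y)) := by
  have hp := h.pos _ _ _ ht
  obtain ⟨n1, n2, n3⟩ := h.nes ht
  have main : ∀ {a b : ℕ}, a ≠ b → z ∈ segment ℝ (p a) (p b) → ∃ x ∈ ({a, b} : Finset ℕ),
      ∃ y ∈ ({a, b} : Finset ℕ), x ≠ y ∧ (z = p x ∨ z ∈ openSegment ℝ (p x) (p y)) := by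
    intro a b hab hz
    rw [← insert_endpoints_openSegment] at hz
    rcases hz with rfl | rfl | hz
    · exact ⟨a, by simp, b, by simp, hab, Or.inl rfl⟩
    · exact ⟨b, by simp, a, by simp, hab.symm, Or.inl rfl⟩
    · exact ⟨a, by simp, b, by simp, hab, Or.inr hz⟩
  have lift : ∀ {a' b' : ℕ}, a' ≠ b' → ({a', b'} : Finset ℕ) ⊆ {a, b, c} →
      z ∈ segment ℝ (p a') (p b') → ∃ x ∈ ({a, b, c} : Finset ℕ),
      ∃ y ∈ ({a, b, c} : Finset ℕ), x ≠ y ∧ (z = p x ∨ z ∈ openSegment ℝ (p x) (p y)) := by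
    intro a' b' hab hs hz
    obtain ⟨x, hx, y, hy, r⟩ := main hab hz
    exact ⟨x, hs hx, y, hs hy, r⟩
  rw [lhull_triple] at hz hi
  rw [mem_interior_triangle hp] at hi
  obtain ⟨g1, g2, g3⟩ := (mem_triangle hp).1 hz
  by_cases e1 : orient (p a) (p b) z = 0
  · exact lift n1 (by intro y; simp; tauto) (mem_segment_of_orient hp hz e1)
  by_cases e2 : orient (p b) (p c) z = 0
  · refine lift n2 (by intro y; simp; tauto) (mem_segment_of_orient (c := p a) ?_ ?_ e2)
    · rwa [← orient_rot]
    · rwa [show ({p b, p c, p a} : Set ℂ) = {p a, p b, p c} by ext; simp; tauto]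
  · refine lift n3 (by intro y; simp; tauto) (mem_segment_of_orient (c := p b) ?_ ?_ ?_)
    · rwa [orient_rot]
    · rwa [show ({p c, p a, p b} : Set ℂ) = {p a, p b, p c} by ext; simp; tauto]
    · by_contra e3
      exact hi ⟨lt_of_le_of_ne g1 (Ne.symm e1), lt_of_le_of_ne g2 (Ne.symm e2),
        lt_of_le_of_ne g3 (Ne.symm e3)⟩

/-- An open visible segment meets only the triangles that it is a side of. -/
theorem ends_mem (h : Deflated n p T) {i j a b c : ℕ} (hi : i < n) (hj : j < n) (hij : i ≠ j)
    (hv : segment ℝ (p i) (p j) ⊆ Cl n p) (ht : T a b c) {z : ℂ}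
    (hz : z ∈ openSegment ℝ (p i) (p j)) (hm : z ∈ lhull p {a, b, c}) :
    i ∈ ({a, b, c} : Finset ℕ) ∧ j ∈ ({a, b, c} : Finset ℕ) := by
  have hlt : ∀ x ∈ ({a, b, c} : Finset ℕ), x < n := by
    obtain ⟨l1, l2, l3⟩ := h.lts ht
    intro x hx
    simp only [Finset.mem_insert, Finset.mem_singleton] at hx
    rcases hx with rfl | rfl | rfl <;> assumption
  -- A frontier point that is not a vertex lies on an open side, which is visible, and crossing
  -- visible segments must coincide.
  have front : ∀ z ∈ openSegment ℝ (p i) (p j), z ∈ lhull p {a, b, c} →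
      z ∉ interior (lhull p {a, b, c}) → i ∈ ({a, b, c} : Finset ℕ) ∧ j ∈ ({a, b, c} : Finset ℕ) := by
    intro z hz hm hint
    obtain ⟨x, hx, y, hy, hxy, rfl | hs⟩ := h.exists_side ht hm hint
    · exact (h.vertex_notMem hi hj (hlt x hx) hij hv hz).elim
    · by_contra hcon
      refine Set.disjoint_left.1 (h.defl i j x y hi hj (hlt x hx) (hlt y hy) hij hxy hv
        (h.side_subset ht hx hy) fun e => hcon ?_) hz hs
      rw [Sym2.eq_iff] at e
      rcases e with ⟨rfl, rfl⟩ | ⟨rfl, rfl⟩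
      · exact ⟨hx, hy⟩
      · exact ⟨hy, hx⟩
  by_cases hint : z ∈ interior (lhull p {a, b, c})
  · by_contra hcon
    -- From the interior point `z` walk towards the end `p e`. It is not an interior point, so the
    -- walk meets the frontier, either in `p e` or in a point to which `front` applies.
    have key : ∀ e < n, p e ∈ segment ℝ (p i) (p j) → e ∈ ({a, b, c} : Finset ℕ) := by
      intro e he hes
      have hzs := openSegment_subset_segment ℝ _ _ hz
      have hpe : p e ∉ interior (lhull p {a, b, c}) := fun hh =>
        Set.disjoint_left.1 (h.interior_disjoint_bd ht) hh (vertex_mem_bd p e)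
      obtain ⟨y, hy, hyf⟩ : (segment ℝ z (p e) ∩ frontier (lhull p {a, b, c})).Nonempty := by
        by_contra hemp
        rw [Set.not_nonempty_iff_eq_empty] at hemp
        have := (convex_segment (𝕜 := ℝ) z (p e)).isPreconnected
        rw [isPreconnected_iff_subset_of_disjoint] at this
        have c1 : segment ℝ z (p e) ⊆ interior (lhull p {a, b, c}) ∪ (lhull p {a, b, c})ᶜ := by
          intro w hw
          by_contra hcon
          rw [Set.mem_union, not_or, Set.mem_compl_iff, not_not] at hcon
          have : w ∈ segment ℝ z (p e) ∩ frontier (lhull p {a, b, c}) :=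
            ⟨hw, subset_closure hcon.2, hcon.1⟩
          rw [hemp] at this; exact this
        have c2 : segment ℝ z (p e) ∩
            (interior (lhull p {a, b, c}) ∩ (lhull p {a, b, c})ᶜ) = ∅ := by
          ext w
          simp only [Set.mem_inter_iff, Set.mem_compl_iff, Set.mem_empty_iff_false, iff_false]
          rintro ⟨-, g1, g2⟩
          exact g2 (interior_subset g1)
        rcases this _ _ isOpen_interior (isClosed_lhull _ _).isOpen_compl c1 c2 with g | g
        · exact hpe (g (right_mem_segment ℝ _ _))
        · exact g (left_mem_segment ℝ _ _) hm
      have hyc : y ∈ lhull p {a, b, c} := by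
        have := hyf.1; rwa [(isClosed_lhull _ _).closure_eq] at this
      have hys : y ∈ segment ℝ (p i) (p j) := (convex_segment _ _).segment_subset hzs hes hy
      rw [← insert_endpoints_openSegment] at hys
      have atv : ∀ e' < n, y = p e' → e' ∈ ({a, b, c} : Finset ℕ) := by
        rintro e' he' rfl
        obtain ⟨x, hx, x', hx', hxx, g | g⟩ := h.exists_side ht hyc hyf.2
        · rw [h.inj_lt he' (hlt x hx) g]; exact hx
        · exact (h.vertex_notMem (hlt x hx) (hlt x' hx') he' hxx (h.side_subset ht hx hx') g).elim
      by_cases hye : y = p e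
      · exact atv e he hye
      · exfalso
        have hyo : y ∈ openSegment ℝ (p i) (p j) := by
          obtain ⟨s, t, hs, ht, hst, e1⟩ := hy
          have hs0 : 0 < s := by
            rcases hs.lt_or_eq with g | g
            · exact g
            · subst g
              obtain rfl : t = 1 := by linarith
              exact (hye (by rw [← e1]; simp)).elim
          obtain ⟨s1, t1, hs1, ht1, hst1, e2⟩ := hz
          obtain ⟨s2, t2, hs2, ht2, hst2, e3⟩ := hes
          refine ⟨s * s1 + t * s2, s * t1 + t * t2, by positivity, by positivity, ?_, ?_⟩
          · have : s * s1 + t * s2 + (s * t1 + t * t2) = s * (s1 + t1) + t * (s2 + t2) := by ring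
            rw [this, hst1, hst2, mul_one, mul_one, hst]
          · rw [← e1, ← e2, ← e3]
            simp only [Complex.real_smul]; push_cast; ring
        exact hcon (front y hyo hyc hyf.2)
    exact hcon ⟨key i hi (left_mem_segment ℝ _ _), key j hj (right_mem_segment ℝ _ _)⟩
  · exact front z hz hm hint

/-- On a side of a visible segment that belongs to the polygon there is a triangle. -/
theorem exists_left (h : Deflated n p T) {i j : ℕ} (hi : i < n) (hj : j < n) (hij : i ≠ j)
    (hv : segment ℝ (p i) (p j) ⊆ Cl n p) {m : ℂ} (hm : m ∈ openSegment ℝ (p i) (p j))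
    (hs : ∀ᶠ s : ℝ in 𝓝[>] 0, m + s * (Complex.I * (p j - p i)) ∈ Cl n p) : ∃ c, T i j c := by
  -- Finitely many triangles cover the points just to the left of `m`, so one of them contains such
  -- points arbitrarily close to `m`, and `m` as well.
  obtain ⟨a, ha, b, hb, c, hc, hf⟩ : ∃ a ∈ Finset.range n, ∃ b ∈ Finset.range n,
      ∃ c ∈ Finset.range n, ∃ᶠ s : ℝ in 𝓝[>] 0,
        T a b c ∧ m + s * (Complex.I * (p j - p i)) ∈ lhull p {a, b, c} := by
    by_contra hcon
    push Not at hcon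
    have : ∀ᶠ s : ℝ in 𝓝[>] 0, ∀ a ∈ Finset.range n, ∀ b ∈ Finset.range n, ∀ c ∈ Finset.range n,
        ¬ (T a b c ∧ m + s * (Complex.I * (p j - p i)) ∈ lhull p {a, b, c}) := by
      rw [Filter.eventually_all_finset]; intro a ha
      rw [Filter.eventually_all_finset]; intro b hb
      rw [Filter.eventually_all_finset]; intro c hc
      have := hcon a ha b hb c hc
      filter_upwards [this] with s hs hs'
      exact hs hs'.1 hs'.2
    obtain ⟨s, g1, g2⟩ := (hs.and this).exists
    rw [h.cover] at g1
    obtain ⟨a, b, c, ht, hz⟩ := g1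
    obtain ⟨l1, l2, l3⟩ := h.lts ht
    exact g2 a (Finset.mem_range.2 l1) b (Finset.mem_range.2 l2) c (Finset.mem_range.2 l3) ⟨ht, hz⟩
  have ht : T a b c := hf.exists.choose_spec.1
  have hmem : m ∈ lhull p {a, b, c} := by
    by_contra hno
    have := (tendsto_add_smul m (Complex.I * (p j - p i))).eventually
      ((isClosed_lhull p {a, b, c}).isOpen_compl.mem_nhds hno)
    obtain ⟨s, g1, g2⟩ := (hf.and_eventually this).exists
    exact g2 g1.2
  obtain ⟨mi, mj⟩ := h.ends_mem hi hj hij hv ht hm hmem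
  have hrot := h.rot _ _ _ ht
  have hrot' := h.rot _ _ _ hrot
  -- A triangle on the right-hand side of `i j` contains no points to the left of it.
  have hneg : ∀ x, T j i x → ({j, i, x} : Finset ℕ) = {a, b, c} → False := by
    intro x hx he
    obtain ⟨s, ⟨-, g1⟩, g2⟩ := (hf.and_eventually self_mem_nhdsWithin).exists
    have g2 : 0 < s := g2
    rw [← he, lhull_triple, mem_triangle (h.pos _ _ _ hx)] at g1
    have g3 := g1.1
    rw [orient_swap', orient_add_perp,
      orient_eq_zero_of_mem_segment (openSegment_subset_segment ℝ _ _ hm)] at g3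
    have : p i ≠ p j := fun e => hij (h.inj_lt hi hj e)
    have := mul_pos g2 (Complex.normSq_pos.2 (sub_ne_zero.2 this.symm))
    linarith
  simp only [Finset.mem_insert, Finset.mem_singleton] at mi mj
  rcases mi with rfl | rfl | rfl <;> rcases mj with rfl | rfl | rfl
  all_goals first
    | exact (hij rfl).elim
    | exact ⟨_, ht⟩
    | exact ⟨_, hrot⟩
    | exact ⟨_, hrot'⟩
    | exact (hneg _ ht (by ext; simp)).elim
    | exact (hneg _ hrot (by ext; simp; tauto)).elim
    | exact (hneg _ hrot' (by ext; simp; tauto)).elim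

end Deflated
namespace Deflated

variable {n : ℕ} {p : ℕ → ℂ} {T : ℕ → ℕ → ℕ → Prop}

theorem chord_disjoint (h : Deflated n p T) {i j : ℕ} (hij : i + 2 ≤ j) (hj : j < n)
    (hne : ¬ (i = 0 ∧ j = n - 1)) (hv : segment ℝ (p i) (p j) ⊆ Cl n p) :
    Disjoint (openSegment ℝ (p i) (p j)) (bd p) := by
  have h3 := h.three
  rw [Set.disjoint_left]
  intro z hz hb
  obtain ⟨k, hk⟩ := mem_bd.1 hb
  have m1 := Nat.mod_lt k (show 0 < n by omega)
  have m2 := Nat.mod_lt (k + 1) (show 0 < n by omega)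
  have e : (k + 1) % n = (k % n + 1) % n := by simp
  have e' : (k + 1) % n = k % n + 1 ∨ (k % n = n - 1 ∧ (k + 1) % n = 0) := by
    rcases lt_or_eq_of_le (show k % n + 1 ≤ n by omega) with g | g
    · left; rw [e, Nat.mod_eq_of_lt g]
    · right; refine ⟨by omega, ?_⟩; rw [e, g, Nat.mod_self]
  have hv2 := edge_subset n p k
  rw [← h.mod_vertex k, ← h.mod_vertex (k + 1)] at hk hv2
  rw [← insert_endpoints_openSegment] at hk
  rcases hk with rfl | rfl | hk
  · exact h.vertex_notMem (by omega) hj m1 (by omega) hv hz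
  · exact h.vertex_notMem (by omega) hj m2 (by omega) hv hz
  · refine Set.disjoint_left.1 (h.defl i j _ _ (by omega) hj m1 m2 (by omega) (by omega) hv hv2 ?_)
      hz hk
    rw [Ne, Sym2.eq_iff]
    omega

/-- The triangle on the left-hand side of a chord has its apex on the part of the boundary that is
cut off there. -/
theorem exists_apex (h : Deflated n p T) {i j : ℕ} (hij : i + 2 ≤ j) (hj : j < n)
    (hne : ¬ (i = 0 ∧ j = n - 1)) (hv : segment ℝ (p i) (p j) ⊆ Cl n p) :
    ∃ c, i < c ∧ c < j ∧ T j i c := by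
  have h3 := h.three
  have hpi := Real.pi_pos
  have hd := h.chord_disjoint hij hj hne hv
  have hpne : p i ≠ p j := fun e => by have := h.inj_lt (by omega) hj e; omega
  have hper := h.per i
  have hA : PerSimple (j - i + 1) (loop p i (j - i + 1)) := by
    refine h.toPerSimple.loop (by omega) (by omega) ?_
    rwa [show i + (j - i + 1) - 1 = j by omega, openSegment_symm]
  have hB : PerSimple (i + n - j + 1) (loop p j (i + n - j + 1)) := by
    refine h.toPerSimple.loop (by omega) (by omega) ?_
    rwa [show j + (i + n - j + 1) - 1 = i + n by omega, hper]
  have a1 : loop p i (j - i + 1) (j - i) = p j := by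
    rw [loop_of_lt (by omega)]; congr 1; omega
  have a2 : loop p i (j - i + 1) (j - i + 1) = p i := loop_self
  have b1 : loop p j (i + n - j + 1) (i + n - j) = p i := by
    rw [loop_of_lt (by omega), show j + (i + n - j) = i + n by omega, hper]
  have b2 : loop p j (i + n - j + 1) (i + n - j + 1) = p j := loop_self
  -- The chord closes the boundary from `i` to `j` to a loop `A`, and that from `j` on to `i` to a
  -- loop `B`.
  obtain ⟨κA, hκA, hsA⟩ := hA.edgeSweep_sign
  obtain ⟨κB, hκB, hsB⟩ := hB.edgeSweep_sign
  obtain ⟨m, hm⟩ : (openSegment ℝ (p i) (p j)).Nonempty :=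
    ⟨_, 1 / 2, 1 / 2, by norm_num, by norm_num, by norm_num, rfl⟩
  have hm' : m ∈ openSegment ℝ (p j) (p i) := by rwa [openSegment_symm]
  have hmA : wind _ (loop p i (j - i + 1)) m = (κA + 1) * Real.pi :=
    hA.wind_open hsA (k := j - i) (by rw [a1, a2]; exact hm')
  have hmB : wind _ (loop p j (i + n - j + 1)) m = (κB + 1) * Real.pi :=
    hB.wind_open hsB (k := i + n - j) (by rw [b1, b2]; exact hm)
  have hmb : m ∉ bd p := Set.disjoint_left.1 hd hm
  have hm0 : wind n p m ≠ 0 := (hv (openSegment_subset_segment ℝ _ _ hm)).resolve_left hmb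
  have hmad := wind_add h.toPerSimple (i := i) (j := j) (by omega) (by omega) m
  rw [hmA, hmB, ang_of_mem_openSegment hpne hm, ang_of_mem_openSegment hpne.symm hm'] at hmad
  -- At the point `m` of the chord the polygon has winding value `(κA + κB) π`, which is nonzero
  -- because `m` is inside: the two loops have the same orientation.
  have hκ : κA + κB ≠ 0 := fun e => hm0 (by
    have : wind n p m = (κA + κB) * Real.pi := by linarith
    rw [this, e, zero_mul])
  obtain ⟨c, hc⟩ := h.exists_left hj (by omega) (by omega) (by rwa [segment_symm]) hm'
    (by
      filter_upwards [(tendsto_add_smul m (Complex.I * (p i - p j))).eventually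
        ((PerSimple.continuousAt_wind (n := n) hmb).eventually_ne hm0)] with s hs using Or.inr hs)
  obtain ⟨-, n2, n3⟩ := h.nes hc
  have hcn := (h.lts hc).2.2
  have hD := h.pos _ _ _ hc
  by_cases hin : i < c ∧ c < j
  · exact ⟨c, hin.1, hin.2, hc⟩
  exfalso
  -- Otherwise the apex belongs to the loop `B`; `c'` is its index in the range from `j` to `i + n`.
  obtain ⟨c', hc1, hc2, hcc⟩ : ∃ c', j < c' ∧ c' < i + n ∧ p c' = p c := by
    rcases lt_or_ge j c with g | g
    · exact ⟨c, g, by omega, rfl⟩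
    · exact ⟨c + n, by omega, by omega, h.per c⟩
  have hor : ∀ u : ℝ, orient (p j) (p i) ((1 - u) • m + u • p c) =
      u * orient (p j) (p i) (p c) := fun u => by
    rw [orient_combo _ _ _ _ (by ring),
      orient_eq_zero_of_mem_segment (openSegment_subset_segment ℝ _ _ hm')]; ring
  have hbdA : ∀ {z}, z ∈ bd (loop p i (j - i + 1)) →
      (∃ k, i ≤ k ∧ k < j ∧ z ∈ segment ℝ (p k) (p (k + 1))) ∨ z ∈ segment ℝ (p j) (p i) := by
    intro z hz
    rcases bd_loop_subset (by omega) hz with ⟨k, k1, k2, hk⟩ | hk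
    · exact Or.inl ⟨k, k1, by omega, hk⟩
    · rw [show i + (j - i + 1) - 1 = j by omega] at hk; exact Or.inr hk
  -- Just to the left of the chord from `j` to `i`, the loop `A` has the winding value `(κA + 1) π`.
  -- This value is now carried through the triangle to `p c`, and then along a polygon edge of `B`
  -- to a point `x`, without meeting `A`.
  obtain ⟨u, hu0, hu1, hu⟩ : ∃ u : ℝ, 0 < u ∧ u < 1 ∧
      wind _ (loop p i (j - i + 1)) ((1 - u) • m + u • p c) = (κA + 1) * Real.pi := by
    have e1 := (tendsto_add_smul m (p c - m)).eventually
      (hA.eventually_wind hκA hsA (k := j - i) (by rw [a1, a2]; exact hm'))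
    have e4 : ∀ᶠ s : ℝ in 𝓝[>] 0, s < 1 :=
      nhdsWithin_le_nhds (gt_mem_nhds (by norm_num : (0 : ℝ) < 1))
    obtain ⟨s, ⟨⟨g1, -⟩, g2⟩, g3⟩ := ((e1.and e4).and self_mem_nhdsWithin).exists
    have g3 : 0 < s := g3
    have e : m + s * (p c - m) = (1 - s) • m + s • p c := by
      rw [Complex.real_smul, Complex.real_smul]; push_cast; ring
    rw [e, a1, a2, hor] at g1
    exact ⟨s, g3, g2, (g1 (by positivity)).2⟩
  have hcA : p c ∉ bd (loop p i (j - i + 1)) := by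
    intro hz
    rcases hbdA hz with ⟨k, k1, k2, hk⟩ | hk
    · rw [← hcc] at hk
      exact h.notMem_edge (by omega) (by omega) hk
    · rw [orient_eq_zero_of_mem_segment hk] at hD; exact lt_irrefl _ hD
  have hS1 : Disjoint (segment ℝ ((1 - u) • m + u • p c) (p c)) (bd (loop p i (j - i + 1))) := by
    rw [Set.disjoint_left]
    intro z hz hb
    obtain ⟨v, hv0, hv1, rfl⟩ : ∃ v : ℝ, 0 < v ∧ v ≤ 1 ∧ z = (1 - v) • m + v • p c := by
      obtain ⟨s, t, hs, ht, hst, rfl⟩ := hz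
      refine ⟨s * u + t, ?_, ?_, ?_⟩
      · rcases ht.eq_or_lt with g | g
        · have : s = 1 := by linarith
          rw [this, ← g]; linarith
        · have := mul_nonneg hs hu0.le; linarith
      · nlinarith
      · obtain rfl : s = 1 - t := by linarith
        simp only [Complex.real_smul]; push_cast; ring
    rcases hv1.eq_or_lt with rfl | hv1
    · simp only [sub_self, zero_smul, one_smul, zero_add] at hb
      exact hcA hb
    · rcases hbdA hb with ⟨k, k1, k2, hk⟩ | hk
      · refine Set.disjoint_left.1 (h.interior_disjoint_bd hc) ?_ (mem_bd.2 ⟨k, hk⟩)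
        obtain ⟨s, t, hs, ht, hst, hme⟩ := hm'
        rw [lhull_triple, mem_interior_triangle hD, hor,
          orient_combo _ _ _ _ (by ring), orient_combo _ _ _ _ (by ring), orient_self_right,
          orient_self_left, ← hme, orient_combo _ _ _ _ hst, orient_combo _ _ _ _ hst,
          orient_self_left, orient_self_right, ← orient_rot (p j) (p i), orient_rot (p c) (p j)]
        refine ⟨by positivity, ?_, ?_⟩
        · have : 0 < (1 - v) * (s * orient (p j) (p i) (p c)) := by
            have : 0 < 1 - v := by linarith
            positivity
          linarith
        · have : 0 < (1 - v) * (t * orient (p j) (p i) (p c)) := by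
            have : 0 < 1 - v := by linarith
            positivity
          linarith
      · have := orient_eq_zero_of_mem_segment hk
        rw [hor] at this
        have := mul_pos hv0 hD
        linarith
  have w1 := hA.wind_const (convex_segment (𝕜 := ℝ) _ _).isPreconnected hS1
    (left_mem_segment ℝ _ _) (right_mem_segment ℝ _ _)
  obtain ⟨x, hx⟩ : (openSegment ℝ (p c') (p (c' + 1))).Nonempty :=
    ⟨_, 1 / 2, 1 / 2, by norm_num, by norm_num, by norm_num, rfl⟩
  have hxo : ∀ z ∈ openSegment ℝ (p c') (p (c' + 1)), z ∉ segment ℝ (p j) (p i) := by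
    intro z hz hk
    rw [← insert_endpoints_openSegment] at hk
    rcases hk with hk | hk | hk
    · exact h.ne_vertex_of_open hz _ hk
    · exact h.ne_vertex_of_open hz _ hk
    · rw [openSegment_symm] at hk
      exact Set.disjoint_left.1 hd hk (mem_bd.2 ⟨c', openSegment_subset_segment ℝ _ _ hz⟩)
  have hS2 : Disjoint (segment ℝ (p c) x) (bd (loop p i (j - i + 1))) := by
    rw [Set.disjoint_left]
    intro z hz hb
    have hz' : z = p c ∨ z ∈ openSegment ℝ (p c') (p (c' + 1)) := by
      rw [← insert_endpoints_openSegment] at hz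
      rcases hz with rfl | rfl | hz
      · exact Or.inl rfl
      · exact Or.inr hx
      · right
        rw [← hcc] at hz
        obtain ⟨s, t, hs, ht, hst, rfl⟩ := hz
        obtain ⟨s1, t1, hs1, ht1, hst1, rfl⟩ := hx
        refine ⟨s + t * s1, t * t1, by positivity, by positivity, ?_, ?_⟩
        · rw [add_assoc, ← mul_add, hst1, mul_one, hst]
        · simp only [Complex.real_smul]; push_cast; ring
    rcases hz' with rfl | hz'
    · exact hcA hb
    · rcases hbdA hb with ⟨k, k1, k2, hk⟩ | hk
      · have := h.notMem_edge_of_open hz' (j := k + n) (by omega) (by omega)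
        rw [show k + n + 1 = k + 1 + n by omega, h.per, h.per] at this
        exact this hk
      · exact hxo z hz' hk
  have w2 := hA.wind_const (convex_segment (𝕜 := ℝ) _ _).isPreconnected hS2
    (left_mem_segment ℝ _ _) (right_mem_segment ℝ _ _)
  have w3 : wind (i + n - j + 1) (loop p j (i + n - j + 1)) x = (κB + 1) * Real.pi := by
    refine hB.wind_open hsB (k := c' - j) ?_
    rw [loop_of_lt (by omega), loop_of_lt (by omega), show j + (c' - j) = c' by omega,
      show j + (c' - j + 1) = c' + 1 by omega]
    exact hx
  -- At `x` the values are `2π` for the polygon, `(κA + 1) π` for `A` and `(κB + 1) π` for `B`. As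
  -- `x` is off the chord they must add up, which forces `κA + κB = 0`.
  have w4 : wind n p x = (1 + 1) * Real.pi := h.wind_open (by simpa using h.left) hx
  have w5 := wind_add h.toPerSimple (i := i) (j := j) (by omega) (by omega) x
  have w6 := ang_swap (p j) (p i) x
  rw [if_neg fun e => hxo x hx (openSegment_subset_segment ℝ _ _ (mem_openSegment_of_ang e))] at w6
  rw [w6, w4, w3, ← w2, ← w1, hu] at w5
  apply hκ
  have : (κA + κB) * Real.pi = 0 := by linarith
  exact (mul_eq_zero.1 this).resolve_right hpi.ne'

theorem exists_root (h : Deflated n p T) : ∃ c, 0 < c ∧ c < n - 1 ∧ T (n - 1) 0 c := by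
  have h3 := h.three
  have hper := h.per 0
  have e0 : n - 1 + 1 = 0 + n := by omega
  have hne : p (n - 1) ≠ p 0 := fun e => by have := h.inj_lt (by omega) (by omega) e; omega
  have hv := edge_subset n p (n - 1)
  obtain ⟨m, hm⟩ : (openSegment ℝ (p (n - 1)) (p 0)).Nonempty :=
    ⟨_, 1 / 2, 1 / 2, by norm_num, by norm_num, by norm_num, rfl⟩
  rw [e0, hper] at hv
  obtain ⟨c, hc⟩ := h.exists_left (i := n - 1) (j := 0) (by omega) (by omega) (by omega) hv hm (by
    have e1 := (tendsto_add_smul m (Complex.I * (p 0 - p (n - 1)))).eventually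
      (h.eventually_wind (Or.inl rfl) (by simpa using h.left) (k := n - 1)
        (by rwa [e0, hper]))
    filter_upwards [e1, self_mem_nhdsWithin] with s hs hs0
    have hs0 : 0 < s := hs0
    have g := hs.1 (by
      rw [e0, hper, orient_add_perp,
        orient_eq_zero_of_mem_segment (openSegment_subset_segment ℝ _ _ hm)]
      have := mul_pos hs0 (Complex.normSq_pos.2 (sub_ne_zero.2 hne.symm))
      linarith)
    right
    rw [g.2]; norm_num [Real.pi_ne_zero])
  obtain ⟨n1, n2, n3⟩ := h.nes hc
  have := (h.lts hc).2.2
  exact ⟨c, by omega, by omega, hc⟩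

/-- Split at the apex over the chord and recurse. The apex index lies strictly between `i` and `j`,
which makes the labels consecutive. -/
theorem exists_subtree (h : Deflated n p T) : ∀ d i j, j - i ≤ d → i < j → j < n →
    segment ℝ (p i) (p j) ⊆ Cl n p → ∃ τ : PTree, τ.Consec i j ∧ (i + 2 ≤ j → τ ≠ leaf) ∧
      ∀ a b c, τ.tri i j a b c → T a b c := by
  intro d
  induction d with
  | zero => intro i j h1 h2; omega
  | succ d ih =>
    intro i j hd hij hj hv
    by_cases hl : j = i + 1
    · exact ⟨leaf, hl, fun _ => by omega, fun _ _ _ k => k.elim⟩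
    obtain ⟨c, c1, c2, hc⟩ : ∃ c, i < c ∧ c < j ∧ T j i c := by
      by_cases hroot : i = 0 ∧ j = n - 1
      · obtain ⟨rfl, rfl⟩ := hroot
        exact h.exists_root
      · exact h.exists_apex (by omega) hj hroot hv
    obtain ⟨l, l1, -, l2⟩ := ih i c (by omega) c1 (by omega)
      (h.side_subset hc (by simp) (by simp))
    obtain ⟨r, r1, -, r2⟩ := ih c j (by omega) c2 hj
      (h.side_subset hc (by simp) (by simp))
    refine ⟨node l c r, ⟨l1, r1⟩, fun _ => by simp, ?_⟩
    rintro x y z (k | k | k)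
    · have hrot := h.rot _ _ _ hc
      rcases k with ⟨rfl, rfl, rfl⟩ | ⟨rfl, rfl, rfl⟩ | ⟨rfl, rfl, rfl⟩
      · exact hrot
      · exact h.rot _ _ _ hrot
      · exact hc
    · exact l2 _ _ _ k
    · exact r2 _ _ _ k

/-- Interiors are disjoint, so a common point is on the frontier of the first triangle. It is a
vertex, or it lies on an open side, which meets only triangles that contain both ends. -/
theorem cplx (h : Deflated n p T) {a b c a' b' c' : ℕ} (ht : T a b c) (ht' : T a' b' c')
    (hne : ({a, b, c} : Finset ℕ) ≠ {a', b', c'}) :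
    lhull p {a, b, c} ∩ lhull p {a', b', c'} ⊆ lhull p ({a, b, c} ∩ {a', b', c'}) := by
  have hlt : ∀ {a b c}, T a b c → ∀ x ∈ ({a, b, c} : Finset ℕ), x < n := by
    intro a b c ht x hx
    obtain ⟨l1, l2, l3⟩ := h.lts ht
    simp only [Finset.mem_insert, Finset.mem_singleton] at hx
    rcases hx with rfl | rfl | rfl <;> assumption
  rintro z ⟨hz, hz'⟩
  have hint : z ∉ interior (lhull p {a, b, c}) := by
    intro hi
    have hcl : z ∈ closure (interior (lhull p {a', b', c'})) := by
      have hp := h.pos _ _ _ ht'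
      have hnon : (interior (lhull p {a', b', c'})).Nonempty := by
        rw [lhull_triple, interior_convexHull_nonempty_iff_affineSpan_eq_top]
        have e := (affineIndependent_of_orient_ne_zero hp.ne').affineSpan_eq_top_iff_card_eq_finrank_add_one.2
          (by simp)
        rw [← e]; congr 1; ext; simp; tauto
      have := (convex_convexHull ℝ (p '' (({a', b', c'} : Finset ℕ) : Set ℕ))).closure_interior_eq_closure_of_nonempty_interior hnon
      rw [lhull, this]
      exact subset_closure hz'
    obtain ⟨w, w1, w2⟩ := mem_closure_iff.1 hcl _ isOpen_interior hi
    exact Set.disjoint_left.1 (h.disjoint _ _ _ _ _ _ ht ht' hne) w1 w2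
  obtain ⟨x, hx, y, hy, hxy, rfl | hs⟩ := h.exists_side ht hz hint
  · have hxi : p x ∉ interior (lhull p {a', b', c'}) := fun hh =>
      Set.disjoint_left.1 (h.interior_disjoint_bd ht') hh (vertex_mem_bd p x)
    obtain ⟨x', hx', y', hy', hxy', g | g⟩ := h.exists_side ht' hz' hxi
    · obtain rfl := h.inj_lt (hlt ht x hx) (hlt ht' x' hx') g
      exact mem_lhull p (Finset.mem_inter.2 ⟨hx, hx'⟩)
    · exact (h.vertex_notMem (hlt ht' _ hx') (hlt ht' _ hy') (hlt ht x hx) hxy'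
        (h.side_subset ht' hx' hy') g).elim
  · obtain ⟨x', y'⟩ := h.ends_mem (hlt ht x hx) (hlt ht y hy) hxy (h.side_subset ht hx hy) ht' hs hz'
    exact segment_subset_lhull (Finset.mem_inter.2 ⟨hx, x'⟩) (Finset.mem_inter.2 ⟨hy, y'⟩)
      (openSegment_subset_segment ℝ _ _ hs)

/-- Without a reflex vertex, the diagonal `x o` would be visible and would cross the common edge `u
v` or pass through one of its ends; both are impossible in a deflated polygon. -/
theorem reflex (h : Deflated n p T) {u x v o : ℕ} (ht : T u x v) (ht' : T v o u) :
    orient (p o) (p u) (p x) < 0 ∨ orient (p x) (p v) (p o) < 0 := by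
  by_contra hcon
  push Not at hcon
  obtain ⟨c1, c2⟩ := hcon
  have hp := h.pos _ _ _ ht
  have hp' := h.pos _ _ _ ht'
  obtain ⟨n1, n2, n3⟩ := h.nes ht
  obtain ⟨m1, m2, m3⟩ := h.nes ht'
  obtain ⟨l1, l2, l3⟩ := h.lts ht
  have l4 := (h.lts ht').2.1
  set A := orient (p u) (p x) (p v) with hA
  set B := orient (p v) (p o) (p u) with hB
  -- The weights put `y` on the line `u v`.
  set s := B / (A + B) with hs
  set t := A / (A + B) with ht0
  have hs0 : 0 < s := by positivity
  have ht0' : 0 < t := by positivity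
  have hst : s + t = 1 := by rw [hs, ht0]; field_simp; ring
  set y := s • p x + t • p o with hy
  have hyo : y ∈ openSegment ℝ (p x) (p o) := ⟨s, t, hs0, ht0', hst, rfl⟩
  have e1 : orient (p v) (p u) y = 0 := by
    rw [hy, orient_combo _ _ _ _ hst, ← orient_rot (p u) (p x) (p v) |>.trans (orient_rot _ _ _)]
    have : orient (p v) (p u) (p o) = -B := by rw [hB, orient_swap]
    rw [this, ← hA, hs, ht0]; field_simp; ring
  have e2 : 0 ≤ orient (p u) (p x) y := by
    rw [hy, orient_combo _ _ _ _ hst, orient_self_right, ← orient_rot (p o)]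
    have := mul_nonneg ht0'.le c1
    linarith
  have e3 : 0 ≤ orient (p x) (p v) y := by
    rw [hy, orient_combo _ _ _ _ hst, orient_self_left]
    have := mul_nonneg ht0'.le c2
    linarith
  have hyh : y ∈ convexHull ℝ {p u, p x, p v} := (mem_triangle hp).2 ⟨e2, e3, e1.ge⟩
  have hys : y ∈ segment ℝ (p v) (p u) := by
    refine mem_segment_of_orient (c := p x) ?_ ?_ e1
    · rwa [← orient_rot, ← orient_rot] 
    · rwa [show ({p v, p u, p x} : Set ℂ) = {p u, p x, p v} by ext; simp; tauto]
  have hyc : y ∈ lhull p {u, x, v} := by rwa [lhull_triple]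
  have hyc' : y ∈ lhull p {v, o, u} := segment_subset_lhull (by simp) (by simp) hys
  have hxo : x ≠ o := by
    rintro rfl
    have : A = -B := by rw [hA, hB, orient_rot (p v), orient_swap]; simp [orient_rot (p x)]
    linarith
  have hvis : segment ℝ (p x) (p o) ⊆ Cl n p := by
    have : segment ℝ (p x) (p o) ⊆ segment ℝ (p x) y ∪ segment ℝ y (p o) := by
      intro z hz
      obtain ⟨a, b, ha, hb, hab, rfl⟩ := hz
      rcases le_total b t with hbt | hbt
      · left
        refine ⟨1 - b / t, b / t, ?_, by positivity, by ring, ?_⟩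
        · rw [sub_nonneg, div_le_one ht0']; exact hbt
        · rw [hy]
          obtain rfl : a = 1 - b := by linarith
          obtain hs' : s = 1 - t := by linarith
          rw [hs']
          have : (t : ℂ) ≠ 0 := by exact_mod_cast ht0'.ne'
          simp only [Complex.real_smul]; push_cast; field_simp; ring
      · right
        refine ⟨a / s, 1 - a / s, by positivity, ?_, by ring, ?_⟩
        · rw [sub_nonneg, div_le_one hs0]; linarith
        · rw [hy]
          obtain rfl : b = 1 - a := by linarith
          obtain ht' : t = 1 - s := by linarith
          rw [ht']
          have : (s : ℂ) ≠ 0 := by exact_mod_cast hs0.ne'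
          simp only [Complex.real_smul]; push_cast; field_simp; ring
    refine this.trans (Set.union_subset ?_ ?_)
    · exact ((convex_convexHull ℝ _).segment_subset (mem_lhull p (by simp)) hyc).trans
        (h.hull_subset ht)
    · exact ((convex_convexHull ℝ _).segment_subset hyc' (mem_lhull p (by simp))).trans
        (h.hull_subset ht')
  rw [← insert_endpoints_openSegment] at hys
  rcases hys with e | e | e
  · rw [e] at hyo; exact h.vertex_notMem l2 l4 l3 hxo hvis hyo
  · rw [Set.mem_singleton_iff.1 e] at hyo; exact h.vertex_notMem l2 l4 l1 hxo hvis hyo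
  · refine Set.disjoint_left.1 (h.defl x o v u l2 l4 l3 l1 hxo n3 hvis
      (h.side_subset ht (by simp) (by simp)) ?_) hyo e
    rw [Ne, Sym2.eq_iff]
    rintro (⟨e, -⟩ | ⟨e, -⟩)
    · exact n2 e
    · exact n1 e.symm

end Deflated
theorem interior_triangle_nonempty {a b c : ℂ} (h : 0 < orient a b c) :
    (interior (convexHull ℝ {a, b, c})).Nonempty := by
  refine ⟨(1 / 3 : ℝ) • a + (1 / 3 : ℝ) • b + (1 / 3 : ℝ) • c, ?_⟩
  have key : ∀ a b c : ℂ, 0 < orient a b c →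
      0 < orient a b ((1 / 3 : ℝ) • a + (1 / 3 : ℝ) • b + (1 / 3 : ℝ) • c) := by
    intro a b c h
    have : orient a b ((1 / 3 : ℝ) • a + (1 / 3 : ℝ) • b + (1 / 3 : ℝ) • c) =
        1 / 3 * orient a b c := by
      simp only [orient, Complex.sub_re, Complex.sub_im, Complex.add_re, Complex.add_im,
        Complex.real_smul, Complex.re_ofReal_mul, Complex.im_ofReal_mul]; ring
    rw [this]; positivity
  rw [mem_interior_triangle h]
  refine ⟨key a b c h, ?_, ?_⟩
  · rw [show (1 / 3 : ℝ) • a + (1 / 3 : ℝ) • b + (1 / 3 : ℝ) • c =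
      (1 / 3 : ℝ) • b + (1 / 3 : ℝ) • c + (1 / 3 : ℝ) • a by ring]
    exact key b c a (by rwa [← orient_rot])
  · rw [show (1 / 3 : ℝ) • a + (1 / 3 : ℝ) • b + (1 / 3 : ℝ) • c =
      (1 / 3 : ℝ) • c + (1 / 3 : ℝ) • a + (1 / 3 : ℝ) • b by ring]
    exact key c a b (by rwa [orient_rot])

theorem rot_of_finset_eq {R : ℕ → ℂ} {a b c a' b' c' : ℕ} (h : 0 < orient (R a) (R b) (R c))
    (h' : 0 < orient (R a') (R b') (R c')) (e : ({a, b, c} : Finset ℕ) = {a', b', c'}) :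
    Rot a' b' c' a b c := by
  have ha : a ∈ ({a', b', c'} : Finset ℕ) := e ▸ (by simp)
  have hb : b ∈ ({a', b', c'} : Finset ℕ) := e ▸ (by simp)
  have hc : c ∈ ({a', b', c'} : Finset ℕ) := e ▸ (by simp)
  have n1 : a ≠ b := by rintro rfl; simp [orient] at h
  have n2 : b ≠ c := by rintro rfl; rw [orient_self_right] at h; exact lt_irrefl _ h
  have n3 : c ≠ a := by rintro rfl; rw [orient_self_left] at h; exact lt_irrefl _ h
  have e1 := orient_swap (R a') (R b') (R c')
  have e2 := orient_rot (R a') (R b') (R c')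
  have e3 := orient_rot (R b') (R c') (R a')
  have e4 := orient_rot (R a') (R c') (R b')
  have e5 := orient_rot (R c') (R b') (R a')
  simp only [Finset.mem_insert, Finset.mem_singleton] at ha hb hc
  unfold Rot
  rcases ha with rfl | rfl | rfl <;> rcases hb with rfl | rfl | rfl <;>
    rcases hc with rfl | rfl | rfl <;> first
    | exact (n1 rfl).elim
    | exact (n2 rfl).elim
    | exact (n3 rfl).elim
    | tauto
    | (exfalso; linarith)

theorem toPer_ofSeq {M : ℕ} {p : ℕ → ℂ} (h : Function.Periodic p (M + 1)) :
    toPer (ofSeq p (M + 1)) = p := by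
  ext k
  rw [toPer, ofSeq_apply]
  exact h.map_mod_nat k

/-- The triangulation of a deflated polygon is that of a tree over the last edge. -/
theorem Deflated.exists_tree {M : ℕ} {p : ℕ → ℂ} {T : ℕ → ℕ → ℕ → Prop}
    (h : Deflated (M + 1) p T) : ∃ τ : PTree, τ.Consec 0 M ∧ τ ≠ leaf ∧
      (∀ a b c, τ.tri 0 M a b c ↔ T a b c) ∧
      Realizes (τ.tri 0 M) (fun o u x => orient (p o) (p u) (p x) < 0) p := by
  have h3 := h.three
  have hper : Function.Periodic p (M + 1) := h.per
  obtain ⟨τ, h1, h2, h4⟩ := h.exists_subtree (M + 1) 0 M (by omega) (by omega) (by omega) (by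
    have := edge_subset (M + 1) p M
    have e := h.per 0
    rw [zero_add] at e
    rwa [e, segment_symm] at this)
  have hl := h2 (by omega)
  refine ⟨τ, h1, hl, fun a b c => ⟨h4 a b c, fun ht => ?_⟩, fun a b c k => h.pos _ _ _ (h4 _ _ _ k),
    fun a b c a' b' c' k k' hne => h.cplx (h4 _ _ _ k) (h4 _ _ _ k') hne, fun _ _ _ _ _ _ => Iff.rfl,
    fun u x v o k k' => h.reflex (h4 _ _ _ k) (h4 _ _ _ k')⟩
  -- The triangles of the tree already cover the polygon, so any further triangle would overlap one
  -- of them.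
  have hcl : Cl (M + 1) p = region (τ.tri 0 M) p := by
    rw [← closedRegion_ofSeq h1 hl fun a b c k => h.pos _ _ _ (h4 _ _ _ k), closedRegion_eq_Cl,
      toPer_ofSeq hper]
  have hp := h.pos _ _ _ ht
  obtain ⟨z, hz⟩ := interior_triangle_nonempty hp
  rw [← lhull_triple] at hz
  have hzc := h.hull_subset ht (interior_subset hz)
  rw [hcl] at hzc
  obtain ⟨a', b', c', k, hz'⟩ := hzc
  have hp' := h.pos _ _ _ (h4 _ _ _ k)
  by_cases he : ({a, b, c} : Finset ℕ) = {a', b', c'}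
  · rcases rot_of_finset_eq hp hp' he with ⟨rfl, rfl, rfl⟩ | ⟨rfl, rfl, rfl⟩ | ⟨rfl, rfl, rfl⟩
    · exact k
    · exact tri_rot k
    · exact tri_rot (tri_rot k)
  · exfalso
    have hcl : z ∈ closure (interior (lhull p {a', b', c'})) := by
      have hnon : (interior (lhull p {a', b', c'})).Nonempty := by
        rw [lhull_triple]; exact interior_triangle_nonempty hp'
      have hconv : Convex ℝ (lhull p {a', b', c'}) := convex_convexHull ℝ _
      rw [hconv.closure_interior_eq_closure_of_nonempty_interior hnon]
      exact subset_closure hz'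
    obtain ⟨w, w1, w2⟩ := mem_closure_iff.1 hcl _ isOpen_interior hz
    exact Set.disjoint_left.1 (h.disjoint _ _ _ _ _ _ ht (h4 _ _ _ k) he) w1 w2

/-! ### Relabelling by rotations and reflections -/

section Relabel

variable {M : ℕ}

/-- The relabelled polygon. -/
def relabel (P : Polygon ℂ (M + 1)) (g : Equiv.Perm (Fin (M + 1))) : Polygon ℂ (M + 1) :=
  ⟨fun i => P (g i)⟩

theorem relabel_apply (P : Polygon ℂ (M + 1)) (g : Equiv.Perm (Fin (M + 1))) (i : Fin (M + 1)) :
    relabel P g i = P (g i) := rfl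

/-- A rotation (with `b` true) or a reflection of the cyclic order, which sends the polygon edge
`i` to the polygon edge `ε i`. -/
structure Dihedral (g ε : Equiv.Perm (Fin (M + 1))) (b : Bool) : Prop where
  left : ∀ i, (if b then g i else g (finRotate _ i)) = ε i
  right : ∀ i, (if b then g (finRotate _ i) else g i) = finRotate _ (ε i)

theorem Dihedral.edge {g ε : Equiv.Perm (Fin (M + 1))} {b : Bool} (h : Dihedral g ε b)
    (i : Fin (M + 1)) : s(g i, g (finRotate _ i)) = s(ε i, finRotate _ (ε i)) := by
  rw [← h.right, ← h.left]
  cases b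
  · exact Sym2.eq_swap
  · rfl

theorem Dihedral.openSegment {g ε : Equiv.Perm (Fin (M + 1))} {b : Bool} (h : Dihedral g ε b)
    (P : Polygon ℂ (M + 1)) (i : Fin (M + 1)) :
    openSegment ℝ (P (g i)) (P (g (finRotate _ i))) =
      openSegment ℝ (P (ε i)) (P (finRotate _ (ε i))) := by
  rw [← h.right, ← h.left]
  cases b
  · exact openSegment_symm ℝ _ _
  · rfl

theorem Dihedral.segment {g ε : Equiv.Perm (Fin (M + 1))} {b : Bool} (h : Dihedral g ε b)
    (P : Polygon ℂ (M + 1)) (i : Fin (M + 1)) :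
    segment ℝ (P (g i)) (P (g (finRotate _ i))) =
      segment ℝ (P (ε i)) (P (finRotate _ (ε i))) := by
  rw [← h.right, ← h.left]
  cases b
  · exact segment_symm ℝ _ _
  · rfl

theorem isSimple_relabel {g ε : Equiv.Perm (Fin (M + 1))} {b : Bool} (h : Dihedral g ε b)
    (P : Polygon ℂ (M + 1)) : (relabel P g).IsSimple ↔ P.IsSimple := by
  rw [isSimple_iff, isSimple_iff]
  refine and_congr_right fun _ => and_congr ?_ (and_congr ?_ ?_)
  · exact ⟨fun hi => by
      have := hi.comp g.symm.injective
      convert this using 1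
      ext i; simp [relabel], fun hi => hi.comp g.injective⟩
  · simp only [relabel_apply, h.openSegment]
    rw [ε.forall_congr_left]
    refine forall_congr' fun i => ?_
    rw [g.forall_congr_left]
    simp
  · simp only [relabel_apply, h.openSegment]
    rw [ε.forall_congr_left]
    refine forall_congr' fun i => ?_
    rw [ε.forall_congr_left]
    simp

theorem boundary_relabel {g ε : Equiv.Perm (Fin (M + 1))} {b : Bool} (h : Dihedral g ε b)
    (P : Polygon ℂ (M + 1)) : (relabel P g).boundary ℝ = P.boundary ℝ := by
  rw [boundary_eq, boundary_eq]
  simp only [relabel_apply, h.segment]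
  exact ε.surjective.iUnion_comp fun i => _root_.segment ℝ (P i) (P (finRotate _ i))

theorem windingNumber_eq (P : Polygon ℂ (M + 1)) (z : ℂ) :
    P.windingNumber z = (∑ i, ang (P i) (P (finRotate _ i)) z) / (2 * Real.pi) := rfl

theorem sum_relabel {g ε : Equiv.Perm (Fin (M + 1))} (h : Dihedral g ε true)
    (P : Polygon ℂ (M + 1)) (z : ℂ) :
    ∑ i, ang (relabel P g i) (relabel P g (finRotate _ i)) z =
      ∑ i, ang (P i) (P (finRotate _ i)) z := by
  rw [← Equiv.sum_comp ε fun i => ang (P i) (P (finRotate _ i)) z]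
  refine Finset.sum_congr rfl fun i _ => ?_
  rw [relabel_apply, relabel_apply, ← h.right, ← h.left]; rfl

theorem sum_relabel_swap {g ε : Equiv.Perm (Fin (M + 1))} (h : Dihedral g ε false)
    (P : Polygon ℂ (M + 1)) (z : ℂ) :
    ∑ i, ang (relabel P g i) (relabel P g (finRotate _ i)) z =
      ∑ i, ang (P (finRotate _ i)) (P i) z := by
  rw [← Equiv.sum_comp ε fun i => ang (P (finRotate _ i)) (P i) z]
  refine Finset.sum_congr rfl fun i _ => ?_
  rw [relabel_apply, relabel_apply, ← h.right, ← h.left]; rfl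

/-- Off the boundary, a reflection of the cyclic order only negates the winding number. -/
theorem closedRegion_relabel {g ε : Equiv.Perm (Fin (M + 1))} {b : Bool} (h : Dihedral g ε b)
    (P : Polygon ℂ (M + 1)) : (relabel P g).closedRegion = P.closedRegion := by
  have main : ∀ z ∉ P.boundary ℝ, ((relabel P g).windingNumber z = 0 ↔ P.windingNumber z = 0) := by
    intro z hz
    rw [windingNumber_eq, windingNumber_eq]
    cases b
    · rw [sum_relabel_swap h]
      have : ∑ i, ang (P (finRotate _ i)) (P i) z = - ∑ i, ang (P i) (P (finRotate _ i)) z := by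
        rw [← Finset.sum_neg_distrib]
        refine Finset.sum_congr rfl fun i _ => ?_
        rw [ang_swap, if_neg]
        intro e
        rw [boundary_eq, Set.mem_iUnion] at hz
        exact hz ⟨i, openSegment_subset_segment ℝ _ _ (mem_openSegment_of_ang e)⟩
      rw [this, neg_div, neg_eq_zero]
    · rw [sum_relabel h]
  ext z
  simp only [closedRegion, openRegion, boundary_relabel h, Set.mem_union, Set.mem_ofPred_eq]
  by_cases hz : z ∈ P.boundary ℝ
  · simp [hz]
  · simp [hz, main z hz]

theorem visible_relabel {g ε : Equiv.Perm (Fin (M + 1))} {b : Bool} (h : Dihedral g ε b)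
    (P : Polygon ℂ (M + 1)) (i j : Fin (M + 1)) :
    (relabel P g).Visible i j ↔ P.Visible (g i) (g j) := by
  rw [Visible, Visible, closedRegion_relabel h]; rfl

theorem exists_dihedral (b : Bool) (r : Fin (M + 1)) : ∃ g ε : Equiv.Perm (Fin (M + 1)),
    Dihedral g ε b ∧ ε (Fin.last M) = r := by
  have hlast : Fin.last M + 1 = 0 := by rw [← finRotate_apply, finRotate_last]
  cases b
  · refine ⟨Equiv.subLeft r, (finRotate _).trans (Equiv.subLeft r), ⟨fun i => ?_, fun i => ?_⟩, ?_⟩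
    · simp
    · simp [finRotate_apply, sub_add_eq_sub_sub]
    · simp [hlast]
  · refine ⟨Equiv.addRight (r + 1), Equiv.addRight (r + 1), ⟨fun i => ?_, fun i => ?_⟩, ?_⟩
    · simp
    · simp only [finRotate_apply, Equiv.coe_addRight, if_true]; abel
    · simp only [Equiv.coe_addRight]
      rw [add_comm r, ← add_assoc, hlast, zero_add]

/-- Some relabelling of a simple polygon is counter-clockwise and ends with a given edge. -/
theorem exists_dihedral_left {P : Polygon ℂ (M + 1)} (hP : P.IsSimple) (r : Fin (M + 1)) :
    ∃ (b : Bool) (g ε : Equiv.Perm (Fin (M + 1))), Dihedral g ε b ∧ ε (Fin.last M) = r ∧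
      ∀ k, ∀ x ∈ segment ℝ (toPer (relabel P g) k) (toPer (relabel P g) (k + 1)),
        PerSimple.edgeSweep (M + 1) (toPer (relabel P g)) k x = Real.pi := by
  have hpi := Real.pi_pos
  obtain ⟨g, ε, h, hr⟩ := exists_dihedral (M := M) true r
  obtain ⟨g', ε', h', hr'⟩ := exists_dihedral (M := M) false r
  have hs := perSimple_toPer ((isSimple_relabel h P).2 hP)
  have hs' := perSimple_toPer ((isSimple_relabel h' P).2 hP)
  obtain ⟨κ, hκ, e⟩ := hs.edgeSweep_sign
  obtain ⟨κ', hκ', e'⟩ := hs'.edgeSweep_sign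
  rcases hκ with rfl | rfl
  · exact ⟨true, g, ε, h, hr, by simpa using e⟩
  rcases hκ' with rfl | rfl
  · exact ⟨false, g', ε', h', hr', by simpa using e'⟩
  -- If neither direction were counter-clockwise, both total angles would vanish at a point `x` of
  -- the edge `r`. But their sum is `2π`: the edge `r` counts `π` in each direction, and all other
  -- edges cancel.
  exfalso
  obtain ⟨x, hx⟩ : (openSegment ℝ (P r) (P (finRotate _ r))).Nonempty :=
    ⟨_, 1 / 2, 1 / 2, by norm_num, by norm_num, by norm_num, rfl⟩
  have edge : ∀ {g ε : Equiv.Perm (Fin (M + 1))} {b : Bool}, Dihedral g ε b → ε (Fin.last M) = r →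
      x ∈ openSegment ℝ (toPer (relabel P g) M) (toPer (relabel P g) (M + 1)) := by
    intro g ε b h hr
    have := h.openSegment P (Fin.last M)
    rw [hr] at this
    rw [toPer, toPer, ← finRotate_ofNat, relabel_apply, relabel_apply]
    have e : Fin.ofNat (M + 1) M = Fin.last M := ofNat_val (Fin.last M)
    rw [e, this]; exact hx
  have w := hs.wind_open e (edge h hr)
  have w' := hs'.wind_open e' (edge h' hr')
  rw [wind_toPer, windingNumber_eq, mul_div_cancel₀ _ (by positivity)] at w w'
  rw [sum_relabel h] at w
  rw [sum_relabel_swap h'] at w'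
  have hne : P r ≠ P (finRotate _ r) := by
    intro e
    obtain ⟨h3, hinj, -, -⟩ := (isSimple_iff P).1 hP
    exact finRotate_ne h3 r (hinj e).symm
  have hsum : ∑ i, (ang (P i) (P (finRotate _ i)) x + ang (P (finRotate _ i)) (P i) x) =
      2 * Real.pi := by
    rw [Finset.sum_eq_single r]
    · rw [ang_of_mem_openSegment hne hx, ang_of_mem_openSegment hne.symm (by rwa [openSegment_symm])]
      ring
    · intro i _ hi
      rw [ang_swap (P i), if_neg]
      · ring
      · intro e
        exact Set.disjoint_left.1 (((isSimple_iff P).1 hP).2.2.2 i r hi) (mem_openSegment_of_ang e) hx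
    · simp
  rw [Finset.sum_add_distrib, w, w'] at hsum
  linarith

/-- The counter-clockwise triples of labels of the triangles of a triangulation. -/
def labelTri (P : Polygon ℂ (M + 1)) (g : Equiv.Perm (Fin (M + 1)))
    (T : Finset (Finset (Fin (M + 1)))) (a b c : ℕ) : Prop :=
  a < M + 1 ∧ b < M + 1 ∧ c < M + 1 ∧
    0 < orient (toPer (relabel P g) a) (toPer (relabel P g) b) (toPer (relabel P g) c) ∧
    ({g (Fin.ofNat _ a), g (Fin.ofNat _ b), g (Fin.ofNat _ c)} : Finset (Fin (M + 1))) ∈ T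

theorem ofNat_inj {a b : ℕ} (ha : a < M + 1) (hb : b < M + 1)
    (h : Fin.ofNat (M + 1) a = Fin.ofNat (M + 1) b) : a = b := by
  have := congrArg Fin.val h
  simpa [Nat.mod_eq_of_lt ha, Nat.mod_eq_of_lt hb] using this

theorem toPer_symm (P : Polygon ℂ (M + 1)) (g : Equiv.Perm (Fin (M + 1))) (u : Fin (M + 1)) :
    toPer (relabel P g) (g.symm u : Fin (M + 1)) = P u := by
  rw [toPer_val, relabel_apply, Equiv.apply_symm_apply]

theorem exists_labels {P : Polygon ℂ (M + 1)} {T : Finset (Finset (Fin (M + 1)))}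
    (hT : P.IsTriangulation T) (g : Equiv.Perm (Fin (M + 1))) {t : Finset (Fin (M + 1))}
    (ht : t ∈ T) : ∃ a b c, labelTri P g T a b c ∧
      t = {g (Fin.ofNat _ a), g (Fin.ofNat _ b), g (Fin.ofNat _ c)} := by
  obtain ⟨u, v, w, huv, huw, hvw, rfl⟩ := Finset.card_eq_three.1 (hT.card_eq t ht)
  have hne : orient (P u) (P v) (P w) ≠ 0 := by
    apply orient_ne_zero_of_affineIndependent
    let f : Fin 3 ↪ ({u, v, w} : Finset (Fin (M + 1))) :=
      ⟨![⟨u, by simp⟩, ⟨v, by simp⟩, ⟨w, by simp⟩], by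
        intro i j hij
        fin_cases i <;> fin_cases j <;> simp_all [Ne.symm]⟩
    have := (hT.nondegenerate _ ht).comp_embedding f
    convert this using 1
    ext i
    fin_cases i <;> rfl
  have hs : ∀ u : Fin (M + 1), g (Fin.ofNat _ (g.symm u : Fin (M + 1))) = u := fun u => by
    rw [ofNat_val, Equiv.apply_symm_apply]
  rcases hne.lt_or_gt with h | h
  · refine ⟨(g.symm u : Fin (M + 1)), (g.symm w : Fin (M + 1)), (g.symm v : Fin (M + 1)),
      ⟨(g.symm u).2, (g.symm w).2, (g.symm v).2, ?_, ?_⟩, ?_⟩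
    · rw [toPer_symm, toPer_symm, toPer_symm, orient_swap]; linarith
    · rw [hs, hs, hs, Finset.pair_comm]; exact ht
    · rw [hs, hs, hs, Finset.pair_comm]
  · refine ⟨(g.symm u : Fin (M + 1)), (g.symm v : Fin (M + 1)), (g.symm w : Fin (M + 1)),
      ⟨(g.symm u).2, (g.symm v).2, (g.symm w).2, ?_, ?_⟩, ?_⟩
    · rw [toPer_symm, toPer_symm, toPer_symm]; exact h
    · rw [hs, hs, hs]; exact ht
    · rw [hs, hs, hs]

theorem hull_labels (P : Polygon ℂ (M + 1)) (g : Equiv.Perm (Fin (M + 1))) (a b c : ℕ) :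
    P.hull {g (Fin.ofNat _ a), g (Fin.ofNat _ b), g (Fin.ofNat _ c)} =
      lhull (toPer (relabel P g)) {a, b, c} := by
  rw [lhull_triple]
  exact lhull_triple P.vertices _ _ _

theorem finset_eq_of_labels (g : Equiv.Perm (Fin (M + 1))) {a b c a' b' c' : ℕ}
    (l1 : a < M + 1) (l2 : b < M + 1) (l3 : c < M + 1) (l1' : a' < M + 1) (l2' : b' < M + 1)
    (l3' : c' < M + 1)
    (e : ({g (Fin.ofNat _ a), g (Fin.ofNat _ b), g (Fin.ofNat _ c)} : Finset (Fin (M + 1))) =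
      {g (Fin.ofNat _ a'), g (Fin.ofNat _ b'), g (Fin.ofNat _ c')}) :
    ({a, b, c} : Finset ℕ) = {a', b', c'} := by
  have im : ∀ a b c : ℕ, ({g (Fin.ofNat _ a), g (Fin.ofNat _ b), g (Fin.ofNat _ c)} :
      Finset (Fin (M + 1))) = ({a, b, c} : Finset ℕ).image fun x => g (Fin.ofNat _ x) := by
    intro a b c; simp [Finset.image_insert]
  rw [im, im] at e
  have sub : ∀ {a b c a' b' c' : ℕ}, a < M + 1 → b < M + 1 → c < M + 1 → a' < M + 1 →
      b' < M + 1 → c' < M + 1 →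
      (({a, b, c} : Finset ℕ).image fun x => g (Fin.ofNat _ x)) ⊆
      (({a', b', c'} : Finset ℕ).image fun x => g (Fin.ofNat _ x)) →
      ({a, b, c} : Finset ℕ) ⊆ {a', b', c'} := by
    intro a b c a' b' c' h1 h2 h3 h1' h2' h3' hs x hx
    obtain ⟨y, hy, hxy⟩ := Finset.mem_image.1 (hs (Finset.mem_image_of_mem _ hx))
    have hx' : x < M + 1 := by
      simp only [Finset.mem_insert, Finset.mem_singleton] at hx
      rcases hx with rfl | rfl | rfl <;> assumption
    have hy' : y < M + 1 := by
      simp only [Finset.mem_insert, Finset.mem_singleton] at hy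
      rcases hy with rfl | rfl | rfl <;> assumption
    rwa [← ofNat_inj hy' hx' (g.injective hxy)]
  exact Finset.Subset.antisymm (sub l1 l2 l3 l1' l2' l3' e.le) (sub l1' l2' l3' l1 l2 l3 e.ge)

theorem deflated_relabel {P : Polygon ℂ (M + 1)} {T : Finset (Finset (Fin (M + 1)))}
    (hP : P.IsSimple) (hd : P.IsDeflated) (hT : P.IsTriangulation T)
    {g ε : Equiv.Perm (Fin (M + 1))} {b : Bool} (h : Dihedral g ε b)
    (hl : ∀ k, ∀ x ∈ _root_.segment ℝ (toPer (relabel P g) k) (toPer (relabel P g) (k + 1)),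
        PerSimple.edgeSweep (M + 1) (toPer (relabel P g)) k x = Real.pi) :
    Deflated (M + 1) (toPer (relabel P g)) (labelTri P g T) := by
  have hCl : Cl (M + 1) (toPer (relabel P g)) = P.closedRegion := by
    rw [← closedRegion_eq_Cl, closedRegion_relabel h]
  have hinj : ∀ {a b}, a < M + 1 → b < M + 1 → g (Fin.ofNat _ a) = g (Fin.ofNat _ b) → a = b :=
    fun ha hb e => ofNat_inj ha hb (g.injective e)
  refine ⟨perSimple_toPer ((isSimple_relabel h P).2 hP), hl, fun a b c k => k.1,
    fun a b c k => ⟨k.2.1, k.2.2.1, k.1, by rw [← orient_rot]; exact k.2.2.2.1, ?_⟩,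
    fun a b c k => k.2.2.2.1, ?_, fun a b c a' b' c' k k' hne => ?_,
    fun i j k l hi hj hk hl' hij hkl v1 v2 hne => ?_⟩
  · have := k.2.2.2.2
    rwa [show ({g (Fin.ofNat _ b), g (Fin.ofNat _ c), g (Fin.ofNat _ a)} : Finset (Fin (M + 1))) =
      {g (Fin.ofNat _ a), g (Fin.ofNat _ b), g (Fin.ofNat _ c)} by ext; simp; tauto]
  · rw [hCl, ← hT.cover]
    ext z
    simp only [Set.mem_iUnion, exists_prop]
    constructor
    · rintro ⟨t, ht, hz⟩
      obtain ⟨a, b, c, k, rfl⟩ := exists_labels hT g ht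
      rw [hull_labels] at hz
      exact ⟨a, b, c, k, hz⟩
    · rintro ⟨a, b, c, k, hz⟩
      rw [← hull_labels] at hz
      exact ⟨_, k.2.2.2.2, hz⟩
  · rw [← hull_labels, ← hull_labels]
    refine hT.disjoint _ k.2.2.2.2 _ k'.2.2.2.2 fun e => hne ?_
    obtain ⟨l1, l2, l3, -⟩ := k
    obtain ⟨l1', l2', l3', -⟩ := k'
    exact finset_eq_of_labels g l1 l2 l3 l1' l2' l3' e
  · rw [hCl] at v1 v2
    refine hd _ _ _ _ ⟨fun e => hij (hinj hi hj e), v1⟩ ⟨fun e => hkl (hinj hk hl' e), v2⟩ fun e => hne ?_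
    rw [Sym2.eq_iff] at e ⊢
    rcases e with ⟨e1, e2⟩ | ⟨e1, e2⟩
    · exact Or.inl ⟨hinj hi hk e1, hinj hj hl' e2⟩
    · exact Or.inr ⟨hinj hi hl' e1, hinj hj hk e2⟩

end Relabel
-- Charts: reading the dual tree from the labels
theorem _root_.PTree.Consec.not_tri_rev {τ : PTree} {p q i c : ℕ} (h : τ.Consec p q) :
    ¬ τ.tri p q (i + 1) i c := by
  induction τ generalizing p q with
  | leaf => exact id
  | node l x r ihl ihr =>
    have h1 := h.1.lt
    have h2 := h.2.lt
    rintro (k | k | k)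
    · unfold Rot at k; omega
    · exact ihl h.1 k
    · exact ihr h.2 k

section Dual

variable {M : ℕ}

/-- A tree that describes a triangulation, with respect to a labelling of the vertices. -/
structure Chart (P : Polygon ℂ (M + 1)) (T : Finset (Finset (Fin (M + 1))))
    (g ε : Equiv.Perm (Fin (M + 1))) (τ : PTree) : Prop where
  edge : ∀ i, s(g i, g (finRotate _ i)) = s(ε i, finRotate _ (ε i))
  consec : τ.Consec 0 M
  ne_leaf : τ ≠ leaf
  tri_iff : ∀ a b c, τ.tri 0 M a b c ↔ labelTri P g T a b c
  labels : ∀ t ∈ T, ∃ a b c, labelTri P g T a b c ∧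
    t = {g (Fin.ofNat _ a), g (Fin.ofNat _ b), g (Fin.ofNat _ c)}

/-- The node of the dual tree on the left-hand side of the directed edge from `u` to `v`. -/
def LeftNode (P : Polygon ℂ (M + 1)) (T : Finset (Finset (Fin (M + 1))))
    (g ε : Equiv.Perm (Fin (M + 1))) (u v : ℕ) (N : DualNode T) : Prop :=
  (∃ y, labelTri P g T u v y ∧ ∃ t : {t // t ∈ T},
    t.1 = {g (Fin.ofNat _ u), g (Fin.ofNat _ v), g (Fin.ofNat _ y)} ∧ N = Sum.inl t) ∨
  ∃ k : Fin (M + 1), u = (finRotate _ k : Fin (M + 1)) ∧ v = k ∧ N = Sum.inr (ε k)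

namespace Chart

variable {P : Polygon ℂ (M + 1)} {T : Finset (Finset (Fin (M + 1)))}
  {g ε : Equiv.Perm (Fin (M + 1))} {τ : PTree}

theorem three (C : Chart P T g ε τ) : 3 ≤ M + 1 := by
  have := C.consec.two_le C.ne_leaf; omega

theorem rot (C : Chart P T g ε τ) {a b c : ℕ} (h : labelTri P g T a b c) :
    labelTri P g T b c a := by
  rw [← C.tri_iff] at h ⊢; exact tri_rot h

theorem unique (C : Chart P T g ε τ) {a b c c' : ℕ} (h : labelTri P g T a b c)
    (h' : labelTri P g T a b c') : c = c' := by
  rw [← C.tri_iff] at h h'; exact tri_unique C.consec.wf h h'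

theorem inj (_ : Chart P T g ε τ) {a b : ℕ} (ha : a < M + 1) (hb : b < M + 1)
    (e : g (Fin.ofNat _ a) = g (Fin.ofNat _ b)) : a = b := ofNat_inj ha hb (g.injective e)

theorem nes (_ : Chart P T g ε τ) {a b c : ℕ} (h : labelTri P g T a b c) :
    a ≠ b ∧ b ≠ c ∧ c ≠ a := by
  have := h.2.2.2.1
  refine ⟨?_, ?_, ?_⟩ <;> rintro rfl
  · simp [orient] at this
  · rw [orient_self_right] at this; exact lt_irrefl _ this
  · rw [orient_self_left] at this; exact lt_irrefl _ this

theorem not_tri_rev (C : Chart P T g ε τ) (k : Fin (M + 1)) (y : ℕ) :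
    ¬ labelTri P g T (finRotate _ k : Fin (M + 1)) k y := by
  rw [← C.tri_iff]
  by_cases hk : k = Fin.last M
  · rw [hk, finRotate_last]; exact not_tri_base C.consec.wf
  · rw [coe_finRotate_of_ne_last hk]; exact C.consec.not_tri_rev

/-- On the left of a reversed polygon edge there is only the outside, so a triangle and a terminal
node never compete for the same directed edge. -/
theorem leftNode_unique (C : Chart P T g ε τ) {u v : ℕ} {N N' : DualNode T}
    (h : LeftNode P T g ε u v N) (h' : LeftNode P T g ε u v N') : N = N' := by
  rcases h with ⟨y, hy, t, ht, rfl⟩ | ⟨k, rfl, rfl, rfl⟩ <;>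
  rcases h' with ⟨y', hy', t', ht', rfl⟩ | ⟨k', e1, e2, rfl⟩
  · obtain rfl := C.unique hy hy'
    rw [Subtype.ext (ht.trans ht'.symm)]
  · subst e1 e2; exact (C.not_tri_rev _ _ hy).elim
  · exact (C.not_tri_rev _ _ hy').elim
  · rw [Fin.ext e2]

theorem leftNode_lt (C : Chart P T g ε τ) {u v : ℕ} {N : DualNode T}
    (h : LeftNode P T g ε u v N) : u < M + 1 ∧ v < M + 1 ∧ u ≠ v := by
  rcases h with ⟨y, hy, -⟩ | ⟨k, rfl, rfl, -⟩
  · exact ⟨hy.1, hy.2.1, (C.nes hy).1⟩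
  · exact ⟨(finRotate _ k).2, k.2, fun e => finRotate_ne C.three k (Fin.ext e)⟩

theorem mem_nodeEdges (C : Chart P T g ε τ) {u v : ℕ} {N : DualNode T}
    (h : LeftNode P T g ε u v N) : s(g (Fin.ofNat _ u), g (Fin.ofNat _ v)) ∈ nodeEdges N := by
  have hlt := C.leftNode_lt h
  rcases h with ⟨y, hy, t, ht, rfl⟩ | ⟨k, rfl, rfl, rfl⟩
  · refine ⟨?_, ?_⟩
    · rw [Sym2.mk_isDiag_iff]; exact fun e => hlt.2.2 (C.inj hlt.1 hlt.2.1 e)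
    · rw [ht]; simp
  · rw [ofNat_val, ofNat_val, Sym2.eq_swap, C.edge]; rfl

theorem leftNode_of_mem (C : Chart P T g ε τ) {u v : ℕ} {N : DualNode T} (hu : u < M + 1)
    (hv : v < M + 1) (h : s(g (Fin.ofNat _ u), g (Fin.ofNat _ v)) ∈ nodeEdges N) :
    LeftNode P T g ε u v N ∨ LeftNode P T g ε v u N := by
  rcases N with t | i
  · obtain ⟨h1, h2⟩ := h
    rw [Sym2.mk_isDiag_iff] at h1
    have huv : u ≠ v := by rintro rfl; exact h1 rfl
    obtain ⟨a, b, c, k, ht⟩ := C.labels t.1 t.2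
    have k2 := C.rot k
    have k3 := C.rot k2
    have hm : ∀ x < M + 1, g (Fin.ofNat _ x) ∈ t.1 → x = a ∨ x = b ∨ x = c := by
      intro x hx hm
      rw [ht] at hm
      simp only [Finset.mem_insert, Finset.mem_singleton] at hm
      rcases hm with e | e | e
      · exact Or.inl (C.inj hx k.1 e)
      · exact Or.inr (Or.inl (C.inj hx k.2.1 e))
      · exact Or.inr (Or.inr (C.inj hx k.2.2.1 e))
    have e2 : t.1 = {g (Fin.ofNat _ b), g (Fin.ofNat _ c), g (Fin.ofNat _ a)} := by
      rw [ht]; ext; simp; tauto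
    have e3 : t.1 = {g (Fin.ofNat _ c), g (Fin.ofNat _ a), g (Fin.ofNat _ b)} := by
      rw [ht]; ext; simp; tauto
    have d1 : LeftNode P T g ε a b (Sum.inl t) := Or.inl ⟨c, k, t, ht, rfl⟩
    have d2 : LeftNode P T g ε b c (Sum.inl t) := Or.inl ⟨a, k2, t, e2, rfl⟩
    have d3 : LeftNode P T g ε c a (Sum.inl t) := Or.inl ⟨b, k3, t, e3, rfl⟩
    rcases hm u hu (h2 _ (by simp)) with rfl | rfl | rfl <;>
    rcases hm v hv (h2 _ (by simp)) with rfl | rfl | rfl <;> tauto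
  · obtain ⟨k, rfl⟩ := ε.surjective i
    have h : s(g (Fin.ofNat _ u), g (Fin.ofNat _ v)) = s(ε k, finRotate _ (ε k)) := h
    rw [← C.edge, Sym2.eq_iff] at h
    rcases h with ⟨e1, e2⟩ | ⟨e1, e2⟩
    · refine Or.inr (Or.inr ⟨k, ?_, ?_, rfl⟩)
      · exact C.inj hv (finRotate _ k).2 (by rw [e2, ofNat_val])
      · exact C.inj hu k.2 (by rw [e1, ofNat_val])
    · refine Or.inl (Or.inr ⟨k, ?_, ?_, rfl⟩)
      · exact C.inj hu (finRotate _ k).2 (by rw [e1, ofNat_val])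
      · exact C.inj hv k.2 (by rw [e2, ofNat_val])

theorem leftNode_ne (C : Chart P T g ε τ) {u v : ℕ} {N N' : DualNode T}
    (h : LeftNode P T g ε u v N) (h' : LeftNode P T g ε v u N') : N ≠ N' := by
  rcases h with ⟨y, hy, t, ht, rfl⟩ | ⟨k, rfl, rfl, rfl⟩ <;>
  rcases h' with ⟨y', hy', t', ht', rfl⟩ | ⟨k', e1, e2, rfl⟩
  · intro e
    have e := Sum.inl.inj e
    rw [← e, ht] at ht'
    have hm : g (Fin.ofNat _ y) ∈ ({g (Fin.ofNat _ v), g (Fin.ofNat _ u), g (Fin.ofNat _ y')} :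
      Finset (Fin (M + 1))) := ht' ▸ (by simp)
    obtain ⟨n1, n2, n3⟩ := C.nes hy
    simp only [Finset.mem_insert, Finset.mem_singleton] at hm
    rcases hm with e | e | e
    · exact n2 (C.inj hy.2.1 hy.2.2.1 e.symm)
    · exact n3 (C.inj hy.2.2.1 hy.1 e)
    · obtain rfl := C.inj hy.2.2.1 hy'.2.2.1 e
      have h1 := hy.2.2.2.1
      have h2 := hy'.2.2.2.1
      rw [orient_swap'] at h2
      linarith
  · simp
  · simp
  · intro e
    have e := ε.injective (Sum.inr.inj e)
    subst e
    exact finRotate_ne C.three k (Fin.ext e1.symm)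

theorem adj (C : Chart P T g ε τ) {u v : ℕ} {N N' : DualNode T}
    (h : LeftNode P T g ε u v N) (h' : LeftNode P T g ε v u N') : (dualGraph T).Adj N N' :=
  ⟨C.leftNode_ne h h', _, C.mem_nodeEdges h, by rw [Sym2.eq_swap]; exact C.mem_nodeEdges h'⟩

theorem ccw (C : Chart P T g ε τ) {p x q : ℕ} (k : labelTri P g T p x q) {t : {t // t ∈ T}}
    (ht : t.1 = {g (Fin.ofNat _ p), g (Fin.ofNat _ x), g (Fin.ofNat _ q)}) {A B X : DualNode T}
    (hA : LeftNode P T g ε x p A) (hB : LeftNode P T g ε q x B) (hX : LeftNode P T g ε p q X) :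
    P.dualCcw T (Sum.inl t) A B X := by
  have e2 : t.1 = {g (Fin.ofNat _ x), g (Fin.ofNat _ q), g (Fin.ofNat _ p)} := by
    rw [ht]; ext; simp; tauto
  have e3 : t.1 = {g (Fin.ofNat _ q), g (Fin.ofNat _ p), g (Fin.ofNat _ x)} := by
    rw [ht]; ext; simp; tauto
  refine ⟨C.adj (Or.inl ⟨q, k, t, ht, rfl⟩) hA, C.adj (Or.inl ⟨p, C.rot k, t, e2, rfl⟩) hB,
    C.adj (Or.inl ⟨x, C.rot (C.rot k), t, e3, rfl⟩) hX, t, rfl, _, _, _, ht, k.2.2.2.1, ?_, ?_, ?_⟩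
  · rw [Sym2.eq_swap]; exact C.mem_nodeEdges hA
  · rw [Sym2.eq_swap]; exact C.mem_nodeEdges hB
  · rw [Sym2.eq_swap]; exact C.mem_nodeEdges hX

/-- A neighbour of a triangle shares only one edge with it; this fixes the rotation in
`leftNode_of_ccw`. -/
theorem eq_of_two_edges (C : Chart P T g ε τ) {p x q : ℕ} (k : labelTri P g T p x q)
    {t : {t // t ∈ T}}
    (ht : t.1 = {g (Fin.ofNat _ p), g (Fin.ofNat _ x), g (Fin.ofNat _ q)}) {X : DualNode T}
    (h1 : s(g (Fin.ofNat _ p), g (Fin.ofNat _ x)) ∈ nodeEdges X)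
    (h2 : s(g (Fin.ofNat _ p), g (Fin.ofNat _ q)) ∈ nodeEdges X) : X = Sum.inl t := by
  obtain ⟨n1, n2, n3⟩ := C.nes k
  have m1 : g (Fin.ofNat _ p) ≠ g (Fin.ofNat _ x) := fun e => n1 (C.inj k.1 k.2.1 e)
  have m2 : g (Fin.ofNat _ x) ≠ g (Fin.ofNat _ q) := fun e => n2 (C.inj k.2.1 k.2.2.1 e)
  have m3 : g (Fin.ofNat _ q) ≠ g (Fin.ofNat _ p) := fun e => n3 (C.inj k.2.2.1 k.1 e)
  rcases X with s | i
  · congr 1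
    apply Subtype.ext
    obtain ⟨a, b, c, k', hs⟩ := C.labels s.1 s.2
    have hsub : t.1 ⊆ s.1 := by
      rw [ht]
      intro y hy
      simp only [Finset.mem_insert, Finset.mem_singleton] at hy
      rcases hy with rfl | rfl | rfl
      · exact h1.2 _ (by simp)
      · exact h1.2 _ (by simp)
      · exact h2.2 _ (by simp)
    refine (Finset.eq_of_subset_of_card_le hsub ?_).symm
    rw [hs, ht, Finset.card_eq_three.2 ⟨_, _, _, m1, m3.symm, m2, rfl⟩]
    exact Finset.card_le_three
  · have e : s(g (Fin.ofNat _ p), g (Fin.ofNat _ x)) = s(g (Fin.ofNat _ p), g (Fin.ofNat _ q)) :=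
      (show _ = s(i, finRotate _ i) from h1).trans (show _ = s(i, finRotate _ i) from h2).symm
    exact (m2 (Sym2.congr_right.1 e)).elim

/-- The counter-clockwise order determines the neighbours of a triangle from one of them. -/
theorem leftNode_of_ccw (C : Chart P T g ε τ) {p x q : ℕ} (k : labelTri P g T p x q)
    {t : {t // t ∈ T}}
    (ht : t.1 = {g (Fin.ofNat _ p), g (Fin.ofNat _ x), g (Fin.ofNat _ q)}) {A B X : DualNode T}
    (h : P.dualCcw T (Sum.inl t) A B X) (hX : LeftNode P T g ε p q X) :
    LeftNode P T g ε x p A ∧ LeftNode P T g ε q x B := by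
  obtain ⟨a1, a2, a3, t', e, u, v, w, huvw, hor, h1, h2, h3⟩ := h
  obtain rfl := Sum.inl.inj e
  have e2 : t.1 = {g (Fin.ofNat _ x), g (Fin.ofNat _ q), g (Fin.ofNat _ p)} := by
    rw [ht]; ext; simp; tauto
  have e3 : t.1 = {g (Fin.ofNat _ q), g (Fin.ofNat _ p), g (Fin.ofNat _ x)} := by
    rw [ht]; ext; simp; tauto
  have key : ∀ {a b c : ℕ} {A : DualNode T}, labelTri P g T a b c →
      t.1 = {g (Fin.ofNat _ a), g (Fin.ofNat _ b), g (Fin.ofNat _ c)} →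
      (dualGraph T).Adj (Sum.inl t) A → s(g (Fin.ofNat _ a), g (Fin.ofNat _ b)) ∈ nodeEdges A →
      LeftNode P T g ε b a A := by
    intro a b c A k ht hadj hm
    rcases C.leftNode_of_mem k.1 k.2.1 hm with h | h
    · exact (hadj.1 (C.leftNode_unique (Or.inl ⟨c, k, t, ht, rfl⟩) h)).elim
    · exact h
  have hgs : ∀ u : Fin (M + 1), ∃ a : ℕ, a < M + 1 ∧ g (Fin.ofNat _ a) = u := fun u =>
    ⟨(g.symm u : Fin (M + 1)), (g.symm u).2, by rw [ofNat_val, Equiv.apply_symm_apply]⟩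
  obtain ⟨a, ha, rfl⟩ := hgs u
  obtain ⟨b, hb, rfl⟩ := hgs v
  obtain ⟨c, hc, rfl⟩ := hgs w
  have k' : labelTri P g T a b c := ⟨ha, hb, hc, hor, huvw ▸ t.2⟩
  have hXm := C.mem_nodeEdges hX
  have hset : ({a, b, c} : Finset ℕ) = {p, x, q} :=
    finset_eq_of_labels g ha hb hc k.1 k.2.1 k.2.2.1 (huvw.symm.trans ht)
  -- The witnesses of the cyclic order are a rotation of `p x q`. Since `X` is across `p q`, the two
  -- nontrivial rotations would give it two edges of the triangle.
  rcases rot_of_finset_eq k'.2.2.2.1 k.2.2.2.1 hset with ⟨rfl, rfl, rfl⟩ | ⟨rfl, rfl, rfl⟩ |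
    ⟨rfl, rfl, rfl⟩
  · exact ⟨key k ht a1 h1, key (C.rot k) e2 a2 h2⟩
  · exact (a3.1 (C.eq_of_two_edges k ht (by rwa [Sym2.eq_swap] at h3 ⊢) hXm).symm).elim
  · exact (a3.1 (C.eq_of_two_edges (C.rot (C.rot k)) e3 (by rwa [Sym2.eq_swap] at hXm)
      (by rwa [Sym2.eq_swap] at h3)).symm).elim

end Chart

end Dual
section Dual

variable {M : ℕ}

namespace Chart

variable {P : Polygon ℂ (M + 1)} {T : Finset (Finset (Fin (M + 1)))}
  {g ε : Equiv.Perm (Fin (M + 1))} {τ : PTree}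

theorem exists_node (C : Chart P T g ε τ) {a b c : ℕ} (k : labelTri P g T a b c) :
    ∃ t : {t // t ∈ T}, t.1 = {g (Fin.ofNat _ a), g (Fin.ofNat _ b), g (Fin.ofNat _ c)} ∧
      LeftNode P T g ε a b (Sum.inl t) ∧ LeftNode P T g ε b c (Sum.inl t) ∧
      LeftNode P T g ε c a (Sum.inl t) := by
  let t : {t // t ∈ T} := ⟨_, k.2.2.2.2⟩
  refine ⟨t, rfl, Or.inl ⟨c, k, t, rfl, rfl⟩, Or.inl ⟨a, C.rot k, t, ?_, rfl⟩,
    Or.inl ⟨b, C.rot (C.rot k), t, ?_, rfl⟩⟩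
  · simp only [t]; ext; simp; tauto
  · simp only [t]; ext; simp; tauto

theorem exists_top (C : Chart P T g ε τ) {σ : PTree} {p q : ℕ} (hσ : σ.Consec p q)
    (hsub : ∀ a b c, σ.tri p q a b c → labelTri P g T a b c) (hq : q ≤ M) :
    ∃ N, LeftNode P T g ε q p N := by
  cases σ with
  | leaf =>
    have hσ : q = p + 1 := hσ
    subst hσ
    refine ⟨_, Or.inr ⟨⟨p, by omega⟩, ?_, rfl, rfl⟩⟩
    rw [coe_finRotate_of_ne_last]
    intro e
    have := congrArg Fin.val e
    simp at this; omega
  | node l x r =>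
    obtain ⟨t, -, -, -, h⟩ := C.exists_node (hsub p x q (Or.inl (Rot.refl _ _ _)))
    exact ⟨_, h⟩

theorem leftNode_root (_ : Chart P T g ε τ) : LeftNode P T g ε 0 M (Sum.inr (ε (Fin.last M))) :=
  Or.inr ⟨Fin.last M, by rw [finRotate_last]; rfl, rfl, rfl⟩

/-- Across a side of a triangle lies the top triangle of a subtree, a polygon edge, or the parent in
the tree. -/
theorem exists_leftNode_rev (C : Chart P T g ε τ) {a b c : ℕ} (k : labelTri P g T a b c) :
    ∃ N, LeftNode P T g ε b a N := by
  have main : ∀ (σ : PTree) (p q : ℕ), σ.Consec p q → q ≤ M →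
      (∀ a b c, σ.tri p q a b c → labelTri P g T a b c) → (∃ X, LeftNode P T g ε p q X) →
      ∀ a b c, σ.tri p q a b c → ∃ N, LeftNode P T g ε b a N := by
    intro σ
    induction σ with
    | leaf => intro p q _ _ _ _ a b c k; exact k.elim
    | node l x r ihl ihr =>
      intro p q hσ hq hsub hX a b c k
      have hx := hσ.2.lt
      have hsl : ∀ a b c, l.tri p x a b c → labelTri P g T a b c := fun a b c k =>
        hsub a b c (Or.inr (Or.inl k))
      have hsr : ∀ a b c, r.tri x q a b c → labelTri P g T a b c := fun a b c k =>
        hsub a b c (Or.inr (Or.inr k))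
      obtain ⟨t, -, h1, h2, h3⟩ := C.exists_node (hsub p x q (Or.inl (Rot.refl _ _ _)))
      rcases k with (⟨rfl, rfl, rfl⟩ | ⟨rfl, rfl, rfl⟩ | ⟨rfl, rfl, rfl⟩) | k | k
      · exact C.exists_top hσ.1 hsl (by omega)
      · exact C.exists_top hσ.2 hsr (by omega)
      · exact hX
      · exact ihl p x hσ.1 (by omega) hsl ⟨_, h1⟩ a b c k
      · exact ihr x q hσ.2 (by omega) hsr ⟨_, h2⟩ a b c k
  exact main τ 0 M C.consec le_rfl (fun a b c k => (C.tri_iff _ _ _).1 k) ⟨_, C.leftNode_root⟩ a b c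
    ((C.tri_iff _ _ _).2 k)

/-- Exactly the triangle nodes have a counter-clockwise triple of neighbours, so an isomorphism
preserves the kind of a node. -/
theorem exists_ccw (C : Chart P T g ε τ) (t : {t // t ∈ T}) :
    ∃ A B X, P.dualCcw T (Sum.inl t) A B X := by
  obtain ⟨a, b, c, k, ht⟩ := C.labels t.1 t.2
  obtain ⟨A, hA⟩ := C.exists_leftNode_rev k
  obtain ⟨B, hB⟩ := C.exists_leftNode_rev (C.rot k)
  obtain ⟨X, hX⟩ := C.exists_leftNode_rev (C.rot (C.rot k))
  exact ⟨A, B, X, C.ccw k ht hA hB hX⟩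

/-- The common edge and the orientation force the names in `RightReflex`: the vertices can only be
`o`, `u`, `v`, `x` in this order. -/
theorem rightReflex_iff (C : Chart P T g ε τ) {u x v o : ℕ} (k : labelTri P g T u x v)
    (k' : labelTri P g T v o u) :
    P.RightReflex {g (Fin.ofNat _ v), g (Fin.ofNat _ o), g (Fin.ofNat _ u)}
        {g (Fin.ofNat _ u), g (Fin.ofNat _ x), g (Fin.ofNat _ v)} ↔
      orient (toPer (relabel P g) o) (toPer (relabel P g) u) (toPer (relabel P g) x) < 0 := by
  obtain ⟨n1, n2, n3⟩ := C.nes k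
  obtain ⟨m1, m2, m3⟩ := C.nes k'
  have hox : o ≠ x := by
    rintro rfl
    have h1 := k.2.2.2.1
    have h2 := k'.2.2.2.1
    rw [orient_rot, orient_swap'] at h2
    rw [orient_rot, orient_rot] at h1
    have := orient_rot (toPer (relabel P g) v) (toPer (relabel P g) u) (toPer (relabel P g) o)
    linarith
  constructor
  · rintro ⟨u₁, v₁, w₁, z₁, ha, hb, h1, h2⟩
    have hgs : ∀ u : Fin (M + 1), ∃ a : ℕ, a < M + 1 ∧ g (Fin.ofNat _ a) = u := fun u =>
      ⟨(g.symm u : Fin (M + 1)), (g.symm u).2, by rw [ofNat_val, Equiv.apply_symm_apply]⟩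
    obtain ⟨a, la, rfl⟩ := hgs u₁
    obtain ⟨b, lb, rfl⟩ := hgs v₁
    obtain ⟨c, lc, rfl⟩ := hgs w₁
    obtain ⟨d, ld, rfl⟩ := hgs z₁
    have s1 := finset_eq_of_labels g k'.1 k'.2.1 k'.2.2.1 la lb lc ha
    have s2 := finset_eq_of_labels g k.1 k.2.1 k.2.2.1 lb lc ld hb
    have hbm : b ∈ ({u, x, v} : Finset ℕ) := s2 ▸ (by simp)
    have hcm : c ∈ ({u, x, v} : Finset ℕ) := s2 ▸ (by simp)
    have hxm : x ∈ ({b, c, d} : Finset ℕ) := s2 ▸ (by simp)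
    simp only [Finset.mem_insert, Finset.mem_singleton] at hbm hcm hxm
    rcases rot_of_finset_eq h1 k'.2.2.2.1 s1.symm with ⟨rfl, rfl, rfl⟩ | ⟨rfl, rfl, rfl⟩ |
      ⟨rfl, rfl, rfl⟩
    · omega
    · obtain rfl : x = d := by omega
      exact h2
    · omega
  · intro h
    refine ⟨g (Fin.ofNat _ o), g (Fin.ofNat _ u), g (Fin.ofNat _ v), g (Fin.ofNat _ x), ?_, ?_,
      (C.rot k').2.2.2.1, h⟩
    · ext; simp; tauto
    · ext; simp; tauto

end Chart

/-! ### Isomorphic directed duals have equal trees -/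

section Match

variable {M' : ℕ} {P : Polygon ℂ (M + 1)} {T : Finset (Finset (Fin (M + 1)))}
  {g ε : Equiv.Perm (Fin (M + 1))} {τ : PTree} {P' : Polygon ℂ (M' + 1)}
  {T' : Finset (Finset (Fin (M' + 1)))} {g' ε' : Equiv.Perm (Fin (M' + 1))} {τ' : PTree}

theorem exists_inr (C' : Chart P' T' g' ε' τ') (φ : (P.directedDual T).Iso (P'.directedDual T'))
    (i : Fin (M + 1)) : ∃ j, φ.toEquiv (Sum.inr i) = Sum.inr j := by
  rcases h : φ.toEquiv (Sum.inr i) with t | j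
  · exfalso
    obtain ⟨A, B, X, hc⟩ := C'.exists_ccw t
    have := φ.map_ccw (Sum.inr i) (φ.toEquiv.symm A) (φ.toEquiv.symm B) (φ.toEquiv.symm X)
    simp only [Equiv.toFun_as_coe, h, Equiv.apply_symm_apply] at this
    obtain ⟨-, -, -, t, ht, -⟩ := this.1 hc
    exact Sum.inr_ne_inl ht
  · exact ⟨j, rfl⟩

theorem exists_inl (C : Chart P T g ε τ) (φ : (P.directedDual T).Iso (P'.directedDual T'))
    (t : {t // t ∈ T}) : ∃ t', φ.toEquiv (Sum.inl t) = Sum.inl t' := by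
  obtain ⟨A, B, X, hc⟩ := C.exists_ccw t
  obtain ⟨-, -, -, t', ht', -⟩ := (φ.map_ccw _ _ _ _).2 hc
  exact ⟨t', ht'⟩

/-- Both trees are explored together from the base. The kind of the top node tells a leaf from a
triangle, and the counter-clockwise order tells the left subtree from the right one. Labels are
consecutive on both sides, so equal shapes carry equal labels. -/
theorem match_tree (C : Chart P T g ε τ) (C' : Chart P' T' g' ε' τ')
    (φ : (P.directedDual T).Iso (P'.directedDual T')) (σ : PTree) :
    ∀ (σ' : PTree) (p q q' : ℕ), σ.Consec p q → q ≤ M →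
    (∀ a b c, σ.tri p q a b c → labelTri P g T a b c) → σ'.Consec p q' → q' ≤ M' →
    (∀ a b c, σ'.tri p q' a b c → labelTri P' g' T' a b c) →
    ∀ N X, LeftNode P T g ε q p N → LeftNode P T g ε p q X →
    LeftNode P' T' g' ε' q' p (φ.toEquiv N) → LeftNode P' T' g' ε' p q' (φ.toEquiv X) →
    q = q' ∧ σ = σ' ∧
    (∀ k, p ≤ k → k < q →
      φ.toEquiv (Sum.inr (ε (Fin.ofNat _ k))) = Sum.inr (ε' (Fin.ofNat _ k))) ∧
    ∀ a b c, σ.tri p q a b c → ∀ N, LeftNode P T g ε a b N →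
      LeftNode P' T' g' ε' a b (φ.toEquiv N) := by
  have leafNode : ∀ {M : ℕ} {P : Polygon ℂ (M + 1)} {T : Finset (Finset (Fin (M + 1)))}
      {g ε : Equiv.Perm (Fin (M + 1))} {τ : PTree}, Chart P T g ε τ → ∀ {p : ℕ}, p + 1 ≤ M → ∀ {N},
      LeftNode P T g ε (p + 1) p N → N = Sum.inr (ε (Fin.ofNat _ p)) := by
    intro M P T g ε τ C p hp N h
    refine C.leftNode_unique h (Or.inr ⟨Fin.ofNat _ p, ?_, ?_, rfl⟩)
    · rw [finRotate_ofNat]; simp only [Fin.ofNat]; exact (Nat.mod_eq_of_lt (by omega)).symm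
    · simp only [Fin.ofNat]; exact (Nat.mod_eq_of_lt (by omega)).symm
  induction σ with
  | leaf =>
    intro σ' p q q' h1 h2 h3 h1' h2' h3' N X hN hX hN' hX'
    have h1 : q = p + 1 := h1
    subst h1
    have eN := leafNode C h2 hN
    subst eN
    obtain ⟨j, hj⟩ := exists_inr C' φ (ε (Fin.ofNat _ p))
    cases σ' with
    | leaf =>
      have h1' : q' = p + 1 := h1'
      subst h1'
      refine ⟨rfl, rfl, fun k hk hk' => ?_, fun _ _ _ k => k.elim⟩
      obtain rfl : k = p := by omega
      exact leafNode C' h2' hN'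
    | node l' x' r' =>
      obtain ⟨t, -, -, -, ht⟩ := C'.exists_node (h3' p x' q' (Or.inl (Rot.refl _ _ _)))
      have := C'.leftNode_unique ht hN'
      rw [hj] at this
      exact (Sum.inl_ne_inr this).elim
  | node l x r ihl ihr =>
    intro σ' p q q' h1 h2 h3 h1' h2' h3' N X hN hX hN' hX'
    have k := h3 p x q (Or.inl (Rot.refl _ _ _))
    have hlt := h1.1.lt
    have hlt' := h1.2.lt
    obtain ⟨t, ht, d1, d2, d3⟩ := C.exists_node k
    obtain rfl := C.leftNode_unique d3 hN
    obtain ⟨t', ht'⟩ := exists_inl C φ t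
    cases σ' with
    | leaf =>
      have h1' : q' = p + 1 := h1'
      subst h1'
      have := leafNode C' h2' hN'
      rw [ht'] at this
      exact (Sum.inl_ne_inr this).elim
    | node l' x' r' =>
      have k' := h3' p x' q' (Or.inl (Rot.refl _ _ _))
      have gt := h1'.1.lt
      have gt' := h1'.2.lt
      obtain ⟨s, hs, d1', d2', d3'⟩ := C'.exists_node k'
      have es := C'.leftNode_unique d3' hN'
      have hsl : ∀ a b c, l.tri p x a b c → labelTri P g T a b c := fun a b c k =>
        h3 a b c (Or.inr (Or.inl k))
      have hsr : ∀ a b c, r.tri x q a b c → labelTri P g T a b c := fun a b c k =>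
        h3 a b c (Or.inr (Or.inr k))
      obtain ⟨A, hA⟩ := C.exists_top h1.1 hsl (by omega)
      obtain ⟨B, hB⟩ := C.exists_top h1.2 hsr (by omega)
      have hccw : P'.dualCcw T' (φ.toEquiv (Sum.inl t)) (φ.toEquiv A) (φ.toEquiv B) (φ.toEquiv X) :=
        (φ.map_ccw _ _ _ _).2 (C.ccw k ht hA hB hX)
      rw [← es] at hccw
      obtain ⟨hA', hB'⟩ := C'.leftNode_of_ccw k' hs hccw hX'
      rw [es] at d1' d2'
      obtain ⟨rfl, rfl, e1, e2⟩ := ihl l' p x x' h1.1 (by omega) hsl h1'.1 (by omega)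
        (fun a b c k => h3' a b c (Or.inr (Or.inl k))) A _ hA d1 hA' d1'
      obtain ⟨rfl, rfl, e3, e4⟩ := ihr r' x q q' h1.2 (by omega) hsr h1'.2 (by omega)
        (fun a b c k => h3' a b c (Or.inr (Or.inr k))) B _ hB d2 hB' d2'
      refine ⟨rfl, rfl, fun k hk hk' => ?_, ?_⟩
      · rcases lt_or_ge k x with g | g
        · exact e1 k hk g
        · exact e3 k g hk'
      · rintro a b c ((⟨rfl, rfl, rfl⟩ | ⟨rfl, rfl, rfl⟩ | ⟨rfl, rfl, rfl⟩) | k | k) Y hY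
        · rw [C.leftNode_unique hY d1]; exact d1'
        · rw [C.leftNode_unique hY d2]; exact d2'
        · rw [C.leftNode_unique hY d3]; exact hN'
        · exact e2 a b c k Y hY
        · exact e4 a b c k Y hY

/-- An isomorphism of the directed duals that respects the chosen last edges identifies the trees,
the polygon edges, and the reflex vertices. -/
theorem Chart.match (C : Chart P T g ε τ) (C' : Chart P' T' g' ε' τ')
    (φ : (P.directedDual T).Iso (P'.directedDual T'))
    (hφ : φ.toEquiv (Sum.inr (ε (Fin.last M))) = Sum.inr (ε' (Fin.last M'))) :
    M = M' ∧ τ = τ' ∧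
    (∀ k, k < M → φ.toEquiv (Sum.inr (ε (Fin.ofNat _ k))) = Sum.inr (ε' (Fin.ofNat _ k))) ∧
    ∀ u x v o, τ.tri 0 M u x v → τ.tri 0 M v o u →
      (orient (toPer (relabel P g) o) (toPer (relabel P g) u) (toPer (relabel P g) x) < 0 ↔
      orient (toPer (relabel P' g') o) (toPer (relabel P' g') u) (toPer (relabel P' g') x) < 0) := by
  have hsub : ∀ a b c, τ.tri 0 M a b c → labelTri P g T a b c := fun a b c => (C.tri_iff _ _ _).1
  have hsub' : ∀ a b c, τ'.tri 0 M' a b c → labelTri P' g' T' a b c := fun a b c =>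
    (C'.tri_iff _ _ _).1
  obtain ⟨N, hN⟩ := C.exists_top C.consec hsub le_rfl
  have hX := C.leftNode_root
  have hX' := C'.leftNode_root
  -- A node adjacent to the base terminal shares its only edge, and hence lies on the other side of
  -- it.
  have hN' : LeftNode P' T' g' ε' M' 0 (φ.toEquiv N) := by
    have hadj := (φ.map_adj _ _).2 (C.adj hX hN)
    simp only [Equiv.toFun_as_coe] at hadj
    rw [hφ] at hadj
    obtain ⟨hne, e, h1, h2⟩ := hadj
    have h1 : e = s(ε' (Fin.last M'), finRotate _ (ε' (Fin.last M'))) := h1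
    rw [h1, ← C'.edge, finRotate_last, Sym2.eq_swap, ← ofNat_val (0 : Fin (M' + 1)),
      ← ofNat_val (Fin.last M')] at h2
    rcases C'.leftNode_of_mem (by simp) (by simp) h2 with h | h
    · exact (hne (C'.leftNode_unique hX' h)).elim
    · exact h
  rw [← hφ] at hX'
  obtain ⟨rfl, rfl, e1, e2⟩ := match_tree C C' φ τ τ' 0 M M' C.consec le_rfl hsub C'.consec le_rfl
    hsub' N _ hN hX hN' hX'
  refine ⟨rfl, rfl, fun k hk => e1 k (Nat.zero_le _) hk, fun u x v o k1 k2 => ?_⟩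
  have l1 := hsub _ _ _ k1
  have l2 := hsub _ _ _ k2
  have l1' := hsub' _ _ _ k1
  have l2' := hsub' _ _ _ k2
  obtain ⟨B, hB, b1, b2, b3⟩ := C.exists_node l1
  obtain ⟨A, hA, a1, a2, a3⟩ := C.exists_node l2
  obtain ⟨B', hB', b1', b2', b3'⟩ := C'.exists_node l1'
  obtain ⟨A', hA', a1', a2', a3'⟩ := C'.exists_node l2'
  have eA := C'.leftNode_unique (e2 _ _ _ k2 _ a1) a1'
  have eB := C'.leftNode_unique (e2 _ _ _ k1 _ b1) b1'
  have harc := φ.map_arc (Sum.inl A) (Sum.inl B)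
  simp only [Equiv.toFun_as_coe, eA, eB] at harc
  have arc : ∀ {M : ℕ} {P : Polygon ℂ (M + 1)} {T : Finset (Finset (Fin (M + 1)))}
      {A B : {t // t ∈ T}}, (dualGraph T).Adj (Sum.inl A) (Sum.inl B) →
      ((P.directedDual T).arc (Sum.inl A) (Sum.inl B) ↔ P.RightReflex A.1 B.1) := by
    intro M P T A B hadj
    constructor
    · rintro ⟨-, a, b, e1, e2, h⟩
      rwa [Sum.inl.inj e1, Sum.inl.inj e2]
    · exact fun h => ⟨hadj, A, B, rfl, rfl, h⟩
  rw [arc (C.adj a3 b3), arc (C'.adj a3' b3'), hA, hB, hA', hB', C.rightReflex_iff l1 l2,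
    C'.rightReflex_iff l1' l2'] at harc
  exact harc.symm

end Match
end Dual

/-- A deflated polygon is described by a tree over any of its edges. -/
theorem exists_chart {M : ℕ} {P : Polygon ℂ (M + 1)} {T : Finset (Finset (Fin (M + 1)))}
    (hP : P.IsSimple) (hd : P.IsDeflated) (hT : P.IsTriangulation T) (r : Fin (M + 1)) :
    ∃ (b : Bool) (g ε : Equiv.Perm (Fin (M + 1))) (τ : PTree), Dihedral g ε b ∧
      ε (Fin.last M) = r ∧ Chart P T g ε τ ∧ Realizes (τ.tri 0 M)
        (fun o u x => orient (toPer (relabel P g) o) (toPer (relabel P g) u)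
          (toPer (relabel P g) x) < 0) (toPer (relabel P g)) := by
  obtain ⟨b, g, ε, h, hr, hl⟩ := exists_dihedral_left hP r
  obtain ⟨τ, h1, h2, h3, h4⟩ := (deflated_relabel hP hd hT h hl).exists_tree
  exact ⟨b, g, ε, τ, h, hr, ⟨h.edge, h1, h2, h3, fun t ht => exists_labels hT g ht⟩, h4⟩

end Polygon

/-! ### The theorem -/

open Polygon in
theorem mainTheorem3 {n m : ℕ} (P : Polygon ℂ n) (P' : Polygon ℂ m)
    (hP : P.IsSimple) (hP' : P'.IsSimple) (hdP : P.IsDeflated) (hdP' : P'.IsDeflated)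
    (T : Finset (Finset (Fin n))) (T' : Finset (Finset (Fin m)))
    (hT : P.IsTriangulation T) (hT' : P'.IsTriangulation T')
    (φ : (P.directedDual T).Iso (P'.directedDual T')) :
    ∃ e : Fin n ≃ Fin m, Polygon.Corresponds φ e ∧
      ∃ γ : unitInterval → Polygon ℂ n, P.IsMonotonicDeformation γ ∧
        ∀ i : Fin n, γ 1 i = P' (e i) := by
  obtain ⟨M, rfl⟩ : ∃ M, n = M + 1 := ⟨n - 1, by have := hP.1; omega⟩
  obtain ⟨M', rfl⟩ : ∃ M, m = M + 1 := ⟨m - 1, by have := hP'.1; omega⟩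
  -- An arbitrary chart of `P'` suffices to see that `φ` sends terminal nodes to terminal nodes; the
  -- charts used afterwards are based at corresponding polygon edges.
  obtain ⟨_, _, _, _, _, _, C₀, _⟩ := exists_chart hP' hdP' hT' 0
  obtain ⟨r', hr'⟩ := exists_inr C₀ φ (Fin.last M)
  obtain ⟨b, g, ε, τ, hg, hε, C, hR⟩ := exists_chart hP hdP hT (Fin.last M)
  obtain ⟨b', g', ε', τ', hg', hε', C', hR'⟩ := exists_chart hP' hdP' hT' r'
  obtain ⟨rfl, rfl, hk, hfl⟩ := C.match C' φ (by rw [hε, hε', hr'])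
  have hterm : ∀ k, φ.toEquiv (Sum.inr (ε k)) = Sum.inr (ε' k) := by
    intro k
    by_cases hl : k = Fin.last M
    · rw [hl, hε, hε', hr']
    · have := hk k (by have := k.2; have : (k : ℕ) ≠ M := fun e => hl (Fin.ext e); omega)
      rwa [ofNat_val] at this
  -- Both polygons realize the same tree with the reflex vertices of `P`.
  have hR'' : Realizes (τ.tri 0 M) (fun o u x => orient (toPer (relabel P g) o)
      (toPer (relabel P g) u) (toPer (relabel P g) x) < 0) (toPer (relabel P' g')) :=
    ⟨hR'.pos, hR'.cplx, fun u x v o k k' => hfl u x v o k k', hR'.reflex⟩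
  have hsize : ∃ N, τ.size = N + 1 := by
    cases τ with
    | leaf => exact (C.ne_leaf rfl).elim
    | node l x r => exact ⟨_, rfl⟩
  obtain ⟨N, hN⟩ := hsize
  obtain ⟨path, hpath⟩ := joinedIn_realizes N hN C.consec.wf hR hR''
  let γ : unitInterval → Polygon ℂ (M + 1) := fun s => ⟨fun i => path s (g.symm i : Fin (M + 1))⟩
  have hγ : ∀ s, relabel (γ s) g = ofSeq (path s) (M + 1) := by
    intro s
    show (⟨_⟩ : Polygon ℂ (M + 1)) = ⟨_⟩
    congr 1
    ext i
    simp [γ]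
  refine ⟨g.symm.trans g', ?_, γ, ⟨⟨?_, ?_, ?_⟩, ?_⟩, ?_⟩
  · intro i
    obtain ⟨k, rfl⟩ := ε.surjective i
    refine ⟨ε' k, hterm k, ?_⟩
    rw [← C'.edge]
    have := C.edge k
    rw [Sym2.eq_iff] at this ⊢
    rcases this with ⟨e1, e2⟩ | ⟨e1, e2⟩
    · rw [← e2, ← e1]; simp
    · rw [← e1, ← e2]; simp
  · show (⟨_⟩ : Polygon ℂ (M + 1)) = P
    cases P
    congr 1
    ext i
    rw [path.source, toPer_symm]
  · intro i
    exact (continuous_apply ((g.symm i : Fin (M + 1)) : ℕ)).comp path.continuous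
  · intro s
    rw [← isSimple_relabel hg, hγ]
    exact isSimple_ofSeq C.consec C.ne_leaf (hpath s)
  · intro s t _ i j hv
    -- Visibility is expressed by the tree alone, independently of the time.
    have key : ∀ s, (γ s).Visible i j ↔ g.symm i = g.symm j ∨ ∃ c,
        τ.tri 0 M (g.symm i : Fin (M + 1)) (g.symm j : Fin (M + 1)) c ∨
        τ.tri 0 M (g.symm j : Fin (M + 1)) (g.symm i : Fin (M + 1)) c := by
      intro s
      rw [← visible_ofSeq_iff C.consec C.ne_leaf (hpath s), ← hγ, visible_relabel hg]
      simp
    rw [key] at hv ⊢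
    exact hv
  · intro i
    show path 1 _ = _
    rw [path.target, toPer_val]
    rfl
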